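/- Let $n\ge 1$, let $(M^{2n+1},\xi=\ker\alpha)$ be a contact manifold, $\Sigma^{2n}\subset M$ an oriented (smoothly embedded) hypersurface and $\beta=\alpha|_\Sigma$. The characteristic foliation of $\Sigma$ is the singular line field $\ker(d\beta|_{\ker\beta})$, oriented so that a vector field $X$ directing it satisfies $i_X\Omega=\beta\wedge(d\beta)^{n-1}$ (away from the singular points, up to a positive factor), where $\Omega$ is a positive volume form on $\Sigma$. Let $\gamma$ be a hyperbolic periodic orbit of the characteristic foliation: if $P:V\to L$ is a Poincaré first return map of $X$ on a transversal $L\subset\Sigma$ meeting $\gamma$ once, at a point $x_0$ (where $V\ni x_0$ is an open subset of $L$ on which the first return time is defined and continuous), then every eigenvalue $\mu\in\mathbb{C}$ of $T_{x_0}P$ satisfies $0<|\mu|\neq 1$. Then: 1. $\gamma$ is Liouville: there is a smooth function $g>0$ on a neighborhood of $\gamma$ such that $g\beta$ is a Liouville form there, i.e. $d(g\beta)$ is symplectic. 2. For every Poincaré first return map $P:V\to L$ as above, $P^*(\beta|_L)=f\,\beta|_L$ on $V$ for some function $f>0$, and $f(x_0)\neq1$. Moreover $\gamma$ is positive Liouville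 (that is, $d(g\beta)^n>0$ near $\gamma$ for some smooth $g>0$) if and only if $f(x_0)>1$, and negative Liouville ($d(g\beta)^n<0$ near $\gamma$ for some smooth $g>0$) if and only if $f(x_0)<1$. 3. If $\gamma$ is positive Liouville, then $\operatorname{ind}(\gamma)\le n$. Here $\operatorname{ind}(\gamma)=\dim E^-+1$ is the dimension of the stable manifold of $\gamma$, where $E^-$ is the space of generalized eigenvectors of $T_{x_0}P$ with eigenvalues of modulus less than $1$, and the summand $1$ accounts for the direction of the orbit. -/

import Mathlib

universe u

open scoped Manifold ContDiff Topology TensorProduct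
open Set

/-- The model space `ℝ^d`. -/
abbrev Euc (d : ℕ) : Type := EuclideanSpace ℝ (Fin d)

noncomputable section

/-! ### Differential forms on manifolds -/

section Forms

variable {E : Type*} [NormedAddCommGroup E] [NormedSpace ℝ E]
  {E' : Type*} [NormedAddCommGroup E'] [NormedSpace ℝ E']

/-- A (not necessarily smooth) differential `p`-form on a boundaryless manifold `N`
modelled on `E`. -/
abbrev DForm (E : Type*) [NormedAddCommGroup E] [NormedSpace ℝ E]
    (N : Type*) [TopologicalSpace N] [ChartedSpace E N] (p : ℕ) : Type _ :=
  ∀ x : N, (TangentSpace 𝓘(ℝ, E) x) [⋀^Fin p]→L[ℝ] ℝ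

variable {N : Type*} [TopologicalSpace N] [ChartedSpace E N]
  {N' : Type*} [TopologicalSpace N'] [ChartedSpace E' N']

namespace DForm

/-- Pullback `f^*η` of a differential form. -/
def pullback {p : ℕ} (f : N → N') (η : DForm E' N' p) : DForm E N p :=
  fun x => (η (f x)).compContinuousLinearMap (mfderiv 𝓘(ℝ, E) 𝓘(ℝ, E') f x)

/-- The expression of `η` in the chart at `x₀`, i.e. the pullback of `η` under the inverse of the
chart (meaningful on the open target of the chart). -/
def inChart {p : ℕ} (η : DForm E N p) (x₀ : N) : E → E [⋀^Fin p]→L[ℝ] ℝ :=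
  fun y => (η ((extChartAt 𝓘(ℝ, E) x₀).symm y)).compContinuousLinearMap
    (mfderiv 𝓘(ℝ, E) 𝓘(ℝ, E) (extChartAt 𝓘(ℝ, E) x₀).symm y)

/-- A differential form is smooth if it is smooth in every chart of the atlas of `N` of the form
`chartAt x₀` (these cover `N`). -/
def IsSmooth {p : ℕ} (η : DForm E N p) : Prop :=
  ∀ x₀ : N, ContDiffOn ℝ ∞ (η.inChart x₀) (extChartAt 𝓘(ℝ, E) x₀).target

/-- The exterior derivative: at `x`, take the exterior derivative in the chart at `x` and pull it
back to `N`. -/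
def d {p : ℕ} (η : DForm E N p) : DForm E N (p + 1) :=
  fun x =>
    (extDeriv (η.inChart x) (extChartAt 𝓘(ℝ, E) x x)).compContinuousLinearMap
      (mfderiv 𝓘(ℝ, E) 𝓘(ℝ, E) (extChartAt 𝓘(ℝ, E) x) x : E →L[ℝ] E)

/-- The form `g η` for a function `g`. -/
def fsmul {p : ℕ} (g : N → ℝ) (η : DForm E N p) : DForm E N p := fun x => g x • η x

end DForm

end Forms

/-! ### Powers of a two-form -/

section Wedge

variable {V : Type*} [AddCommGroup V] [Module ℝ V] [TopologicalSpace V]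

/-- The value of the exterior power `η^m = η ∧ ⋯ ∧ η` on `v₀, …, v_{2m-1}`. -/
def wedgePow (η : V [⋀^Fin 2]→L[ℝ] ℝ) (m : ℕ) (v : Fin (2 * m) → V) : ℝ :=
  (1 / 2 ^ m : ℝ) * ∑ σ : Equiv.Perm (Fin (2 * m)), ((Equiv.Perm.sign σ : ℤ) : ℝ) *
    ∏ i : Fin m, η ![v (σ ⟨2 * i, by omega⟩), v (σ ⟨2 * i + 1, by omega⟩)]

/-- The value of `b ∧ η^m` on `v₀, …, v_{2m}`, for a covector `b` and a two-form `η`. -/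
def oneWedgePow (b : V [⋀^Fin 1]→L[ℝ] ℝ) (η : V [⋀^Fin 2]→L[ℝ] ℝ) (m : ℕ)
    (v : Fin (2 * m + 1) → V) : ℝ :=
  (1 / 2 ^ m : ℝ) * ∑ σ : Equiv.Perm (Fin (2 * m + 1)), ((Equiv.Perm.sign σ : ℤ) : ℝ) *
    (b ![v (σ 0)] *
      ∏ i : Fin m, η ![v (σ ⟨2 * i + 1, by omega⟩), v (σ ⟨2 * i + 2, by omega⟩)])

end Wedge

/-! ### Contact forms, volume forms, characteristic foliation -/

section Contact

/-- `α` is a contact form on the `(2n+1)`-manifold `M`: `α ∧ (dα)^n` vanishes nowhere. -/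
def IsContactForm {n : ℕ} {M : Type*} [TopologicalSpace M] [ChartedSpace (Euc (2 * n + 1)) M]
    (α : DForm (Euc (2 * n + 1)) M 1) : Prop :=
  α.IsSmooth ∧ ∀ x : M, ∃ v : Fin (2 * n + 1) → TangentSpace 𝓘(ℝ, Euc (2 * n + 1)) x,
    oneWedgePow (α x) (α.d x) n v ≠ 0

/-- `Ω` is a volume form: a nowhere vanishing smooth form of top degree. -/
def IsVolumeForm {d : ℕ} {N : Type*} [TopologicalSpace N] [ChartedSpace (Euc d) N]
    (Ω : DForm (Euc d) N d) : Prop :=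
  Ω.IsSmooth ∧ ∀ x : N, Ω x ≠ 0

/-- The (singular) characteristic distribution `ker (dβ|_{ker β})` of a one-form `β`. -/
def charFoliation {E : Type*} [NormedAddCommGroup E] [NormedSpace ℝ E]
    {S : Type*} [TopologicalSpace S] [ChartedSpace E S]
    (β : DForm E S 1) (x : S) : Set (TangentSpace 𝓘(ℝ, E) x) :=
  {v | β x ![v] = 0 ∧ ∀ w : TangentSpace 𝓘(ℝ, E) x, β x ![w] = 0 → β.d x ![v, w] = 0}

/-- On `S` of dimension `2n = 2(k+1)`, oriented by the volume form `Ω`, the smooth vector field `X`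
directs the characteristic foliation of `β` with its orientation: `X` spans the foliation at each
point, and `i_X Ω` has the sign of `β ∧ (dβ)^{n-1}`. -/
structure DirectsCharFoliation {k : ℕ} {S : Type*} [TopologicalSpace S]
    [ChartedSpace (Euc (2 * (k + 1))) S] [IsManifold 𝓘(ℝ, Euc (2 * (k + 1))) ∞ S]
    (Ω : DForm (Euc (2 * (k + 1))) S (2 * (k + 1)))
    (β : DForm (Euc (2 * (k + 1))) S 1)
    (X : ∀ x : S, TangentSpace 𝓘(ℝ, Euc (2 * (k + 1))) x) : Prop where
  smooth : ContMDiff 𝓘(ℝ, Euc (2 * (k + 1))) 𝓘(ℝ, Euc (2 * (k + 1))).tangent ∞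
    (fun x => (⟨x, X x⟩ : TangentBundle 𝓘(ℝ, Euc (2 * (k + 1))) S))
  spans : ∀ x, charFoliation β x = (Submodule.span ℝ {X x} : Set _)
  oriented : ∀ (x : S) (v : Fin (2 * k + 1) → TangentSpace 𝓘(ℝ, Euc (2 * (k + 1))) x),
    0 < oneWedgePow (β x) (β.d x) k v →
      0 < Ω x (Fin.cons (X x) v : Fin (2 * k + 1 + 1) → TangentSpace 𝓘(ℝ, Euc (2 * (k + 1))) x)

end Contact

/-! ### Periodic orbits and Poincaré return maps -/

section Dynamics

/-- `γ` parametrizes a periodic orbit of `X`, with minimal period `T > 0`. -/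
structure IsPeriodicOrbit {E : Type*} [NormedAddCommGroup E] [NormedSpace ℝ E]
    {S : Type*} [TopologicalSpace S] [ChartedSpace E S]
    (X : ∀ x : S, TangentSpace 𝓘(ℝ, E) x) (γ : ℝ → S) (T : ℝ) : Prop where
  integralCurve : IsMIntegralCurve (I := 𝓘(ℝ, E)) γ X
  period_pos : 0 < T
  periodic : Function.Periodic γ T
  injOn : InjOn γ (Ico 0 T)

/-- A Poincaré first return map of the vector field `X` along the orbit `γ`, on a manifold of
dimension `d + 1`. -/
structure ReturnMap {d : ℕ} {S : Type u} [TopologicalSpace S] [ChartedSpace (Euc (d + 1)) S]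
    (X : ∀ x : S, TangentSpace 𝓘(ℝ, Euc (d + 1)) x) (γ : ℝ → S) where
  /-- the transversal, an embedded hypersurface -/
  L : Type u
  [top : TopologicalSpace L]
  [charted : ChartedSpace (Euc d) L]
  [manifold : IsManifold 𝓘(ℝ, Euc d) ∞ L]
  /-- the inclusion of the transversal -/
  incl : L → S
  embedding : Manifold.IsSmoothEmbedding 𝓘(ℝ, Euc d) 𝓘(ℝ, Euc (d + 1)) ∞ incl
  transverse : ∀ y : L,
    X (incl y) ∉ range (mfderiv 𝓘(ℝ, Euc d) 𝓘(ℝ, Euc (d + 1)) incl y)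
  /-- the only point of the transversal on the orbit -/
  base : L
  meets_once : ∀ y : L, incl y ∈ range γ ↔ y = base
  /-- the domain of the return map -/
  V : Set L
  isOpen_V : IsOpen V
  base_mem : base ∈ V
  /-- the return map (only its values on `V` matter) -/
  P : L → L
  /-- the first return time (only its values on `V` matter) -/
  τ : L → ℝ
  τ_pos : ∀ y ∈ V, 0 < τ y
  τ_cont : ContinuousOn τ V
  /-- `P y` is where the trajectory of `X` starting at `y` returns to `L` for the first time -/
  first_return : ∀ y ∈ V, ∃ c : ℝ → S,
    IsMIntegralCurveOn (I := 𝓘(ℝ, Euc (d + 1))) c X (Icc 0 (τ y)) ∧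
    c 0 = incl y ∧ c (τ y) = incl (P y) ∧ ∀ t ∈ Ioo 0 (τ y), c t ∉ range incl

attribute [instance] ReturnMap.top ReturnMap.charted ReturnMap.manifold

namespace ReturnMap

variable {d : ℕ} {S : Type u} [TopologicalSpace S] [ChartedSpace (Euc (d + 1)) S]
  {X : ∀ x : S, TangentSpace 𝓘(ℝ, Euc (d + 1)) x} {γ : ℝ → S}

/-- The differential of the return map at the fixed point `base`, as an endomorphism of the tangent
space of the transversal at `base`. -/
def TP (R : ReturnMap X γ) : Euc d →ₗ[ℝ] Euc d :=
  ContinuousLinearMap.toLinearMap (M := Euc d) (M₂ := Euc d)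
    (mfderiv 𝓘(ℝ, Euc d) 𝓘(ℝ, Euc d) R.P R.base)

/-- The complexification of `TP`. -/
def TPC (R : ReturnMap X γ) : Module.End ℂ (ℂ ⊗[ℝ] Euc d) := R.TP.baseChange ℂ

/-- The dimension of the stable manifold of the orbit: the dimension of the space `E⁻` of
generalized eigenvectors of `TP` with eigenvalues of modulus less than one, plus one for the
direction of the orbit. -/
def index (R : ReturnMap X γ) : ℕ :=
  Module.finrank ℂ (⨆ μ ∈ {μ : ℂ | ‖μ‖ < 1}, R.TPC.maxGenEigenspace μ :
    Submodule ℂ (ℂ ⊗[ℝ] Euc d)) + 1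

/-- `f` is the conformal factor of the return map with respect to the one-form `β` on the ambient
manifold: `P^* (β|_L) = f β|_L` on `V`, with `f > 0`. -/
def IsConformalFactor (R : ReturnMap X γ) (β : DForm (Euc (d + 1)) S 1) (f : R.L → ℝ) : Prop :=
  ∀ y ∈ R.V, 0 < f y ∧ MDifferentiableAt 𝓘(ℝ, Euc d) 𝓘(ℝ, Euc d) R.P y ∧
    DForm.pullback R.P (DForm.pullback R.incl β : DForm (Euc d) R.L 1) y =
      f y • (DForm.pullback R.incl β : DForm (Euc d) R.L 1) y

end ReturnMap

/-- The orbit `γ` of `X` is hyperbolic: the eigenvalues `μ` of the differential of a Poincaré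
return map satisfy `0 < |μ| ≠ 1`. (This does not depend on the choice of the return map.) -/
def IsHyperbolicOrbit {d : ℕ} {S : Type u} [TopologicalSpace S] [ChartedSpace (Euc (d + 1)) S]
    (X : ∀ x : S, TangentSpace 𝓘(ℝ, Euc (d + 1)) x) (γ : ℝ → S) : Prop :=
  ∃ R : ReturnMap X γ, ∀ μ : ℂ, R.TPC.HasEigenvalue μ → 0 < ‖μ‖ ∧ ‖μ‖ ≠ 1

end Dynamics

/-! ### Liouville orbits -/

section Liouville

variable {n : ℕ} {S : Type*} [TopologicalSpace S] [ChartedSpace (Euc (2 * n)) S]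

/-- `g` is a smooth positive function on the open neighbourhood `U` of the orbit `γ`. -/
def IsPosFunctionNear (γ : ℝ → S) (U : Set S) (g : S → ℝ) : Prop :=
  IsOpen U ∧ range γ ⊆ U ∧ ContMDiffOn 𝓘(ℝ, Euc (2 * n)) 𝓘(ℝ) ∞ g U ∧ ∀ x ∈ U, 0 < g x

/-- `γ` is Liouville: near `γ`, `gβ` is a Liouville form for some smooth `g > 0`, i.e. the closed
two-form `d(gβ)` is nondegenerate. -/
def IsLiouvilleOrbit (β : DForm (Euc (2 * n)) S 1) (γ : ℝ → S) : Prop :=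
  ∃ (U : Set S) (g : S → ℝ), IsPosFunctionNear (n := n) γ U g ∧
    ∀ x ∈ U, ∀ v : TangentSpace 𝓘(ℝ, Euc (2 * n)) x,
      (∀ w : TangentSpace 𝓘(ℝ, Euc (2 * n)) x, (β.fsmul g).d x ![v, w] = 0) → v = 0

/-- `γ` is positive Liouville: `d(gβ)^n > 0` near `γ` for some smooth `g > 0`, where positivity
refers to the orientation given by the volume form `Ω`. -/
def IsPositiveLiouville (Ω : DForm (Euc (2 * n)) S (2 * n)) (β : DForm (Euc (2 * n)) S 1)
    (γ : ℝ → S) : Prop :=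
  ∃ (U : Set S) (g : S → ℝ), IsPosFunctionNear (n := n) γ U g ∧
    ∀ x ∈ U, ∀ v : Fin (2 * n) → TangentSpace 𝓘(ℝ, Euc (2 * n)) x,
      0 < Ω x v → 0 < wedgePow ((β.fsmul g).d x) n v

/-- `γ` is negative Liouville: `d(gβ)^n < 0` near `γ` for some smooth `g > 0`. -/
def IsNegativeLiouville (Ω : DForm (Euc (2 * n)) S (2 * n)) (β : DForm (Euc (2 * n)) S 1)
    (γ : ℝ → S) : Prop :=
  ∃ (U : Set S) (g : S → ℝ), IsPosFunctionNear (n := n) γ U g ∧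
    ∀ x ∈ U, ∀ v : Fin (2 * n) → TangentSpace 𝓘(ℝ, Euc (2 * n)) x,
      0 < Ω x v → wedgePow ((β.fsmul g).d x) n v < 0

end Liouville

end

/-!
Let `X` direct the characteristic foliation. Away from the zeros of `X` the contact condition
implies that `β` does not vanish, and the definition of the foliation gives `β(X) = 0` and
`i_X dβ = c β` for a function `c`, which is smooth there. Hence the Lie derivative of `β` along
`X` is `c β`. All assertions about the orbit `γ`, of period `T`, are read off from the number
`I = ∫₀ᵀ c(γ t) dt`.

*Return maps.* The flow along an orbit segment multiplies `β` by the exponential of the integral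
of `c`, and multiplies `dβ` on `ker β` by the same factor (`IsCharField.exists_isTransport`). A
return map `P` is obtained from the flow by letting the time depend on the point. This changes the
differential by multiples of `X` only, which are invisible to `β`, and to `dβ` on `ker β`
(`IsCharField.return_map`). So `P^*(β|_L) = f β|_L` with `f > 0`, and `f(x₀) = exp I`, as the
first return time of the base point is the period. A linear form that is multiplied by `f(x₀)`
under `T_{x₀}P` shows that `f(x₀)` is an eigenvalue, so hyperbolicity gives `I ≠ 0`
(`IsCharField.integral_ne_zero_of_hyperbolic`).

*Liouville forms.* For `g > 0` one has `i_X d(gβ) = s β` with `s = dg(X) + g c`, and the top power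
of `d(gβ)` is a positive multiple of `s Ω` (`DirectsCharFoliation.exists_wedgePow_eq`, where the
orientation of `X` enters). If `s` has a constant sign along `γ`, this is the sign of `I`:
integrate `s / g = (log g)' + c` over a period (`IsCharField.integral_coeff_pos`). Conversely, if
`I ≠ 0`, the function `I t / T - ∫₀ᵗ c(γ)` of the time is smooth and `T`-periodic, so it extends
from `γ` to a smooth function `log g` on the hypersurface, and then `s = g I / T` along `γ`, which
has the sign of `I` (`IsCharField.exists_pos_function`).

*The index.* If `I > 0`, then `T_{x₀}P` multiplies `β|_L`, and the form `dβ`, which is symplectic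
on the `2k`-dimensional space `ker β|_L`, by `f(x₀) > 1`. A generalized eigenvector with
eigenvalue of modulus less than `1` lies in the kernel of `β|_L`, and two of them are orthogonal
for `dβ`, since the product of the eigenvalues is not `f(x₀)`. So the contracting space is
isotropic, of dimension at most `k` (`finrank_contracting_le`).
-/

/-! ### Powers of two-forms: linear algebra -/

section LinearAlgebra

variable {V : Type*} [AddCommGroup V] [Module ℝ V]

/-- The linear form underlying a one-form. -/
noncomputable def ContinuousAlternatingMap.toLin [TopologicalSpace V] (b : V [⋀^Fin 1]→L[ℝ] ℝ) :
    V →ₗ[ℝ] ℝ where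
  toFun v := b ![v]
  map_add' x y := b.toAlternatingMap.map_vecCons_add ![] x y
  map_smul' c x := b.toAlternatingMap.map_vecCons_smul ![] c x

@[simp] theorem ContinuousAlternatingMap.toLin_apply [TopologicalSpace V]
    (b : V [⋀^Fin 1]→L[ℝ] ℝ) (v : V) : b.toLin v = b ![v] := rfl

/-- The bilinear form underlying a two-form. -/
noncomputable def ContinuousAlternatingMap.toBilin [TopologicalSpace V]
    (η : V [⋀^Fin 2]→L[ℝ] ℝ) : V →ₗ[ℝ] V →ₗ[ℝ] ℝ :=
  have hu : ∀ x y z : V, Function.update ![x, y] 1 z = ![x, z] := fun x y z => by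
    funext i; fin_cases i <;> rfl
  LinearMap.mk₂ ℝ (fun v w => η ![v, w])
    (fun x y z => η.toAlternatingMap.map_vecCons_add ![z] x y)
    (fun c x z => η.toAlternatingMap.map_vecCons_smul ![z] c x)
    (fun x y z => by simpa only [hu] using η.map_update_add ![x, y] 1 y z)
    (fun c x z => by simpa only [hu] using η.map_update_smul ![x, z] 1 c z)

@[simp] theorem ContinuousAlternatingMap.toBilin_apply [TopologicalSpace V]
    (η : V [⋀^Fin 2]→L[ℝ] ℝ) (v w : V) : η.toBilin v w = η ![v, w] := rfl

theorem ContinuousAlternatingMap.toBilin_isAlt [TopologicalSpace V] (η : V [⋀^Fin 2]→L[ℝ] ℝ) :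
    η.toBilin.IsAlt := fun v => by
  rw [toBilin_apply]
  exact η.map_eq_zero_of_eq ![v, v] (i := 0) (j := 1) rfl (by decide)

/-- The multilinear map `∏ B (v₂ᵢ, v₂ᵢ₊₁)`. -/
noncomputable def pairProd (B : V →ₗ[ℝ] V →ₗ[ℝ] ℝ) :
    ∀ m : ℕ, MultilinearMap ℝ (fun _ : Fin (2 * m) => V) ℝ
  | 0 => haveI : IsEmpty (Fin (2 * 0)) := Fin.isEmpty; MultilinearMap.constOfIsEmpty ℝ _ 1
  | m + 1 => LinearMap.uncurryLeft (n := 2 * m + 1) (M := fun _ => V)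
      { toFun := fun x => LinearMap.uncurryLeft (n := 2 * m) (M := fun _ => V)
          ((B x).smulRight (pairProd B m))
        map_add' := fun x y => by ext v; simp [add_mul]
        map_smul' := fun c x => by ext v; simp [mul_assoc] }

theorem pairProd_apply (B : V →ₗ[ℝ] V →ₗ[ℝ] ℝ) (m : ℕ) (v : Fin (2 * m) → V) :
    pairProd B m v = ∏ i : Fin m, B (v ⟨2 * i, by omega⟩) (v ⟨2 * i + 1, by omega⟩) := by
  induction m with
  | zero => simp [pairProd]
  | succ m ih =>
    rw [Fin.prod_univ_succ]
    have h : pairProd B (m + 1) v = B (v 0) (v 1) *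
        pairProd B m (Fin.tail (n := 2 * m) (Fin.tail (n := 2 * m + 1) v)) := rfl
    rw [h, ih]
    rfl

/-- The exterior power `B^m = B ∧ ⋯ ∧ B`, as an alternating map; the normalization is that of
`wedgePow`. -/
noncomputable def wedgeAlt (B : V →ₗ[ℝ] V →ₗ[ℝ] ℝ) (m : ℕ) : V [⋀^Fin (2 * m)]→ₗ[ℝ] ℝ :=
  (1 / 2 ^ m : ℝ) • MultilinearMap.alternatization (pairProd B m)

/-- The alternating map `f ∧ B^m`, with the normalization of `oneWedgePow`. -/
noncomputable def oneWedgeAlt (f : V →ₗ[ℝ] ℝ) (B : V →ₗ[ℝ] V →ₗ[ℝ] ℝ) (m : ℕ) :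
    V [⋀^Fin (2 * m + 1)]→ₗ[ℝ] ℝ :=
  (1 / 2 ^ m : ℝ) • MultilinearMap.alternatization
    (LinearMap.uncurryLeft (n := 2 * m) (M := fun _ => V) (f.smulRight (pairProd B m)))

theorem wedgeAlt_apply (B : V →ₗ[ℝ] V →ₗ[ℝ] ℝ) (m : ℕ) (v : Fin (2 * m) → V) :
    wedgeAlt B m v = (1 / 2 ^ m : ℝ) * ∑ σ : Equiv.Perm (Fin (2 * m)),
      ((Equiv.Perm.sign σ : ℤ) : ℝ) *
        ∏ i : Fin m, B (v (σ ⟨2 * i, by omega⟩)) (v (σ ⟨2 * i + 1, by omega⟩)) := by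
  rw [wedgeAlt, AlternatingMap.smul_apply, MultilinearMap.alternatization_apply, smul_eq_mul]
  congr 1
  refine Finset.sum_congr rfl fun σ _ => ?_
  rw [Units.smul_def, zsmul_eq_mul, MultilinearMap.domDomCongr_apply, pairProd_apply]

theorem oneWedgeAlt_apply (f : V →ₗ[ℝ] ℝ) (B : V →ₗ[ℝ] V →ₗ[ℝ] ℝ) (m : ℕ)
    (v : Fin (2 * m + 1) → V) :
    oneWedgeAlt f B m v = (1 / 2 ^ m : ℝ) * ∑ σ : Equiv.Perm (Fin (2 * m + 1)),
      ((Equiv.Perm.sign σ : ℤ) : ℝ) * (f (v (σ 0)) *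
        ∏ i : Fin m, B (v (σ ⟨2 * i + 1, by omega⟩)) (v (σ ⟨2 * i + 2, by omega⟩))) := by
  rw [oneWedgeAlt, AlternatingMap.smul_apply, MultilinearMap.alternatization_apply, smul_eq_mul]
  congr 1
  refine Finset.sum_congr rfl fun σ _ => ?_
  rw [Units.smul_def, zsmul_eq_mul, MultilinearMap.domDomCongr_apply, LinearMap.uncurryLeft_apply,
    LinearMap.smulRight_apply, smul_apply, pairProd_apply, smul_eq_mul]
  rfl

theorem wedgePow_eq [TopologicalSpace V] (η : V [⋀^Fin 2]→L[ℝ] ℝ) (m : ℕ)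
    (v : Fin (2 * m) → V) : wedgePow η m v = wedgeAlt η.toBilin m v := by
  rw [wedgeAlt_apply]; rfl

theorem oneWedgePow_eq [TopologicalSpace V] (b : V [⋀^Fin 1]→L[ℝ] ℝ) (η : V [⋀^Fin 2]→L[ℝ] ℝ)
    (m : ℕ) (v : Fin (2 * m + 1) → V) :
    oneWedgePow b η m v = oneWedgeAlt b.toLin η.toBilin m v := by
  rw [oneWedgeAlt_apply]; rfl

/-- Only the permutations fixing `0` contribute to `f ∧ B^m` on a family all of whose vectors but
the first lie in `ker f`. -/
theorem oneWedgeAlt_cons (f : V →ₗ[ℝ] ℝ) (B : V →ₗ[ℝ] V →ₗ[ℝ] ℝ) (m : ℕ) (r : V)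
    (v : Fin (2 * m) → V) (hv : ∀ i, f (v i) = 0) :
    oneWedgeAlt f B m (Fin.cons r v : Fin (2 * m + 1) → V) = f r * wedgeAlt B m v := by
  rw [oneWedgeAlt_apply, wedgeAlt_apply, ← Equiv.sum_comp Equiv.Perm.decomposeFin.symm,
    Fintype.sum_prod_type, Fintype.sum_eq_single 0]
  · rw [mul_left_comm]
    congr 1
    rw [Finset.mul_sum]
    refine Finset.sum_congr rfl fun e _ => ?_
    rw [Equiv.Perm.decomposeFin.symm_sign, Equiv.Perm.decomposeFin_symm_apply_zero, if_pos rfl,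
      one_mul, Fin.cons_zero, mul_left_comm]
    congr 2
  · intro p hp
    refine Finset.sum_eq_zero fun e _ => ?_
    obtain ⟨q, rfl⟩ := Fin.exists_succ_eq.2 hp
    rw [Equiv.Perm.decomposeFin_symm_apply_zero, Fin.cons_succ, hv]
    simp

/-- The interior product rule `i_x (B^{k+1}) = (k+1) (i_x B) ∧ B^k`. -/
theorem wedgeAlt_cons (B : V →ₗ[ℝ] V →ₗ[ℝ] ℝ) (hB : B.IsAlt) (k : ℕ) (x : V)
    (v : Fin (2 * k + 1) → V) :
    wedgeAlt B (k + 1) (Fin.cons x v : Fin (2 * k + 1 + 1) → V) =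
      (k + 1) * oneWedgeAlt (B x) B k v := by
  set w : Fin (2 * (k + 1)) → V := (Fin.cons x v : Fin (2 * k + 1 + 1) → V) with hw
  set F : Equiv.Perm (Fin (2 * (k + 1))) → ℝ := fun σ => ((Equiv.Perm.sign σ : ℤ) : ℝ) *
    ∏ i : Fin (k + 1), B (w (σ ⟨2 * i, by omega⟩)) (w (σ ⟨2 * i + 1, by omega⟩)) with hF
  let z : Fin (2 * (k + 1)) := ⟨0, by omega⟩
  let o : Fin (2 * (k + 1)) := ⟨1, by omega⟩
  -- `F` is invariant under exchanging two pairs and under flipping a pair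
  have hpair : ∀ (i : Fin (k + 1)) (σ : Equiv.Perm (Fin (2 * (k + 1)))),
      F (σ * (Equiv.swap z ⟨2 * i, by omega⟩ * Equiv.swap o ⟨2 * i + 1, by omega⟩)) = F σ := by
    intro i σ
    by_cases hi : i = 0
    · subst hi
      have h1 : (⟨2 * ((0 : Fin (k + 1)) : ℕ), by simp⟩ : Fin (2 * (k + 1))) = z := rfl
      have h2 : (⟨2 * ((0 : Fin (k + 1)) : ℕ) + 1, by simp; omega⟩ : Fin (2 * (k + 1))) = o := rfl
      rw [h1, h2, Equiv.swap_self, Equiv.swap_self]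
      rfl
    · have hi' : (i : ℕ) ≠ 0 := fun h => hi (Fin.ext h)
      simp only [hF]
      congr 1
      · rw [Equiv.Perm.sign_mul, Equiv.Perm.sign_mul, Equiv.Perm.sign_swap, Equiv.Perm.sign_swap]
        · simp
        · simp only [o, ne_eq, Fin.mk.injEq]; omega
        · simp only [z, ne_eq, Fin.mk.injEq]; omega
      · have hswap : ∀ j : Fin (k + 1), ((Equiv.swap (0 : Fin (k + 1)) i j : Fin (k + 1)) : ℕ) =
            if (j : ℕ) = 0 then (i : ℕ) else if (j : ℕ) = i then (0 : ℕ) else (j : ℕ) := by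
          intro j
          rw [Equiv.swap_apply_def]
          simp only [Fin.ext_iff, Fin.val_zero]
          split_ifs <;> simp
        have hval : ∀ (n : ℕ) (hn : n < 2 * (k + 1)), (((Equiv.swap z ⟨2 * i, by omega⟩ *
            Equiv.swap o ⟨2 * i + 1, by omega⟩ : Equiv.Perm (Fin (2 * (k + 1)))) ⟨n, hn⟩ :
              Fin (2 * (k + 1))) : ℕ) = if n = 0 then 2 * (i : ℕ) else if n = 2 * i then 0
                else if n = 1 then 2 * i + 1 else if n = 2 * i + 1 then 1 else n := by
          intro n hn
          rw [Equiv.Perm.mul_apply, Equiv.swap_apply_def o, Equiv.swap_apply_def z]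
          simp only [Fin.ext_iff, z, o]
          split_ifs <;> simp only [] at * <;> omega
        rw [← Equiv.prod_comp (Equiv.swap (0 : Fin (k + 1)) i)]
        refine Finset.prod_congr rfl fun j _ => ?_
        have e1 : (Equiv.swap z ⟨2 * i, by omega⟩ * Equiv.swap o ⟨2 * i + 1, by omega⟩ :
            Equiv.Perm (Fin (2 * (k + 1)))) ⟨2 * (Equiv.swap (0 : Fin (k + 1)) i j : Fin (k + 1)),
              by omega⟩ = ⟨2 * j, by omega⟩ := by
          refine Fin.ext ?_
          rw [hval, hswap]
          simp only []
          split_ifs <;> first | contradiction | omega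
        have e2 : (Equiv.swap z ⟨2 * i, by omega⟩ * Equiv.swap o ⟨2 * i + 1, by omega⟩ :
            Equiv.Perm (Fin (2 * (k + 1))))
              ⟨2 * (Equiv.swap (0 : Fin (k + 1)) i j : Fin (k + 1)) + 1,
              by omega⟩ = ⟨2 * j + 1, by omega⟩ := by
          refine Fin.ext ?_
          rw [hval, hswap]
          simp only []
          split_ifs <;> first | contradiction | omega
        rw [Equiv.Perm.mul_apply σ, Equiv.Perm.mul_apply σ, e1, e2]
  have hflip : ∀ σ : Equiv.Perm (Fin (2 * (k + 1))), F (σ * Equiv.swap z o) = F σ := by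
    intro σ
    have hzo : z ≠ o := by simp [z, o]
    simp only [hF]
    rw [Equiv.Perm.sign_mul, Equiv.Perm.sign_swap hzo, Fin.prod_univ_succ,
      Fin.prod_univ_succ (fun i : Fin (k + 1) => B (w (σ ⟨2 * i, by omega⟩)) _)]
    have h1 : (⟨2 * ((0 : Fin (k + 1)) : ℕ), by simp⟩ : Fin (2 * (k + 1))) = z := rfl
    have h2 : (⟨2 * ((0 : Fin (k + 1)) : ℕ) + 1, by simp; omega⟩ : Fin (2 * (k + 1))) = o := rfl
    rw [h1, h2, Equiv.Perm.mul_apply, Equiv.Perm.mul_apply, Equiv.swap_apply_left,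
      Equiv.swap_apply_right, ← hB.neg]
    have h3 : ∀ i : Fin k, B (w ((σ * Equiv.swap z o) ⟨2 * (i.succ : Fin (k + 1)), by omega⟩))
        (w ((σ * Equiv.swap z o) ⟨2 * (i.succ : Fin (k + 1)) + 1, by omega⟩)) =
        B (w (σ ⟨2 * (i.succ : Fin (k + 1)), by omega⟩))
          (w (σ ⟨2 * (i.succ : Fin (k + 1)) + 1, by omega⟩)) := by
      intro i
      rw [Equiv.Perm.mul_apply, Equiv.Perm.mul_apply, Equiv.swap_apply_of_ne_of_ne,
        Equiv.swap_apply_of_ne_of_ne] <;>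
      · simp only [z, o, Fin.val_succ, ne_eq, Fin.mk.injEq]; omega
    rw [Finset.prod_congr rfl fun i _ => h3 i]
    push_cast
    ring
  -- hence the position of the first vector may be moved to `0`, so that the sum is `2(k+1)` times
  -- the sum over the permutations fixing `0`
  have hρ : ∀ p : Fin (2 * (k + 1)), ∃ ρ : Equiv.Perm (Fin (2 * (k + 1))),
      ρ z = p ∧ ∀ σ, F (σ * ρ) = F σ := by
    intro p
    obtain ⟨q, hq | hq⟩ : ∃ q, (p : ℕ) = 2 * q ∨ (p : ℕ) = 2 * q + 1 := ⟨p / 2, by omega⟩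
    · refine ⟨_, ?_, hpair ⟨q, by omega⟩⟩
      rw [Equiv.Perm.mul_apply, Equiv.swap_apply_of_ne_of_ne (a := o), Equiv.swap_apply_left]
      · exact Fin.ext hq.symm
      · simp [z, o]
      · simp [z]
    · refine ⟨(Equiv.swap z ⟨2 * q, by omega⟩ * Equiv.swap o ⟨2 * q + 1, by omega⟩) *
        Equiv.swap z o, ?_, fun σ => ?_⟩
      · rw [Equiv.Perm.mul_apply, Equiv.swap_apply_left, Equiv.Perm.mul_apply,
          Equiv.swap_apply_left, Equiv.swap_apply_of_ne_of_ne]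
        · exact Fin.ext hq.symm
        · simp [z]
        · simp [Fin.ext_iff]
      · rw [← mul_assoc, hflip]
        exact hpair ⟨q, by omega⟩ σ
  have hsum : ∑ σ, F σ = (2 * (k + 1) : ℝ) * ∑ σ, if σ z = z then F σ else 0 := by
    have h1 : ∀ σ, F σ = ∑ p, if σ p = z then F σ else 0 := by
      intro σ
      rw [Finset.sum_eq_single (σ.symm z)]
      · simp
      · intro b _ hb
        rw [if_neg]
        intro h
        exact hb (by rw [← h, Equiv.symm_apply_apply])
      · simp
    rw [Finset.sum_congr rfl fun σ _ => h1 σ, Finset.sum_comm]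
    have h2 : ∀ p, (∑ σ, if σ p = z then F σ else 0) = ∑ σ, if σ z = z then F σ else 0 := by
      intro p
      obtain ⟨ρ, hρz, hρF⟩ := hρ p
      rw [← Equiv.sum_comp (Equiv.mulRight ρ) (fun σ => if σ z = z then F σ else 0)]
      refine Finset.sum_congr rfl fun σ _ => ?_
      rw [Equiv.coe_mulRight, Equiv.Perm.mul_apply, hρz, hρF]
    rw [Finset.sum_congr rfl fun p _ => h2 p, Finset.sum_const, Finset.card_univ, Fintype.card_fin,
      nsmul_eq_mul]
    push_cast
    ring
  have hfix : (∑ σ, if σ z = z then F σ else 0) = ∑ e : Equiv.Perm (Fin (2 * k + 1)),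
      ((Equiv.Perm.sign e : ℤ) : ℝ) * (B x (v (e 0)) *
        ∏ i : Fin k, B (v (e ⟨2 * i + 1, by omega⟩)) (v (e ⟨2 * i + 2, by omega⟩))) := by
    have := (Equiv.sum_comp (Equiv.Perm.decomposeFin (n := 2 * k + 1)).symm
      (fun σ => if σ z = z then F σ else 0)).symm
    refine this.trans ?_
    rw [Fintype.sum_prod_type, Fintype.sum_eq_single 0]
    · refine Finset.sum_congr rfl fun e _ => ?_
      have hz : (Equiv.Perm.decomposeFin.symm (0, e) : Equiv.Perm (Fin (2 * k + 1 + 1))) 0 = 0 :=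
        Equiv.Perm.decomposeFin_symm_apply_zero _ _
      have hs : ∀ q : Fin (2 * k + 1),
          w ((Equiv.Perm.decomposeFin.symm (0, e) : Equiv.Perm (Fin (2 * k + 1 + 1))) q.succ) =
            v (e q) := by
        intro q
        rw [Equiv.Perm.decomposeFin_symm_apply_succ, Equiv.swap_self, Equiv.refl_apply, hw]
        exact Fin.cons_succ (α := fun _ => V) x v (e q)
      refine (if_pos hz).trans ?_
      simp only [hF]
      refine congrArg₂ (· * ·) ?_ ?_
      · have := Equiv.Perm.decomposeFin.symm_sign (0 : Fin (2 * k + 1 + 1)) e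
        rw [if_pos rfl, one_mul] at this
        exact congrArg (fun u : ℤˣ => ((u : ℤ) : ℝ)) this
      · rw [Fin.prod_univ_succ]
        refine congrArg₂ (· * ·) (congrArg₂ (fun a b => B a b) ?_ (hs 0))
          (Finset.prod_congr rfl fun i _ => congrArg₂ (fun a b => B a b)
            (hs ⟨2 * i + 1, by omega⟩) (hs ⟨2 * i + 2, by omega⟩))
        exact (congrArg w hz).trans (Fin.cons_zero (α := fun _ => V) x v)
    · intro p hp
      refine Finset.sum_eq_zero fun e _ => if_neg ?_
      intro h
      exact hp ((Equiv.Perm.decomposeFin_symm_apply_zero p e).symm.trans h)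
  rw [wedgeAlt_apply, oneWedgeAlt_apply]
  change _ * ∑ σ, F σ = _
  rw [hsum, hfix, pow_succ]
  field_simp

/-- A nonzero vector in a `(d+1)`-dimensional space is the first vector of a basis. -/
theorem exists_linearIndependent_cons [FiniteDimensional ℝ V] {d : ℕ}
    (hd : d + 1 ≤ Module.finrank ℝ V) {X : V} (hX : X ≠ 0) :
    ∃ u : Fin d → V, LinearIndependent ℝ (Fin.cons X u : Fin (d + 1) → V) := by
  induction d with
  | zero =>
    refine ⟨![], ?_⟩
    rw [linearIndependent_finCons]
    refine ⟨linearIndependent_empty_type, ?_⟩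
    simpa using hX
  | succ d ih =>
    obtain ⟨u, hu⟩ := ih (by omega)
    obtain ⟨y, hy⟩ := exists_linearIndependent_snoc_of_lt_finrank hu (by omega)
    refine ⟨Fin.snoc u y, ?_⟩
    rwa [Fin.cons_snoc_eq_snoc_cons]

theorem Fin.cons_cons_comp_swap {α : Type*} {d : ℕ} (a b : α) (u : Fin d → α) :
    (Fin.cons a (Fin.cons b u : Fin (d + 1) → α) : Fin (d + 2) → α) ∘ Equiv.swap 0 1 =
      (Fin.cons b (Fin.cons a u : Fin (d + 1) → α) : Fin (d + 2) → α) := by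
  funext i
  refine Fin.cases ?_ (fun i => Fin.cases ?_ (fun i => ?_) i) i
  · rw [Function.comp_apply, Equiv.swap_apply_left]; rfl
  · have h1 : (Fin.succ 0 : Fin (d + 2)) = 1 := rfl
    rw [Function.comp_apply, h1, Equiv.swap_apply_right]; rfl
  · rw [Function.comp_apply, Equiv.swap_apply_of_ne_of_ne]
    · rfl
    · exact Fin.succ_ne_zero _
    · exact fun h => Fin.succ_ne_zero _ (Fin.succ_injective _ h)

theorem LinearIndependent.cons_cons_comm {d : ℕ} {a b : V} {u : Fin d → V}
    (h : LinearIndependent ℝ (Fin.cons a (Fin.cons b u : Fin (d + 1) → V) : Fin (d + 2) → V)) :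
    LinearIndependent ℝ (Fin.cons b (Fin.cons a u : Fin (d + 1) → V) : Fin (d + 2) → V) := by
  rw [← Fin.cons_cons_comp_swap]
  exact h.comp _ (Equiv.swap (0 : Fin (d + 2)) 1).injective

theorem AlternatingMap.ne_zero_of_linearIndependent {d : ℕ} (hd : Module.finrank ℝ V = d)
    (f : V [⋀^Fin d]→ₗ[ℝ] ℝ) {v : Fin d → V} (hv : f v ≠ 0) {e : Fin d → V}
    (he : LinearIndependent ℝ e) : f e ≠ 0 := by
  intro h0
  rcases d with _ | d
  · exact hv (by rwa [Subsingleton.elim v e])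
  let b := basisOfLinearIndependentOfCardEqFinrank he (by simp [hd])
  have hb : (b : Fin (d + 1) → V) = e := by simp [b]
  have : f = 0 := (AlternatingMap.map_basis_eq_zero_iff b f).1 (by rw [hb, h0])
  exact hv (by rw [this]; rfl)

theorem AlternatingMap.eq_of_linearIndependent {d : ℕ} (hd : Module.finrank ℝ V = d)
    (f g : V [⋀^Fin d]→ₗ[ℝ] ℝ) {e : Fin d → V}
    (he : LinearIndependent ℝ e) (h : f e = g e) (v : Fin d → V) : f v = g v := by
  by_contra hne
  refine (f - g).ne_zero_of_linearIndependent hd (v := v) ?_ he ?_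
  · simpa [sub_eq_zero] using hne
  · simpa [sub_eq_zero] using h

variable {W : Type*} [AddCommGroup W] [Module ℝ W]

/-- On a hyperplane `W` of a contact vector space, where the characteristic direction is spanned by
`X ≠ 0`, the restricted covector does not vanish: otherwise `i_X η` vanishes on `W`, so
`a ∧ η^{k+1}` vanishes on a basis that consists of a transverse vector, `X`, and other vectors of
`W`. -/
theorem covector_ne_zero_of_contact {k : ℕ} [FiniteDimensional ℝ V] [FiniteDimensional ℝ W]
    (hV : Module.finrank ℝ V = 2 * (k + 1) + 1) (hW : Module.finrank ℝ W = 2 * (k + 1))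
    (a : V →ₗ[ℝ] ℝ) (η : V →ₗ[ℝ] V →ₗ[ℝ] ℝ) (hη : η.IsAlt)
    {v : Fin (2 * (k + 1) + 1) → V} (hc : oneWedgeAlt a η (k + 1) v ≠ 0)
    (ι : W →ₗ[ℝ] V) (hι : Function.Injective ι) {X : W} (hX : X ≠ 0)
    (hXker : ∀ w, a (ι w) = 0 → η (ι X) (ι w) = 0) : ∃ w, a (ι w) ≠ 0 := by
  by_contra! hb
  obtain ⟨N, hN⟩ : ∃ N, N ∉ LinearMap.range ι := by
    by_contra! h
    have : LinearMap.range ι = ⊤ := by ext; simp [h]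
    have h1 := LinearMap.finrank_range_of_inj hι
    rw [this, finrank_top] at h1
    omega
  obtain ⟨u, hu⟩ := exists_linearIndependent_cons (d := 2 * k + 1) (by omega) hX
  have hu' : LinearIndependent ℝ (Fin.cons (ι X) (ι ∘ u) : Fin (2 * k + 1 + 1) → V) := by
    have := hu.map' ι (LinearMap.ker_eq_bot.2 hι)
    rwa [Fin.comp_cons] at this
  have hLI : LinearIndependent ℝ (Fin.cons N (Fin.cons (ι X) (ι ∘ u) : Fin (2 * k + 1 + 1) → V) :
      Fin (2 * k + 1 + 1 + 1) → V) := by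
    rw [linearIndependent_finCons]
    refine ⟨hu', fun h => hN (Submodule.span_le.2 ?_ h)⟩
    rintro _ ⟨i, rfl⟩
    refine Fin.cases ?_ (fun i => ?_) i <;> simp
  refine (oneWedgeAlt a η (k + 1)).ne_zero_of_linearIndependent hV hc hLI ?_
  have h1 := oneWedgeAlt_cons a η (k + 1) N
    (Fin.cons (ι X) (ι ∘ u) : Fin (2 * k + 1 + 1) → V) (fun i => by
      refine Fin.cases (motive := fun i => a ((Fin.cons (ι X) (ι ∘ u) :
        Fin (2 * k + 1 + 1) → V) i) = 0) ?_ (fun i => ?_) i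
      · exact hb X
      · exact hb (u i))
  refine h1.trans ?_
  rw [wedgeAlt_cons η hη, oneWedgeAlt_apply, Finset.sum_eq_zero]
  · simp
  · intro σ _
    rw [Function.comp_apply, hXker _ (hb _)]
    simp

/-- With `X`, `W` as in `covector_ne_zero_of_contact`, the form `η^k` does not vanish on a
complement `u` of `X` in the kernel of the restricted covector: it is a factor of the value of
`a ∧ η^{k+1}` on a basis `r, X, N, u` with `X, N, u` in `ker a`. -/
theorem wedgeAlt_ne_zero_of_contact {k : ℕ} [FiniteDimensional ℝ V] [FiniteDimensional ℝ W]
    (hV : Module.finrank ℝ V = 2 * (k + 1) + 1) (hW : Module.finrank ℝ W = 2 * (k + 1))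
    (a : V →ₗ[ℝ] ℝ) (η : V →ₗ[ℝ] V →ₗ[ℝ] ℝ) (hη : η.IsAlt)
    {v : Fin (2 * (k + 1) + 1) → V} (hc : oneWedgeAlt a η (k + 1) v ≠ 0)
    (ι : W →ₗ[ℝ] V) (hι : Function.Injective ι) {X r : W}
    (hXa : a (ι X) = 0) (hXker : ∀ w, a (ι w) = 0 → η (ι X) (ι w) = 0)
    (hr : a (ι r) ≠ 0) {u : Fin (2 * k) → W} (hu : ∀ i, a (ι (u i)) = 0)
    (hLI : LinearIndependent ℝ (Fin.cons r (Fin.cons X u : Fin (2 * k + 1) → W) :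
      Fin (2 * k + 1 + 1) → W)) :
    wedgeAlt (η.compl₁₂ ι ι) k u ≠ 0 := by
  intro h0
  have h0' : wedgeAlt η k (ι ∘ u) = 0 := by
    rw [← h0, wedgeAlt_apply, wedgeAlt_apply]; rfl
  -- a vector `N ∈ ker a` transverse to the hyperplane
  obtain ⟨N, hN, hNa⟩ : ∃ N, N ∉ LinearMap.range ι ∧ a N = 0 := by
    obtain ⟨N, hN⟩ : ∃ N, N ∉ LinearMap.range ι := by
      by_contra! h
      have : LinearMap.range ι = ⊤ := by ext; simp [h]
      have h1 := LinearMap.finrank_range_of_inj hι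
      rw [this, finrank_top] at h1
      omega
    refine ⟨N - (a N / a (ι r)) • ι r, fun h => hN ?_, by simp [hr]⟩
    have := Submodule.add_mem _ h (Submodule.smul_mem _ (a N / a (ι r)) ⟨r, rfl⟩)
    simpa using this
  have hu' : LinearIndependent ℝ (Fin.cons (ι r) (Fin.cons (ι X) (ι ∘ u) : Fin (2 * k + 1) → V) :
      Fin (2 * k + 1 + 1) → V) := by
    have := hLI.map' ι (LinearMap.ker_eq_bot.2 hι)
    rwa [Fin.comp_cons, Fin.comp_cons] at this
  have hLI' : LinearIndependent ℝ (Fin.cons N (Fin.cons (ι r)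
      (Fin.cons (ι X) (ι ∘ u) : Fin (2 * k + 1) → V) :
      Fin (2 * k + 1 + 1) → V) : Fin (2 * k + 1 + 1 + 1) → V) := by
    rw [linearIndependent_finCons]
    refine ⟨hu', fun h => hN (Submodule.span_le.2 ?_ h)⟩
    rintro _ ⟨i, rfl⟩
    refine Fin.cases ?_ (fun i => Fin.cases ?_ (fun i => ?_) i) i <;> simp
  refine (oneWedgeAlt a η (k + 1)).ne_zero_of_linearIndependent hV hc hLI'.cons_cons_comm ?_
  refine (oneWedgeAlt_cons a η (k + 1) (ι r) (Fin.cons N (Fin.cons (ι X) (ι ∘ u) :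
    Fin (2 * k + 1) → V) : Fin (2 * k + 1 + 1) → V) (fun i => ?_)).trans ?_
  · refine Fin.cases (motive := fun i => a ((Fin.cons N (Fin.cons (ι X) (ι ∘ u) :
      Fin (2 * k + 1) → V) : Fin (2 * k + 1 + 1) → V) i) = 0) hNa (fun i => ?_) i
    exact Fin.cases (motive := fun i => a ((Fin.cons (ι X) (ι ∘ u) :
      Fin (2 * k + 1) → V) i) = 0) hXa hu i
  · have h1 := (wedgeAlt η (k + 1)).map_swap (Fin.cons (ι X) (Fin.cons N (ι ∘ u) :
      Fin (2 * k + 1) → V) : Fin (2 * k + 1 + 1) → V)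
      (i := (0 : Fin (2 * k + 1 + 1))) (j := (1 : Fin (2 * k + 1 + 1))) (by simp)
    have h2 := Fin.cons_cons_comp_swap (ι X) N (ι ∘ u)
    rw [← h2]
    refine (congrArg (a (ι r) * ·) h1).trans ?_
    rw [wedgeAlt_cons η hη, oneWedgeAlt_cons _ _ _ _ (ι ∘ u) (fun i => hXker _ (hu i)), h0']
    simp

/-- If `θ'` is conformal to `θ` modulo `b` with factor `g > 0` and `i_X θ' = s b`, then `(θ')^{k+1}`
is `s` times a positive multiple of the volume form `Ω` for which `i_X Ω` is a positive multiple of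
`b ∧ θ^k`. -/
theorem exists_wedgeAlt_eq_mul {k : ℕ} [FiniteDimensional ℝ W]
    (hW : Module.finrank ℝ W = 2 * (k + 1)) (b : W →ₗ[ℝ] ℝ) (θ θ' : W →ₗ[ℝ] W →ₗ[ℝ] ℝ)
    (hθ' : θ'.IsAlt) (Ω : W [⋀^Fin (2 * (k + 1))]→ₗ[ℝ] ℝ) {X : W} (hX : X ≠ 0) (hbX : b X = 0)
    (hb : ∃ r, b r ≠ 0) {s g : ℝ} (hg : 0 < g) (hs : ∀ w, θ' X w = s * b w)
    (hgθ : ∀ v w, b v = 0 → b w = 0 → θ' v w = g * θ v w)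
    (hne : ∀ (r : W) (u : Fin (2 * k) → W), b r ≠ 0 → (∀ i, b (u i) = 0) →
      LinearIndependent ℝ (Fin.cons r (Fin.cons X u : Fin (2 * k + 1) → W) :
        Fin (2 * k + 1 + 1) → W) → wedgeAlt θ k u ≠ 0)
    (hΩ : ∀ v : Fin (2 * k + 1) → W, 0 < oneWedgeAlt b θ k v →
      0 < Ω (Fin.cons X v : Fin (2 * k + 1 + 1) → W)) :
    ∃ ρ > 0, ∀ v, wedgeAlt θ' (k + 1) v = ρ * s * Ω v := by
  obtain ⟨r₀, hr₀⟩ := hb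
  -- a basis `r, X, u` with `u` in the kernel of `b`
  obtain ⟨u, hub, hLI₀⟩ : ∃ u : Fin (2 * k) → W, (∀ i, b (u i) = 0) ∧
      LinearIndependent ℝ (Fin.cons X u : Fin (2 * k + 1) → W) := by
    have hker : Module.finrank ℝ (LinearMap.ker b) = 2 * k + 1 := by
      have h1 := LinearMap.finrank_range_add_finrank_ker b
      have h2 : LinearMap.range b = ⊤ := LinearMap.range_eq_top.2 fun y =>
        ⟨(y / b r₀) • r₀, by simp [hr₀]⟩
      rw [h2, finrank_top, Module.finrank_self] at h1
      omega
    obtain ⟨u, hu⟩ := exists_linearIndependent_cons (V := LinearMap.ker b) (d := 2 * k) hker.ge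
      (X := ⟨X, hbX⟩) (fun h => hX (congrArg Subtype.val h))
    refine ⟨fun i => u i, fun i => (u i).2, ?_⟩
    have := hu.map' (LinearMap.ker b).subtype (Submodule.ker_subtype _)
    rwa [Fin.comp_cons] at this
  have hLIr : ∀ r, b r ≠ 0 → LinearIndependent ℝ
      (Fin.cons r (Fin.cons X u : Fin (2 * k + 1) → W) : Fin (2 * k + 1 + 1) → W) := by
    intro r hr
    rw [linearIndependent_finCons]
    refine ⟨hLI₀, fun h => hr ?_⟩
    have hsub : Submodule.span ℝ (Set.range (Fin.cons X u : Fin (2 * k + 1) → W)) ≤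
        LinearMap.ker b := by
      rw [Submodule.span_le]
      rintro _ ⟨i, rfl⟩
      exact Fin.cases (motive := fun i => b ((Fin.cons X u : Fin (2 * k + 1) → W) i) = 0)
        hbX hub i
    exact hsub h
  obtain ⟨r, hr, hpos⟩ : ∃ r, b r ≠ 0 ∧ 0 < b r * wedgeAlt θ k u := by
    have h := hne r₀ u hr₀ hub (hLIr r₀ hr₀)
    rcases lt_or_gt_of_ne (mul_ne_zero hr₀ h) with h' | h'
    · exact ⟨-r₀, by simpa using hr₀, by simpa using h'⟩
    · exact ⟨r₀, hr₀, h'⟩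
  have h1 : 0 < Ω (Fin.cons X (Fin.cons r u : Fin (2 * k + 1) → W) : Fin (2 * k + 1 + 1) → W) :=
    hΩ _ (by rwa [oneWedgeAlt_cons _ _ _ _ _ hub])
  refine ⟨(k + 1) * g ^ k * (b r * wedgeAlt θ k u) /
    Ω (Fin.cons X (Fin.cons r u : Fin (2 * k + 1) → W) : Fin (2 * k + 1 + 1) → W),
    by positivity, fun v => ?_⟩
  have key := AlternatingMap.eq_of_linearIndependent hW (wedgeAlt θ' (k + 1))
    (((k + 1) * g ^ k * (b r * wedgeAlt θ k u) /
    Ω (Fin.cons X (Fin.cons r u : Fin (2 * k + 1) → W) : Fin (2 * k + 1 + 1) → W) * s) • Ω)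
    (hLIr r hr).cons_cons_comm ?_ v
  · rw [key]; rfl
  · refine (wedgeAlt_cons θ' hθ' k X _).trans ?_
    rw [oneWedgeAlt_cons _ _ _ _ _ (fun i => by rw [hs, hub, mul_zero]), hs]
    have h2 : wedgeAlt θ' k u = g ^ k * wedgeAlt θ k u := by
      rw [wedgeAlt_apply, wedgeAlt_apply, mul_left_comm, Finset.mul_sum (a := g ^ k)]
      congr 1
      refine Finset.sum_congr rfl fun σ _ => ?_
      rw [mul_left_comm]
      congr 1
      rw [Finset.prod_congr rfl fun i _ => hgθ _ _ (hub _) (hub _), Finset.prod_mul_distrib]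
      simp
    rw [h2]
    change _ = _ * Ω (Fin.cons X (Fin.cons r u : Fin (2 * k + 1) → W) : Fin (2 * k + 1 + 1) → W)
    field_simp

end LinearAlgebra

/-! ### Differentiability of the flow in the initial value -/

section Flow

open Filter Asymptotics Metric

variable {E : Type*} [NormedAddCommGroup E] [NormedSpace ℝ E]

/-- A continuous solution `s` of the equation `f (y, s y) = 0` is differentiable at a point where
`f` is differentiable with nonzero derivative in the second variable. -/
theorem exists_hasFDerivAt_of_implicit {Y : Type*} [NormedAddCommGroup Y] [NormedSpace ℝ Y]
    {f : Y × ℝ → ℝ} {f' : Y × ℝ →L[ℝ] ℝ} {s : Y → ℝ} {y : Y}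
    (hf : HasFDerivAt f f' (y, s y)) (hf' : f' (0, 1) ≠ 0)
    (hs : ContinuousAt s y) (h0 : ∀ᶠ z in 𝓝 y, f (z, s z) = 0) :
    ∃ s' : Y →L[ℝ] ℝ, HasFDerivAt s s' y := by
  set a := f' (0, 1) with ha
  set l : Y →L[ℝ] ℝ := f'.comp (ContinuousLinearMap.inl ℝ Y ℝ) with hl
  have hdec : ∀ h : Y, ∀ d : ℝ, f' (h, d) = l h + d * a := by
    intro h d
    have : ((h, d) : Y × ℝ) = (h, 0) + d • (0, 1) := by simp
    rw [this, map_add, map_smul]; simp [hl, ha]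
  have hT : Tendsto (fun z => (z, s z)) (𝓝 y) (𝓝 (y, s y)) :=
    continuousAt_id.prodMk hs
  have h1 : (fun z => f (z, s z) - f (y, s y) - f' ((z, s z) - (y, s y))) =o[𝓝 y]
      fun z => ((z, s z) - (y, s y) : Y × ℝ) := hf.isLittleO.comp_tendsto hT
  have h2 : (fun z => l (z - y) + (s z - s y) * a) =o[𝓝 y]
      fun z => ((z - y, s z - s y) : Y × ℝ) := by
    refine h1.neg_left.congr' ?_ (Eventually.of_forall fun z => rfl)
    filter_upwards [h0] with z hz
    rw [hz, h0.self_of_nhds]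
    simp only [Prod.mk_sub_mk, hdec]; ring
  -- the estimate `|Δs| ≤ C ‖Δy‖`
  have h3 : (fun z => s z - s y) =O[𝓝 y] fun z => z - y := by
    have ha' : 0 < |a| := abs_pos.2 hf'
    have h4 := h2.def (half_pos ha')
    refine IsBigO.of_bound ((‖l‖ + |a|) * (2 / |a|)) ?_
    filter_upwards [h4] with z hz
    have hA : |s z - s y| * |a| ≤ ‖l (z - y) + (s z - s y) * a‖ + ‖l (z - y)‖ := by
      rw [← abs_mul]
      calc |(s z - s y) * a| = ‖(l (z - y) + (s z - s y) * a) - l (z - y)‖ := by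
            rw [add_sub_cancel_left, Real.norm_eq_abs]
        _ ≤ _ := norm_sub_le _ _
    have hB : ‖((z - y, s z - s y) : Y × ℝ)‖ ≤ ‖z - y‖ + |s z - s y| := by
      rw [Prod.norm_def]
      exact max_le (le_add_of_nonneg_right (abs_nonneg _))
        (le_add_of_nonneg_left (norm_nonneg _))
    have hC := l.le_opNorm (z - y)
    have hD : |s z - s y| * |a| ≤ |a| / 2 * (‖z - y‖ + |s z - s y|) + ‖l‖ * ‖z - y‖ :=
      hA.trans (add_le_add (hz.trans (by gcongr)) hC)
    rw [Real.norm_eq_abs]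
    have hE : |s z - s y| * (|a| / 2) ≤ (‖l‖ + |a|) * ‖z - y‖ := by
      nlinarith [norm_nonneg (z - y), mul_nonneg ha'.le (norm_nonneg (z - y))]
    calc |s z - s y| = |s z - s y| * (|a| / 2) * (2 / |a|) := by field_simp
      _ ≤ (‖l‖ + |a|) * ‖z - y‖ * (2 / |a|) := by gcongr
      _ = _ := by ring
  refine ⟨-(a⁻¹ • l), ?_⟩
  rw [hasFDerivAt_iff_isLittleO]
  have h5 : (fun z => ((z - y, s z - s y) : Y × ℝ)) =O[𝓝 y] fun z => z - y :=
    (isBigO_refl _ _).prod_left h3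
  refine ((h2.trans_isBigO h5).const_mul_left a⁻¹).congr_left fun z => ?_
  simp only [neg_apply, smul_apply, smul_eq_mul]
  field_simp
  ring

/-- Second-order Taylor estimate when the derivative is Lipschitz on a convex set. -/
theorem norm_sub_sub_fderiv_le {v : E → E} {B : Set E} (hBo : IsOpen B) (hB : Convex ℝ B)
    (hv : DifferentiableOn ℝ v B) {C : NNReal} (hL : LipschitzOnWith C (fderiv ℝ v) B)
    {p q : E} (hp : p ∈ B) (hq : q ∈ B) :
    ‖v p - v q - fderiv ℝ v q (p - q)‖ ≤ C * ‖p - q‖ * ‖p - q‖ := by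
  have hsub : segment ℝ q p ⊆ B := hB.segment_subset hq hp
  refine (convex_segment q p).norm_image_sub_le_of_norm_hasFDerivWithin_le'
    (f' := fderiv ℝ v) (fun x hx => ?_) (fun x hx => ?_) (left_mem_segment ℝ q p)
    (right_mem_segment ℝ q p)
  · exact ((hv.differentiableAt (hBo.mem_nhds (hsub hx))).hasFDerivAt).hasFDerivWithinAt
  · refine (hL.norm_sub_le (hsub hx) hq).trans ?_
    gcongr
    obtain ⟨a, b, ha, hb, hab, rfl⟩ := hx
    have : a • q + b • p - q = b • (p - q) := by
      rw [show a = 1 - b by linarith]; module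
    rw [this, norm_smul, Real.norm_of_nonneg hb]
    exact mul_le_of_le_one_left (norm_nonneg _) (by linarith)

/-- Quadratic dependence estimate: solutions of an ODE differ from the linearized flow by
`O(‖h‖²)`. -/
theorem norm_flow_sub_sub_le {v : E → E} {B : Set E} (hBo : IsOpen B) (hB : Convex ℝ B)
    (hv : DifferentiableOn ℝ v B) {C K : NNReal} (hL : LipschitzOnWith C (fderiv ℝ v) B)
    (hK : LipschitzOnWith K v B) (hK1 : 1 ≤ K) {T : ℝ} :
    ∃ M : ℝ, ∀ (p q : ℝ → E) (A : ℝ → E →L[ℝ] E),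
      (∀ t ∈ Icc 0 T, HasDerivAt p (v (p t)) t ∧ p t ∈ B) →
      (∀ t ∈ Icc 0 T, HasDerivAt q (v (q t)) t ∧ q t ∈ B) →
      A 0 = ContinuousLinearMap.id ℝ E →
      (∀ t ∈ Icc 0 T, HasDerivAt A ((fderiv ℝ v (q t)).comp (A t)) t) →
      ∀ t ∈ Icc 0 T, ‖p t - q t - A t (p 0 - q 0)‖ ≤ M * ‖p 0 - q 0‖ * ‖p 0 - q 0‖ := by
  have hK0 : (K : ℝ) ≠ 0 := by
    have : (1 : ℝ) ≤ K := by exact_mod_cast hK1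
    linarith
  refine ⟨C * Real.exp (K * T) ^ 2 / K * Real.exp (K * T), fun p q A hp hq hA0 hA t ht => ?_⟩
  set h := p 0 - q 0 with hh
  have hpc : ContinuousOn p (Icc 0 T) := fun t ht => (hp t ht).1.continuousAt.continuousWithinAt
  have hqc : ContinuousOn q (Icc 0 T) := fun t ht => (hq t ht).1.continuousAt.continuousWithinAt
  have hAc : ContinuousOn A (Icc 0 T) := fun t ht => (hA t ht).continuousAt.continuousWithinAt
  have hdist : ∀ s ∈ Icc 0 T, ‖p s - q s‖ ≤ ‖h‖ * Real.exp (K * T) := by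
    intro s hs
    have := dist_le_of_trajectories_ODE_of_mem (v := fun _ => v) (s := fun _ => B) (K := K)
      (δ := ‖h‖) (fun _ _ => hK) hpc
      (fun t ht => (hp t (Ico_subset_Icc_self ht)).1.hasDerivWithinAt)
      (fun t ht => (hp t (Ico_subset_Icc_self ht)).2) hqc
      (fun t ht => (hq t (Ico_subset_Icc_self ht)).1.hasDerivWithinAt)
      (fun t ht => (hq t (Ico_subset_Icc_self ht)).2) (dist_eq_norm _ _).le s hs
    rw [dist_eq_norm] at this
    refine this.trans ?_
    gcongr
    linarith [hs.2]
  have hder : ∀ s ∈ Icc 0 T, HasDerivAt (fun s => p s - q s - A s h)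
      (v (p s) - v (q s) - fderiv ℝ v (q s) (A s h)) s := fun s hs =>
    ((hp s hs).1.sub (hq s hs).1).sub ((hA s hs).clm_apply (hasDerivAt_const s h) |>.congr_deriv
      (by simp))
  have hbound : ∀ s ∈ Ico 0 T, ‖v (p s) - v (q s) - fderiv ℝ v (q s) (A s h)‖ ≤
      K * ‖p s - q s - A s h‖ + C * (‖h‖ * Real.exp (K * T)) * (‖h‖ * Real.exp (K * T)) := by
    intro s hs
    have hs := Ico_subset_Icc_self hs
    have hqB := (hq s hs).2
    have hn : ‖fderiv ℝ v (q s)‖ ≤ K := norm_fderiv_le_of_lipschitzOn ℝ (hBo.mem_nhds hqB) hK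
    have e1 : v (p s) - v (q s) - fderiv ℝ v (q s) (A s h) =
        fderiv ℝ v (q s) (p s - q s - A s h) +
          (v (p s) - v (q s) - fderiv ℝ v (q s) (p s - q s)) := by
      rw [map_sub _ (p s - q s) (A s h)]; abel
    rw [e1]
    refine (norm_add_le _ _).trans (add_le_add ?_ ?_)
    · exact (ContinuousLinearMap.le_opNorm _ _).trans (by gcongr)
    · refine (norm_sub_sub_fderiv_le hBo hB hv hL (hp s hs).2 hqB).trans ?_
      have := hdist s hs
      gcongr
  -- Grönwall's inequality with the quadratic error term
  have key := norm_le_gronwallBound_of_norm_deriv_right_le (δ := 0) (K := K) (a := 0) (b := T)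
    (((hpc.sub hqc).sub (hAc.clm_apply continuousOn_const)))
    (fun s hs => (hder s (Ico_subset_Icc_self hs)).hasDerivWithinAt)
    (by simp [hA0, hh]) hbound t ht
  rw [gronwallBound_of_K_ne_0 hK0] at key
  refine key.trans ?_
  have hexp : Real.exp (K * (t - 0)) - 1 ≤ Real.exp (K * T) := by
    have : Real.exp (K * (t - 0)) ≤ Real.exp (K * T) := by
      gcongr
      linarith [ht.2]
    linarith
  simp only [zero_mul, zero_add]
  calc _ ≤ C * (‖h‖ * Real.exp (K * T)) * (‖h‖ * Real.exp (K * T)) / K * Real.exp (K * T) := by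
        gcongr
    _ = _ := by ring

/-- The local flow `Φ` of a `C²` vector field near a point, with its differential `A` in the
initial condition, which solves the variational equation. The joint differentiability in the initial
value and the time is stated for positive times. -/
theorem exists_local_flow [CompleteSpace E] {v : E → E} {O : Set E} (hO : IsOpen O)
    (hv : ContDiffOn ℝ 2 v O) {x₀ : E} (hx₀ : x₀ ∈ O) :
    ∃ r > (0 : ℝ), ∃ ε > (0 : ℝ), ∃ (Φ : E → ℝ → E) (A : E → ℝ → E →L[ℝ] E),
      ∀ x ∈ ball x₀ r, Φ x 0 = x ∧ A x 0 = ContinuousLinearMap.id ℝ E ∧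
      ∀ t ∈ Ioo (-ε) ε, Φ x t ∈ O ∧ HasDerivAt (Φ x) (v (Φ x t)) t ∧
        HasDerivAt (A x) ((fderiv ℝ v (Φ x t)).comp (A x t)) t ∧
        (0 < t → HasFDerivAt (fun z : E × ℝ => Φ z.1 z.2)
          ((A x t).coprod (ContinuousLinearMap.toSpanSingleton ℝ (v (Φ x t)))) (x, t)) := by
  have hv0 : ContDiffAt ℝ 2 v x₀ := hv.contDiffAt (hO.mem_nhds hx₀)
  have hdv0 : ContDiffAt ℝ 1 (fderiv ℝ v) x₀ := hv0.fderiv_right (by norm_num)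
  obtain ⟨K, s₁, hs₁, hK⟩ := (hv0.of_le (by norm_num : (1 : ℕ∞ω) ≤ 2)).exists_lipschitzOnWith
  obtain ⟨C, s₂, hs₂, hC⟩ := hdv0.exists_lipschitzOnWith
  obtain ⟨ρ, hρ, hρs⟩ := Metric.mem_nhds_iff.1
    (inter_mem (inter_mem hs₁ hs₂) (hO.mem_nhds hx₀))
  set B := ball x₀ ρ with hBdef
  have hBO : B ⊆ O := fun x hx => (hρs hx).2
  have hvB : DifferentiableOn ℝ v B := (hv.mono hBO).differentiableOn (by norm_num)
  -- the vector field together with its linearization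
  let W : E × (E →L[ℝ] E) → E × (E →L[ℝ] E) := fun z => (v z.1, (fderiv ℝ v z.1).comp z.2)
  have hW : ContDiffAt ℝ 1 W (x₀, ContinuousLinearMap.id ℝ E) := by
    refine ContDiffAt.prodMk ?_ ?_
    · exact (hv0.of_le (by norm_num : (1 : ℕ∞ω) ≤ 2)).comp
        (x₀, ContinuousLinearMap.id ℝ E) contDiffAt_fst
    · exact (hdv0.comp (x₀, ContinuousLinearMap.id ℝ E) contDiffAt_fst).clm_comp contDiffAt_snd
  obtain ⟨ε, hε, a, r, L, K', hr, hpl⟩ := IsPicardLindelof.of_contDiffAt_one hW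
  obtain ⟨α, hα, hαc⟩ := (hpl 0).exists_forall_mem_closedBall_eq_hasDerivWithinAt_continuousOn
  simp only [zero_sub, zero_add] at hα hαc
  have hcont : ContinuousAt α ((x₀, ContinuousLinearMap.id ℝ E), 0) := by
    refine hαc.continuousAt (prod_mem_nhds (closedBall_mem_nhds _ hr) (Icc_mem_nhds ?_ hε))
    linarith
  have hα0 : α ((x₀, ContinuousLinearMap.id ℝ E), 0) = (x₀, ContinuousLinearMap.id ℝ E) :=
    (hα _ (mem_closedBall_self hr.le)).1
  have hnear : ∀ᶠ z : E × ℝ in 𝓝 (x₀, 0), (α ((z.1, ContinuousLinearMap.id ℝ E), z.2)).1 ∈ B := by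
    have hc : ContinuousAt (fun z : E × ℝ => (α ((z.1, ContinuousLinearMap.id ℝ E), z.2)).1)
        (x₀, 0) := by
      refine continuousAt_fst.comp (ContinuousAt.comp (f := fun z : E × ℝ =>
        ((z.1, ContinuousLinearMap.id ℝ E), z.2)) hcont (by fun_prop))
    refine hc.eventually_mem ?_
    simp only [hα0]
    exact ball_mem_nhds _ hρ
  obtain ⟨δ, hδ, hδB⟩ := Metric.eventually_nhds_iff_ball.1 hnear
  refine ⟨min δ r, lt_min hδ hr, min δ ε, lt_min hδ hε,
    fun x t => (α ((x, ContinuousLinearMap.id ℝ E), t)).1,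
    fun x t => (α ((x, ContinuousLinearMap.id ℝ E), t)).2, ?_⟩
  have hball : ∀ x ∈ ball x₀ (min δ r), (x, ContinuousLinearMap.id ℝ E) ∈
      closedBall (x₀, ContinuousLinearMap.id ℝ E) r := by
    intro x hx
    rw [mem_closedBall, Prod.dist_eq, dist_self]
    exact max_le ((mem_ball.1 hx).le.trans (min_le_right _ _)) hr.le
  have hmem : ∀ x ∈ ball x₀ (min δ r), ∀ t ∈ Ioo (-min δ ε) (min δ ε),
      (α ((x, ContinuousLinearMap.id ℝ E), t)).1 ∈ B := by
    intro x hx t ht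
    refine hδB (x, t) ?_
    rw [mem_ball, Prod.dist_eq]
    refine max_lt ((mem_ball.1 hx).trans_le (min_le_left _ _)) ?_
    simp only [dist_zero_right, Real.norm_eq_abs]
    exact (abs_lt.2 ht).trans_le (min_le_left _ _)
  have hder : ∀ x ∈ ball x₀ (min δ r), ∀ t ∈ Ioo (-min δ ε) (min δ ε),
      HasDerivAt (fun t => α ((x, ContinuousLinearMap.id ℝ E), t))
        (W (α ((x, ContinuousLinearMap.id ℝ E), t))) t := by
    intro x hx t ht
    have h1 : -ε < t := lt_of_le_of_lt (neg_le_neg (min_le_right _ _)) ht.1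
    have h2 : t < ε := ht.2.trans_le (min_le_right _ _)
    exact ((hα _ (hball x hx)).2 t ⟨h1.le, h2.le⟩).hasDerivAt (Icc_mem_nhds h1 h2)
  have hder1 := fun x hx t ht => (hder x hx t ht).fst
  have hder2 := fun x hx t ht => (hder x hx t ht).snd
  intro x hx
  have hx0 := (hα _ (hball x hx)).1
  refine ⟨by simp only [hx0], by simp only [hx0], fun t ht => ⟨hBO (hmem x hx t ht),
    hder1 x hx t ht, hder2 x hx t ht, fun ht0 => ?_⟩⟩
  obtain ⟨t₁, ht₁, ht₁'⟩ := exists_between ht.2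
  obtain ⟨M, hM⟩ := norm_flow_sub_sub_le (T := t₁) isOpen_ball (convex_ball x₀ ρ) hvB
    (hC.mono fun x hx => (hρs hx).1.2)
    ((hK.mono fun x hx => (hρs hx).1.1).weaken (le_max_left K 1)) (le_max_right K 1)
  have hIcc : Icc 0 t₁ ⊆ Ioo (-min δ ε) (min δ ε) := fun s hs =>
    ⟨lt_of_lt_of_le (by linarith) hs.1, hs.2.trans_lt ht₁'⟩
  have hquad : ∀ z ∈ ball x₀ (min δ r), ∀ s ∈ Icc 0 t₁,
      ‖(α ((z, ContinuousLinearMap.id ℝ E), s)).1 - (α ((x, ContinuousLinearMap.id ℝ E), s)).1 -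
        (α ((x, ContinuousLinearMap.id ℝ E), s)).2 (z - x)‖ ≤ M * ‖z - x‖ * ‖z - x‖ := by
    intro z hz s hs
    have := hM (fun s => (α ((z, ContinuousLinearMap.id ℝ E), s)).1)
      (fun s => (α ((x, ContinuousLinearMap.id ℝ E), s)).1)
      (fun s => (α ((x, ContinuousLinearMap.id ℝ E), s)).2)
      (fun s hs => ⟨hder1 z hz s (hIcc hs), hmem z hz s (hIcc hs)⟩)
      (fun s hs => ⟨hder1 x hx s (hIcc hs), hmem x hx s (hIcc hs)⟩) (by simp only [hx0])
      (fun s hs => hder2 x hx s (hIcc hs)) s hs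
    simpa only [hx0, (hα _ (hball z hz)).1] using this
  -- the increment of `Φ` is the sum of a variation of the initial value at time `z.2`, estimated by
  -- `hquad`, a variation of the time along the orbit of `x`, and a variation of `A` in the time
  rw [hasFDerivAt_iff_isLittleO]
  have hfst : Tendsto (fun z : E × ℝ => z.1) (𝓝 (x, t)) (𝓝 x) := continuousAt_fst
  have hsnd : Tendsto (fun z : E × ℝ => z.2) (𝓝 (x, t)) (𝓝 t) := continuousAt_snd
  have hO1 : (fun z : E × ℝ => z.1 - x) =O[𝓝 (x, t)] fun z => z - (x, t) :=
    IsBigO.of_bound 1 (Eventually.of_forall fun z => by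
      rw [one_mul]; exact norm_fst_le (z - (x, t)))
  have hO2 : (fun z : E × ℝ => z.2 - t) =O[𝓝 (x, t)] fun z => z - (x, t) :=
    IsBigO.of_bound 1 (Eventually.of_forall fun z => by
      rw [one_mul]; exact norm_snd_le (z - (x, t)))
  have hsub0 : Tendsto (fun z : E × ℝ => z.1 - x) (𝓝 (x, t)) (𝓝 0) := by
    simpa using hfst.sub_const x
  have t1 : (fun z : E × ℝ => (α ((z.1, ContinuousLinearMap.id ℝ E), z.2)).1 -
      (α ((x, ContinuousLinearMap.id ℝ E), z.2)).1 -
        (α ((x, ContinuousLinearMap.id ℝ E), z.2)).2 (z.1 - x)) =o[𝓝 (x, t)]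
      fun z => z - (x, t) := by
    have hb : (fun z : E × ℝ => (α ((z.1, ContinuousLinearMap.id ℝ E), z.2)).1 -
      (α ((x, ContinuousLinearMap.id ℝ E), z.2)).1 -
        (α ((x, ContinuousLinearMap.id ℝ E), z.2)).2 (z.1 - x)) =O[𝓝 (x, t)]
        fun z => ‖z.1 - x‖ * ‖z.1 - x‖ := by
      refine IsBigO.of_bound M ?_
      filter_upwards [hfst.eventually_mem (isOpen_ball.mem_nhds hx),
        hsnd.eventually_mem (Icc_mem_nhds ht0 ht₁)] with z hz1 hz2
      refine (hquad z.1 hz1 z.2 hz2).trans_eq ?_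
      rw [norm_mul, norm_norm]; ring
    refine hb.trans_isLittleO ?_
    have : (fun z : E × ℝ => ‖z.1 - x‖ * ‖z.1 - x‖) =o[𝓝 (x, t)]
        fun z => (1 : ℝ) * ‖z.1 - x‖ :=
      ((isLittleO_one_iff ℝ).2 (by simpa using hsub0.norm)).mul_isBigO (isBigO_refl _ _)
    simp only [one_mul] at this
    exact this.trans_isBigO hO1.norm_left
  have t2 : (fun z : E × ℝ => (α ((x, ContinuousLinearMap.id ℝ E), z.2)).1 -
      (α ((x, ContinuousLinearMap.id ℝ E), t)).1 -
        (z.2 - t) • v (α ((x, ContinuousLinearMap.id ℝ E), t)).1) =o[𝓝 (x, t)]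
      fun z => z - (x, t) :=
    ((hasDerivAt_iff_isLittleO.1 (hder1 x hx t ht)).comp_tendsto hsnd).trans_isBigO hO2
  have t3 : (fun z : E × ℝ => ((α ((x, ContinuousLinearMap.id ℝ E), z.2)).2 -
      (α ((x, ContinuousLinearMap.id ℝ E), t)).2) (z.1 - x)) =o[𝓝 (x, t)]
      fun z => z - (x, t) := by
    have hA0 : Tendsto (fun z : E × ℝ => (α ((x, ContinuousLinearMap.id ℝ E), z.2)).2 -
      (α ((x, ContinuousLinearMap.id ℝ E), t)).2) (𝓝 (x, t)) (𝓝 0) := by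
      have := ((HasDerivAt.continuousAt (hder2 x hx t ht)).tendsto.comp hsnd).sub_const
        (α ((x, ContinuousLinearMap.id ℝ E), t)).2
      simpa using this
    have hb : (fun z : E × ℝ => ((α ((x, ContinuousLinearMap.id ℝ E), z.2)).2 -
      (α ((x, ContinuousLinearMap.id ℝ E), t)).2) (z.1 - x)) =O[𝓝 (x, t)]
        fun z => ‖(α ((x, ContinuousLinearMap.id ℝ E), z.2)).2 -
      (α ((x, ContinuousLinearMap.id ℝ E), t)).2‖ * ‖z.1 - x‖ :=
      IsBigO.of_bound 1 (Eventually.of_forall fun z => by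
        rw [one_mul, norm_mul, norm_norm, norm_norm]; exact ContinuousLinearMap.le_opNorm _ _)
    refine hb.trans_isLittleO ?_
    have : (fun z : E × ℝ => ‖(α ((x, ContinuousLinearMap.id ℝ E), z.2)).2 -
      (α ((x, ContinuousLinearMap.id ℝ E), t)).2‖ * ‖z.1 - x‖) =o[𝓝 (x, t)]
        fun z => (1 : ℝ) * ‖z.1 - x‖ :=
      ((isLittleO_one_iff ℝ).2 (by simpa using hA0.norm)).mul_isBigO (isBigO_refl _ _)
    simp only [one_mul] at this
    exact this.trans_isBigO hO1.norm_left
  refine ((t1.add t2).add t3).congr_left fun z => ?_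
  simp only [ContinuousLinearMap.coprod_apply, sub_apply,
    ContinuousLinearMap.toSpanSingleton_apply, Prod.fst_sub, Prod.snd_sub]
  abel

end Flow

/-! ### Pullback and exterior derivative on manifolds -/

section Forms

open Filter

variable {E : Type*} [NormedAddCommGroup E] [NormedSpace ℝ E]
  {E' : Type*} [NormedAddCommGroup E'] [NormedSpace ℝ E']
  {N : Type*} [TopologicalSpace N] [ChartedSpace E N]
  {N' : Type*} [TopologicalSpace N'] [ChartedSpace E' N']

variable (E E') in
/-- The derivative of a map between manifolds, as a map between the model spaces, to which the
tangent spaces are definitionally equal. Working with fixed normed spaces avoids the dependence of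
the tangent spaces on the points. -/
noncomputable def mfd (f : N → N') (x : N) : E →L[ℝ] E' := mfderiv 𝓘(ℝ, E) 𝓘(ℝ, E') f x

/-- The value of a form at a point, as an alternating map on the model space. -/
def DForm.val {p : ℕ} (η : DForm E N p) (x : N) : E [⋀^Fin p]→L[ℝ] ℝ := η x

theorem DForm.val_pullback {p : ℕ} (f : N → N') (η : DForm E' N' p) (x : N) :
    (DForm.pullback f η : DForm E N p).val x =
      (η.val (f x)).compContinuousLinearMap (mfd E E' f x) := rfl

theorem DForm.inChart_eq {p : ℕ} (η : DForm E N p) (x₀ : N) (y : E) :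
    η.inChart x₀ y = (η.val ((extChartAt 𝓘(ℝ, E) x₀).symm y)).compContinuousLinearMap
      (mfd E E (extChartAt 𝓘(ℝ, E) x₀).symm y) := rfl

theorem DForm.val_d {p : ℕ} (η : DForm E N p) (x : N) :
    η.d.val x = (extDeriv (η.inChart x) (extChartAt 𝓘(ℝ, E) x x)).compContinuousLinearMap
      (mfd E E (extChartAt 𝓘(ℝ, E) x) x) := rfl

theorem mfd_comp {E'' : Type*} [NormedAddCommGroup E''] [NormedSpace ℝ E'']
    {N'' : Type*} [TopologicalSpace N''] [ChartedSpace E'' N''] {g : N' → N''} {f : N → N'} {x : N}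
    (hg : MDifferentiableAt 𝓘(ℝ, E') 𝓘(ℝ, E'') g (f x))
    (hf : MDifferentiableAt 𝓘(ℝ, E) 𝓘(ℝ, E') f x) :
    mfd E E'' (g ∘ f) x = (mfd E' E'' g (f x)).comp (mfd E E' f x) := mfderiv_comp x hg hf

theorem mfd_congr {f g : N → N'} {x : N} (h : f =ᶠ[𝓝 x] g) : mfd E E' f x = mfd E E' g x :=
  h.mfderiv_eq

theorem mfd_eq_fderiv (f : E → E') (x : E) : mfd E E' f x = fderiv ℝ f x := mfderiv_eq_fderiv

theorem mfd_id (x : N) : mfd E E (id : N → N) x = ContinuousLinearMap.id ℝ E := mfderiv_id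

/-- An alternating one-form, as a covector. -/
noncomputable def ContinuousAlternatingMap.toCov (b : E [⋀^Fin 1]→L[ℝ] ℝ) : E →L[ℝ] ℝ :=
  (ContinuousAlternatingMap.ofSubsingletonLIE (𝕜 := ℝ) (E := E) (F := ℝ) (0 : Fin 1)).symm b

@[simp]
theorem ContinuousAlternatingMap.toCov_apply (b : E [⋀^Fin 1]→L[ℝ] ℝ) (w : E) :
    b.toCov w = b ![w] := by
  obtain ⟨f, rfl⟩ := (ContinuousAlternatingMap.ofSubsingletonLIE (𝕜 := ℝ) (E := E) (F := ℝ)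
    (0 : Fin 1)).surjective b
  rw [toCov, LinearIsometryEquiv.symm_apply_apply]
  rfl

theorem contDiff_toCov {n : WithTop ℕ∞} :
    ContDiff ℝ n (ContinuousAlternatingMap.toCov : (E [⋀^Fin 1]→L[ℝ] ℝ) → E →L[ℝ] ℝ) :=
  (ContinuousAlternatingMap.ofSubsingletonLIE (𝕜 := ℝ) (E := E) (F := ℝ) (0 : Fin 1)).symm.contDiff

theorem extDeriv_one_apply {θ : E → E [⋀^Fin 1]→L[ℝ] ℝ} {y : E} (h : DifferentiableAt ℝ θ y)
    (v w : E) :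
    extDeriv θ y ![v, w] =
      fderiv ℝ (fun z => (θ z).toCov) y v w - fderiv ℝ (fun z => (θ z).toCov) y w v := by
  have hc : DifferentiableAt ℝ (fun z => (θ z).toCov) y :=
    ((contDiff_toCov (n := 1)).differentiable (by simp)).differentiableAt.comp y h
  have key : ∀ u w : E,
      fderiv ℝ (fun z => θ z ![w]) y u = fderiv ℝ (fun z => (θ z).toCov) y u w := by
    intro u w
    have : (fun z => θ z ![w]) = fun z => (θ z).toCov w := by funext z; simp
    rw [this, fderiv_clm_apply hc (differentiableAt_const w)]
    simp
  rw [extDeriv_apply h, Fin.sum_univ_two]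
  have e0 : (Fin.removeNth (0 : Fin 2) ![v, w] : Fin 1 → E) = ![w] := by
    funext i; fin_cases i; rfl
  have e1 : (Fin.removeNth (1 : Fin 2) ![v, w] : Fin 1 → E) = ![v] := by
    funext i; fin_cases i; rfl
  rw [e0, e1, key, key]
  simp [sub_eq_add_neg]

/-- The chart expression of a one-form, as a field of covectors. -/
noncomputable def DForm.chartCov (β : DForm E N 1) (x₀ : N) (y : E) : E →L[ℝ] ℝ :=
  (β.inChart x₀ y).toCov

theorem DForm.chartCov_apply (β : DForm E N 1) (x₀ : N) (y w : E) :
    β.chartCov x₀ y w = β.val ((extChartAt 𝓘(ℝ, E) x₀).symm y)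
      ![mfd E E (extChartAt 𝓘(ℝ, E) x₀).symm y w] := by
  rw [DForm.chartCov, ContinuousAlternatingMap.toCov_apply, DForm.inChart_eq,
    ContinuousAlternatingMap.compContinuousLinearMap_apply]
  congr 1
  funext i; fin_cases i; rfl

theorem DForm.IsSmooth.contDiffOn_chartCov {β : DForm E N 1} (h : β.IsSmooth) (x₀ : N) :
    ContDiffOn ℝ ∞ (β.chartCov x₀) (extChartAt 𝓘(ℝ, E) x₀).target :=
  contDiff_toCov.comp_contDiffOn (h x₀)

theorem DForm.IsSmooth.differentiableAt_inChart {p : ℕ} {β : DForm E N p} (h : β.IsSmooth) {x₀ : N}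
    {y : E} (hy : y ∈ (extChartAt 𝓘(ℝ, E) x₀).target) :
    DifferentiableAt ℝ (β.inChart x₀) y :=
  ((h x₀).contDiffAt ((isOpen_extChartAt_target _).mem_nhds hy)).differentiableAt (by simp)

variable [IsManifold 𝓘(ℝ, E) ∞ N] [IsManifold 𝓘(ℝ, E') ∞ N']

theorem mdifferentiableAt_chart {x₀ x : N} (hx : x ∈ (extChartAt 𝓘(ℝ, E) x₀).source) :
    MDifferentiableAt 𝓘(ℝ, E) 𝓘(ℝ, E) (extChartAt 𝓘(ℝ, E) x₀) x :=
  (contMDiffAt_extChartAt' (n := ∞) (by rwa [extChartAt_source] at hx)).mdifferentiableAt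
    (by simp)

theorem contMDiffAt_chart_symm {x₀ : N} {y : E} (hy : y ∈ (extChartAt 𝓘(ℝ, E) x₀).target) :
    ContMDiffAt 𝓘(ℝ, E) 𝓘(ℝ, E) ∞ (extChartAt 𝓘(ℝ, E) x₀).symm y :=
  (contMDiffOn_extChartAt_symm x₀).contMDiffAt
    ((isOpen_extChartAt_target x₀).mem_nhds hy)

theorem mdifferentiableAt_chart_symm {x₀ : N} {y : E}
    (hy : y ∈ (extChartAt 𝓘(ℝ, E) x₀).target) :
    MDifferentiableAt 𝓘(ℝ, E) 𝓘(ℝ, E) (extChartAt 𝓘(ℝ, E) x₀).symm y :=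
  (contMDiffAt_chart_symm hy).mdifferentiableAt (by simp)

theorem mfd_symm_comp_mfd {x₀ x : N} (hx : x ∈ (extChartAt 𝓘(ℝ, E) x₀).source) :
    (mfd E E (extChartAt 𝓘(ℝ, E) x₀).symm (extChartAt 𝓘(ℝ, E) x₀ x)).comp
      (mfd E E (extChartAt 𝓘(ℝ, E) x₀) x) = ContinuousLinearMap.id ℝ E := by
  rw [← mfd_comp (mdifferentiableAt_chart_symm ((extChartAt 𝓘(ℝ, E) x₀).map_source hx))
    (mdifferentiableAt_chart hx), ← mfd_id (E := E) x]
  apply mfd_congr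
  filter_upwards [(isOpen_extChartAt_source x₀).mem_nhds hx] with z hz
  exact (extChartAt 𝓘(ℝ, E) x₀).left_inv hz

theorem mfd_comp_mfd_symm {x₀ : N} {y : E} (hy : y ∈ (extChartAt 𝓘(ℝ, E) x₀).target) :
    (mfd E E (extChartAt 𝓘(ℝ, E) x₀) ((extChartAt 𝓘(ℝ, E) x₀).symm y)).comp
      (mfd E E (extChartAt 𝓘(ℝ, E) x₀).symm y) = ContinuousLinearMap.id ℝ E := by
  rw [← mfd_comp (mdifferentiableAt_chart ((extChartAt 𝓘(ℝ, E) x₀).map_target hy))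
    (mdifferentiableAt_chart_symm hy), ← mfd_id y]
  apply mfd_congr
  filter_upwards [(isOpen_extChartAt_target x₀).mem_nhds hy] with z hz
  exact (extChartAt 𝓘(ℝ, E) x₀).right_inv hz

/-- The chart expression of a pullback is the pullback of a chart expression under the chart
expression of the map. -/
theorem DForm.inChart_pullback {p : ℕ} {f : N → N'} (η : DForm E' N' p) {x₀ : N} {z₀ : N'} {y : E}
    (hy : y ∈ (extChartAt 𝓘(ℝ, E) x₀).target)
    (hf : ContMDiffAt 𝓘(ℝ, E) 𝓘(ℝ, E') ∞ f ((extChartAt 𝓘(ℝ, E) x₀).symm y))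
    (hfy : f ((extChartAt 𝓘(ℝ, E) x₀).symm y) ∈ (extChartAt 𝓘(ℝ, E') z₀).source) :
    ContDiffAt ℝ ∞ (extChartAt 𝓘(ℝ, E') z₀ ∘ f ∘ (extChartAt 𝓘(ℝ, E) x₀).symm) y ∧
    ∀ᶠ z in 𝓝 y, (DForm.pullback f η : DForm E N p).inChart x₀ z =
      (η.inChart z₀ ((extChartAt 𝓘(ℝ, E') z₀ ∘ f ∘ (extChartAt 𝓘(ℝ, E) x₀).symm) z)
        ).compContinuousLinearMap
        (fderiv ℝ (extChartAt 𝓘(ℝ, E') z₀ ∘ f ∘ (extChartAt 𝓘(ℝ, E) x₀).symm) z) := by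
  set φ := extChartAt 𝓘(ℝ, E) x₀ with hφ
  set ψ := extChartAt 𝓘(ℝ, E') z₀ with hψ
  have hcomp : ContMDiffAt 𝓘(ℝ, E) 𝓘(ℝ, E') ∞ (f ∘ φ.symm) y :=
    hf.comp y (contMDiffAt_chart_symm hy)
  have hFm : ContMDiffAt 𝓘(ℝ, E) 𝓘(ℝ, E') ∞ (ψ ∘ f ∘ φ.symm) y :=
    (contMDiffAt_extChartAt' (by rwa [hψ, extChartAt_source] at hfy)).comp y hcomp
  refine ⟨contMDiffAt_iff_contDiffAt.1 hFm, ?_⟩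
  have h1 : ∀ᶠ z in 𝓝 y, z ∈ φ.target := (isOpen_extChartAt_target x₀).mem_nhds hy
  have h2 : ∀ᶠ z in 𝓝 y, (f ∘ φ.symm) z ∈ ψ.source :=
    hcomp.continuousAt.eventually_mem ((isOpen_extChartAt_source z₀).mem_nhds hfy)
  have h3 : ∀ᶠ z in 𝓝 y, MDifferentiableAt 𝓘(ℝ, E) 𝓘(ℝ, E') f (φ.symm z) := by
    have : ∀ᶠ w in 𝓝 (φ.symm y), ContMDiffAt 𝓘(ℝ, E) 𝓘(ℝ, E') 1 f w :=
      (contMDiffAt_iff_contMDiffAt_nhds (by simp)).1 (hf.of_le (by norm_cast))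
    filter_upwards [(contMDiffAt_chart_symm hy).continuousAt.eventually this] with z hz
    exact hz.mdifferentiableAt (by simp)
  filter_upwards [h1.eventually_nhds, h2.eventually_nhds, h3] with z hz1 hz2 hz3
  have hzt := hz1.self_of_nhds
  have hzs := hz2.self_of_nhds
  have hpt : ψ.symm ((ψ ∘ f ∘ φ.symm) z) = f (φ.symm z) := ψ.left_inv hzs
  have hmf : MDifferentiableAt 𝓘(ℝ, E) 𝓘(ℝ, E') (f ∘ φ.symm) z :=
    hz3.comp z (mdifferentiableAt_chart_symm hzt)
  have hF : MDifferentiableAt 𝓘(ℝ, E) 𝓘(ℝ, E') (ψ ∘ f ∘ φ.symm) z :=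
    (mdifferentiableAt_chart hzs).comp z hmf
  have hder : (mfd E' E' ψ.symm ((ψ ∘ f ∘ φ.symm) z)).comp (fderiv ℝ (ψ ∘ f ∘ φ.symm) z) =
      (mfd E E' f (φ.symm z)).comp (mfd E E φ.symm z) := by
    rw [← mfd_comp hz3 (mdifferentiableAt_chart_symm hzt), ← mfd_eq_fderiv,
      ← mfd_comp (g := ψ.symm) (f := ψ ∘ f ∘ φ.symm)
        (mdifferentiableAt_chart_symm (ψ.map_source hzs)) hF]
    apply mfd_congr
    filter_upwards [hz2] with w hw
    exact ψ.left_inv hw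
  rw [DForm.inChart_eq, DForm.inChart_eq, DForm.val_pullback, ← hψ, ← hφ, hpt]
  ext v
  have := fun i => DFunLike.congr_fun hder (v i)
  simp only [ContinuousLinearMap.comp_apply] at this
  simp only [ContinuousAlternatingMap.compContinuousLinearMap_apply]
  congr 1
  funext i
  exact (this i).symm

/-- The exterior derivative commutes with pullbacks. -/
theorem DForm.d_pullback {p : ℕ} {f : N → N'} {η : DForm E' N' p} (hη : η.IsSmooth) {x : N}
    (hf : ContMDiffAt 𝓘(ℝ, E) 𝓘(ℝ, E') ∞ f x) :
    (DForm.pullback f η : DForm E N p).d.val x =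
      (DForm.pullback f η.d : DForm E N (p + 1)).val x := by
  set φ := extChartAt 𝓘(ℝ, E) x with hφ
  set ψ := extChartAt 𝓘(ℝ, E') (f x) with hψ
  have hxs : φ.symm (φ x) = x := extChartAt_to_inv x
  obtain ⟨h1, h2⟩ := DForm.inChart_pullback (f := f) η (x₀ := x) (z₀ := f x) (y := φ x)
    (mem_extChartAt_target x) (by rwa [← hφ, hxs])
    (by rw [← hφ, hxs]; exact mem_extChartAt_source _)
  rw [← hφ, ← hψ] at h1 h2
  have hpt : (ψ ∘ f ∘ φ.symm) (φ x) = ψ (f x) := by simp only [Function.comp_apply, hxs]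
  have hω : DifferentiableAt ℝ (η.inChart (f x)) ((ψ ∘ f ∘ φ.symm) (φ x)) := by
    rw [hpt]
    exact ((hη (f x)).contDiffAt ((isOpen_extChartAt_target _).mem_nhds
      (mem_extChartAt_target _))).differentiableAt (by simp)
  rw [DForm.val_d, ← hφ, Filter.EventuallyEq.extDeriv_eq h2,
    extDeriv_pullback hω h1 (by simp [minSmoothness_of_isRCLikeNormedField]; norm_cast),
    DForm.val_pullback, DForm.val_d, ← hψ, hpt]
  have hder : (fderiv ℝ (ψ ∘ f ∘ φ.symm) (φ x)).comp (mfd E E φ x) =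
      (mfd E' E' ψ (f x)).comp (mfd E E' f x) := by
    rw [← mfd_eq_fderiv, ← mfd_comp (f := φ) (h1.differentiableAt (by simp)).mdifferentiableAt
        (mdifferentiableAt_chart (E := E) (mem_extChartAt_source x)),
      ← mfd_comp (mdifferentiableAt_chart (E := E') (mem_extChartAt_source _))
        (hf.mdifferentiableAt (by simp))]
    apply mfd_congr
    filter_upwards [(isOpen_extChartAt_source (I := 𝓘(ℝ, E)) x).mem_nhds
      (mem_extChartAt_source x)] with z hz
    exact congrArg (ψ ∘ f) (φ.left_inv hz)
  ext v
  have := fun i => DFunLike.congr_fun hder (v i)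
  simp only [ContinuousLinearMap.comp_apply] at this
  simp only [ContinuousAlternatingMap.compContinuousLinearMap_apply]
  congr 1
  funext i
  exact this i

/-- The exterior derivative on a vector space is the usual one. -/
theorem DForm.d_modelSpace {p : ℕ} (η : DForm E E p) (y : E) :
    η.d.val y = extDeriv η.val y := by
  have h0 : (extChartAt 𝓘(ℝ, E) y).symm = PartialEquiv.refl E := by
    rw [extChartAt_model_space_eq_id]; rfl
  have h0' : extChartAt 𝓘(ℝ, E) y = PartialEquiv.refl E := by
    rw [extChartAt_model_space_eq_id]
  have hid : ∀ z : E, mfd E E (PartialEquiv.refl E) z = ContinuousLinearMap.id ℝ E :=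
    fun z => mfd_id (E := E) z
  have h1 : η.inChart y = η.val := by
    funext z
    rw [DForm.inChart_eq, h0, hid]
    rfl
  rw [DForm.val_d, h1, h0', hid]
  rfl

theorem DForm.val_d_chart {p : ℕ} {β : DForm E N p} (h : β.IsSmooth) {x₀ : N} {y : E}
    (hy : y ∈ (extChartAt 𝓘(ℝ, E) x₀).target) :
    (β.d.val ((extChartAt 𝓘(ℝ, E) x₀).symm y)).compContinuousLinearMap
      (mfd E E (extChartAt 𝓘(ℝ, E) x₀).symm y) = extDeriv (β.inChart x₀) y := by
  rw [← DForm.val_pullback, ← DForm.d_pullback h (contMDiffAt_chart_symm hy), DForm.d_modelSpace]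
  rfl

theorem DForm.val_d_chart_apply {β : DForm E N 1} (h : β.IsSmooth) {x₀ : N} {y : E}
    (hy : y ∈ (extChartAt 𝓘(ℝ, E) x₀).target) (v w : E) :
    β.d.val ((extChartAt 𝓘(ℝ, E) x₀).symm y)
      ![mfd E E (extChartAt 𝓘(ℝ, E) x₀).symm y v, mfd E E (extChartAt 𝓘(ℝ, E) x₀).symm y w] =
      fderiv ℝ (β.chartCov x₀) y v w - fderiv ℝ (β.chartCov x₀) y w v := by
  have := extDeriv_one_apply (h.differentiableAt_inChart hy) v w
  rw [← DForm.val_d_chart h hy, ContinuousAlternatingMap.compContinuousLinearMap_apply] at this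
  refine Eq.trans ?_ this
  congr 1
  funext i; fin_cases i <;> rfl

/-- The pullback of a smooth one-form is smooth. -/
theorem DForm.IsSmooth.pullback {β : DForm E' N' 1} (h : β.IsSmooth) {f : N → N'}
    (hf : ContMDiff 𝓘(ℝ, E) 𝓘(ℝ, E') ∞ f) : (DForm.pullback f β : DForm E N 1).IsSmooth := by
  intro x₀ y hy
  apply ContDiffAt.contDiffWithinAt
  set φ := extChartAt 𝓘(ℝ, E) x₀ with hφ
  obtain ⟨h1, h2⟩ := DForm.inChart_pullback (f := f) β (x₀ := x₀) (z₀ := f (φ.symm y)) hy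
    (hf _) (mem_extChartAt_source _)
  rw [← hφ] at h1 h2
  set ψ := extChartAt 𝓘(ℝ, E') (f (φ.symm y)) with hψ
  have h3 : (DForm.pullback f β : DForm E N 1).inChart x₀ =ᶠ[𝓝 y] fun z =>
      ContinuousAlternatingMap.ofSubsingletonLIE (𝕜 := ℝ) (E := E) (F := ℝ) (0 : Fin 1)
        ((β.chartCov (f (φ.symm y)) ((ψ ∘ f ∘ φ.symm) z)).comp (fderiv ℝ (ψ ∘ f ∘ φ.symm) z)) := by
    filter_upwards [h2] with z hz
    rw [hz]
    ext v
    rw [ContinuousAlternatingMap.compContinuousLinearMap_apply]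
    change _ = (β.chartCov (f (φ.symm y)) ((ψ ∘ f ∘ φ.symm) z)) (fderiv ℝ (ψ ∘ f ∘ φ.symm) z (v 0))
    rw [DForm.chartCov, ContinuousAlternatingMap.toCov_apply]
    congr 1
    funext i; fin_cases i; rfl
  refine ContDiffAt.congr_of_eventuallyEq ?_ h3
  refine (LinearIsometryEquiv.contDiff _).contDiffAt.comp y (ContDiffAt.clm_comp ?_ ?_)
  · have ht : (ψ ∘ f ∘ φ.symm) y ∈ ψ.target := mem_extChartAt_target _
    exact ((h.contDiffOn_chartCov _).contDiffAt
      ((isOpen_extChartAt_target _).mem_nhds ht)).comp y h1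
  · exact h1.fderiv_right (by simp)

/-- The Leibniz rule for `d(gβ)`. -/
theorem DForm.val_d_fsmul {β : DForm E N 1} (h : β.IsSmooth) {g : N → ℝ} {x : N}
    (hg : ContMDiffAt 𝓘(ℝ, E) 𝓘(ℝ) ∞ g x) (v w : E) :
    (β.fsmul g).d.val x ![v, w] = mfd E ℝ g x v * β.val x ![w] - mfd E ℝ g x w * β.val x ![v] +
      g x * β.d.val x ![v, w] := by
  set φ := extChartAt 𝓘(ℝ, E) x with hφ
  have hxs : φ.symm (φ x) = x := extChartAt_to_inv x
  have hxt : φ x ∈ φ.target := mem_extChartAt_target x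
  have hmg : MDifferentiableAt 𝓘(ℝ, E) 𝓘(ℝ) g (φ.symm (φ x)) := by
    rw [hxs]; exact hg.mdifferentiableAt (by simp)
  have hG : DifferentiableAt ℝ (g ∘ φ.symm) (φ x) :=
    (hmg.comp (φ x) (mdifferentiableAt_chart_symm hxt)).differentiableAt
  have hB : DifferentiableAt ℝ (β.chartCov x) (φ x) :=
    ((h.contDiffOn_chartCov x).contDiffAt
      ((isOpen_extChartAt_target _).mem_nhds hxt)).differentiableAt (by simp)
  have hA : (mfd E E φ.symm (φ x)).comp (mfd E E φ x) = ContinuousLinearMap.id ℝ E :=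
    mfd_symm_comp_mfd (mem_extChartAt_source x)
  have hA' : ∀ u, mfd E E φ.symm (φ x) (mfd E E φ x u) = u := fun u => DFunLike.congr_fun hA u
  have hgA : ∀ u, fderiv ℝ (g ∘ φ.symm) (φ x) (mfd E E φ x u) = mfd E ℝ g x u := by
    intro u
    rw [← mfd_eq_fderiv, mfd_comp hmg (mdifferentiableAt_chart_symm hxt),
      ContinuousLinearMap.comp_apply, hA', hxs]
  have hβ : ∀ u, β.chartCov x (φ x) (mfd E E φ x u) = β.val x ![u] := by
    intro u; rw [DForm.chartCov_apply, ← hφ, hA', hxs]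
  have hfs : (β.fsmul g).inChart x = fun z => (g ∘ φ.symm) z • β.inChart x z := rfl
  have hcov : (fun z => ((β.fsmul g).inChart x z).toCov) =
      fun z => (g ∘ φ.symm) z • β.chartCov x z := by
    funext z; ext u
    rw [hfs]; simp [DForm.chartCov]
  have hd : ∀ η : DForm E N 1, η.d.val x ![v, w] =
      extDeriv (η.inChart x) (φ x) ![mfd E E φ x v, mfd E E φ x w] := by
    intro η
    rw [DForm.val_d, ContinuousAlternatingMap.compContinuousLinearMap_apply]
    congr 1
    funext i; fin_cases i <;> rfl
  rw [hd, hd, extDeriv_one_apply, hcov, extDeriv_one_apply (h.differentiableAt_inChart hxt),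
    fderiv_fun_smul hG hB]
  · have : (fun z => (β.inChart x z).toCov) = β.chartCov x := rfl
    rw [this]
    simp only [add_apply, smul_apply, ContinuousLinearMap.smulRight_apply, hgA, hβ,
      smul_eq_mul, Function.comp_apply, hxs]
    ring
  · rw [hfs]
    exact hG.smul (h.differentiableAt_inChart hxt)

/-- The expression of a vector field in the chart at `x₀`, meaningful on the target of the chart. -/
noncomputable def chartField (X : ∀ x : N, TangentSpace 𝓘(ℝ, E) x) (x₀ : N) (y : E) : E :=
  mfd E E (extChartAt 𝓘(ℝ, E) x₀) ((extChartAt 𝓘(ℝ, E) x₀).symm y)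
    (X ((extChartAt 𝓘(ℝ, E) x₀).symm y))

theorem mfd_symm_chartField (X : ∀ x : N, TangentSpace 𝓘(ℝ, E) x) {x₀ : N} {y : E}
    (hy : y ∈ (extChartAt 𝓘(ℝ, E) x₀).target) :
    mfd E E (extChartAt 𝓘(ℝ, E) x₀).symm y (chartField X x₀ y) =
      X ((extChartAt 𝓘(ℝ, E) x₀).symm y) := by
  have := mfd_symm_comp_mfd (E := E) ((extChartAt 𝓘(ℝ, E) x₀).map_target hy)
  rw [(extChartAt 𝓘(ℝ, E) x₀).right_inv hy] at this
  exact DFunLike.congr_fun this _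

theorem contDiffOn_chartField {X : ∀ x : N, TangentSpace 𝓘(ℝ, E) x}
    (hX : ContMDiff 𝓘(ℝ, E) 𝓘(ℝ, E).tangent ∞ (fun x => (⟨x, X x⟩ : TangentBundle 𝓘(ℝ, E) N)))
    (x₀ : N) : ContDiffOn ℝ ∞ (chartField X x₀) (extChartAt 𝓘(ℝ, E) x₀).target := by
  rw [← contMDiffOn_iff_contDiffOn]
  have h1 := ((trivializationAt E (TangentSpace 𝓘(ℝ, E)) x₀).contMDiffOn_section_baseSet_iff
    (IB := 𝓘(ℝ, E)) (n := ∞) (s := X)).1 hX.contMDiffOn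
  have h2 : ContMDiffOn 𝓘(ℝ, E) 𝓘(ℝ, E) ∞ (fun x => mfd E E (extChartAt 𝓘(ℝ, E) x₀) x (X x))
      (chartAt E x₀).source := by
    refine h1.congr fun x hx => ?_
    have := TangentBundle.continuousLinearMapAt_trivializationAt (I := 𝓘(ℝ, E)) hx
    have := DFunLike.congr_fun this (X x)
    refine this.symm.trans ?_
    rw [Bundle.Trivialization.continuousLinearMapAt_apply,
      Bundle.Trivialization.linearMapAt_apply, if_pos hx]
  refine h2.comp (contMDiffOn_extChartAt_symm x₀) fun y hy => ?_
  have := (extChartAt 𝓘(ℝ, E) x₀).map_target hy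
  rwa [extChartAt_source] at this

end Forms

/-! ### Evolution of a one-form and its differential along a flow -/

section Laws

/-- The solution of the linear scalar equation `h' = a h`. -/
theorem eq_mul_exp_integral_of_hasDerivAt {a h : ℝ → ℝ} {ε : ℝ}
    (ha : ContinuousOn a (Ioo (-ε) ε)) (hh : ∀ t ∈ Ioo (-ε) ε, HasDerivAt h (a t * h t) t) {t : ℝ}
    (ht : t ∈ Ioo (-ε) ε) : h t = Real.exp (∫ s in (0 : ℝ)..t, a s) * h 0 := by
  have h0 : (0 : ℝ) ∈ Ioo (-ε) ε := by
    obtain ⟨h1, h2⟩ := ht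
    constructor <;> linarith
  have hK : ∀ s ∈ Ioo (-ε) ε, HasDerivAt (fun s => ∫ u in (0 : ℝ)..s, a u) (a s) s := by
    intro s hs
    have hsub : uIcc 0 s ⊆ Ioo (-ε) ε := ordConnected_Ioo.uIcc_subset h0 hs
    refine intervalIntegral.integral_hasDerivAt_right ((ha.mono hsub).intervalIntegrable)
      (ha.stronglyMeasurableAtFilter isOpen_Ioo s hs) (ha.continuousAt (isOpen_Ioo.mem_nhds hs))
  have hd : ∀ s ∈ Ioo (-ε) ε,
      HasDerivAt (fun s => h s * Real.exp (-∫ u in (0 : ℝ)..s, a u)) 0 s := by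
    intro s hs
    have := (hh s hs).mul (hK s hs).neg.exp
    refine this.congr_deriv ?_
    ring
  have hc := isOpen_Ioo.is_const_of_deriv_eq_zero isPreconnected_Ioo
    (fun s hs => (hd s hs).differentiableAt.differentiableWithinAt)
    (fun s hs => (hd s hs).deriv) ht h0
  simp only [intervalIntegral.integral_same, neg_zero, Real.exp_zero, mul_one] at hc
  rw [← hc, mul_comm, mul_assoc, ← Real.exp_add]
  simp

variable {E : Type*} [NormedAddCommGroup E] [NormedSpace ℝ E] {O : Set E}
  {b : E → E →L[ℝ] ℝ} {v : E → E} {c : E → ℝ}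

/-- If `b(v) = 0` and `i_v db = c b`, a solution of the linearised equation along an integral curve
of `v` satisfies `(b(u))' = c b(u)`: the Lie derivative of `b` along `v` is `c b`. -/
theorem hasDerivAt_covector_along (hO : IsOpen O) (hb : ContDiffOn ℝ 2 b O)
    (hv : ContDiffOn ℝ 2 v O) (h1 : ∀ y ∈ O, b y (v y) = 0)
    (h2 : ∀ y ∈ O, ∀ w, fderiv ℝ b y (v y) w - fderiv ℝ b y w (v y) = c y * b y w)
    {p u : ℝ → E} {t : ℝ} (hpO : p t ∈ O) (hp : HasDerivAt p (v (p t)) t)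
    (hu : HasDerivAt u (fderiv ℝ v (p t) (u t)) t) :
    HasDerivAt (fun t => b (p t) (u t)) (c (p t) * b (p t) (u t)) t := by
  have hnO := hO.mem_nhds hpO
  have hbd : HasFDerivAt b (fderiv ℝ b (p t)) (p t) :=
    ((hb.contDiffAt hnO).differentiableAt (by simp)).hasFDerivAt
  have hvd : HasFDerivAt v (fderiv ℝ v (p t)) (p t) :=
    ((hv.contDiffAt hnO).differentiableAt (by simp)).hasFDerivAt
  have h3 := (hbd.comp_hasDerivAt t hp).clm_apply hu
  have h4 : fderiv ℝ b (p t) (u t) (v (p t)) + b (p t) (fderiv ℝ v (p t) (u t)) = 0 := by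
    have h5 := (hbd.clm_apply hvd).congr_of_eventuallyEq (f₁ := fun _ => 0)
      (by filter_upwards [hnO] with y hy using (h1 y hy).symm)
    have := DFunLike.congr_fun (h5.unique (hasFDerivAt_const (0 : ℝ) (p t))) (u t)
    simp at this
    linarith
  refine h3.congr_deriv ?_
  have := h2 _ hpO (u t)
  simp only [Function.comp_apply]
  linarith

/-- The derivative of the relation `i_v db = c b`, where `B` stands for the derivative of `b`. -/
theorem fderiv_interior_product {B : E → E →L[ℝ] E →L[ℝ] ℝ} {B' : E →L[ℝ] E →L[ℝ] E →L[ℝ] ℝ}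
    {v' : E →L[ℝ] E} {c' : E →L[ℝ] ℝ} {b' : E →L[ℝ] E →L[ℝ] ℝ} {y : E}
    (hB : HasFDerivAt B B' y) (hv : HasFDerivAt v v' y) (hc : HasFDerivAt c c' y)
    (hb : HasFDerivAt b b' y) (x z : E)
    (h2 : ∀ᶠ y in 𝓝 y, B y (v y) z - B y z (v y) = c y * b y z) :
    B' x (v y) z + B y (v' x) z - (B' x z (v y) + B y z (v' x)) = c y * b' x z + c' x * b y z := by
  have e0 : HasFDerivAt (fun y => B y (v y)) _ y := hB.clm_apply hv
  have e1 : HasFDerivAt (fun y => B y (v y) z) _ y := e0.clm_apply (hasFDerivAt_const z y)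
  have e2 : HasFDerivAt (fun y => B y z) _ y := hB.clm_apply (hasFDerivAt_const z y)
  have e3 : HasFDerivAt (fun y => B y z (v y)) _ y := e2.clm_apply hv
  have e4 : HasFDerivAt (fun y => b y z) _ y := hb.clm_apply (hasFDerivAt_const z y)
  have e5 : HasFDerivAt (fun y => B y (v y) z - B y z (v y)) _ y := e1.sub e3
  have e6 : HasFDerivAt (fun y => c y * b y z) _ y := hc.mul e4
  have e7 := e5.congr_of_eventuallyEq (f₁ := fun y => c y * b y z)
      (by filter_upwards [h2] with y hy using hy.symm)
  have := DFunLike.congr_fun (e7.unique e6) x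
  simp only [sub_apply, add_apply, ContinuousLinearMap.comp_apply, ContinuousLinearMap.flip_apply,
    smul_apply, smul_eq_mul, zero_apply, map_zero, zero_add] at this
  linarith

theorem hasDerivAt_bilin_along {B : E → E →L[ℝ] E →L[ℝ] ℝ} {B' : E →L[ℝ] E →L[ℝ] E →L[ℝ] ℝ}
    {p u w : ℝ → E} {t : ℝ} {p' u' w' : E}
    (hB : HasFDerivAt B B' (p t)) (hp : HasDerivAt p p' t) (hu : HasDerivAt u u' t)
    (hw : HasDerivAt w w' t) :
    HasDerivAt (fun t => B (p t) (u t) (w t))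
      (B' p' (u t) (w t) + B (p t) u' (w t) + B (p t) (u t) w') t := by
  have e0 : HasDerivAt (fun t => B (p t)) (B' p') t := by
    have h := (HasFDerivAt.comp (F := E) (G := E →L[ℝ] E →L[ℝ] ℝ) (g := B) (g' := B') t hB
      hp.hasFDerivAt).hasDerivAt
    refine h.congr_deriv ?_
    simp
  have e1 : HasDerivAt (fun t => B (p t) (u t)) _ t := e0.clm_apply hu
  have e2 : HasDerivAt (fun t => B (p t) (u t) (w t)) _ t := e1.clm_apply hw
  exact e2.congr_deriv (by simp only [add_apply])

/-- On the kernel of `b`, the two-form `db` evolves by the same factor as `b`: the Lie derivative of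
`db` along `v` is `d(c b) = dc ∧ b + c db`. -/
theorem hasDerivAt_twoForm_along (hO : IsOpen O) (hb : ContDiffOn ℝ ∞ b O)
    (hv : ContDiffOn ℝ 2 v O) (hc : ContDiffOn ℝ 1 c O)
    (h2 : ∀ y ∈ O, ∀ w, fderiv ℝ b y (v y) w - fderiv ℝ b y w (v y) = c y * b y w)
    {p u w : ℝ → E} {t : ℝ} (hpO : p t ∈ O) (hp : HasDerivAt p (v (p t)) t)
    (hu : HasDerivAt u (fderiv ℝ v (p t) (u t)) t)
    (hw : HasDerivAt w (fderiv ℝ v (p t) (w t)) t)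
    (hbu : b (p t) (u t) = 0) (hbw : b (p t) (w t) = 0) :
    HasDerivAt (fun t => fderiv ℝ b (p t) (u t) (w t) - fderiv ℝ b (p t) (w t) (u t))
      (c (p t) * (fderiv ℝ b (p t) (u t) (w t) - fderiv ℝ b (p t) (w t) (u t))) t := by
  have hnO := hO.mem_nhds hpO
  have hbA := hb.contDiffAt hnO
  have hbd : HasFDerivAt b (fderiv ℝ b (p t)) (p t) :=
    (hbA.differentiableAt (by simp)).hasFDerivAt
  have hvd : HasFDerivAt v (fderiv ℝ v (p t)) (p t) :=
    ((hv.contDiffAt hnO).differentiableAt (by simp)).hasFDerivAt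
  have hcd : HasFDerivAt c (fderiv ℝ c (p t)) (p t) :=
    ((hc.contDiffAt hnO).differentiableAt (by simp)).hasFDerivAt
  have hbb : HasFDerivAt (fderiv ℝ b) (fderiv ℝ (fderiv ℝ b) (p t)) (p t) :=
    ((hbA.fderiv_right (m := 1) (by norm_cast)).differentiableAt (by simp)).hasFDerivAt
  have hsymm : ∀ x y, fderiv ℝ (fderiv ℝ b) (p t) x y = fderiv ℝ (fderiv ℝ b) (p t) y x := by
    have : IsSymmSndFDerivAt ℝ b (p t) :=
      hbA.isSymmSndFDerivAt (by simp [minSmoothness_of_isRCLikeNormedField]; norm_cast)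
    exact fun x y => this x y
  -- the term `dc ⊗ b` drops out on the kernel of `b`
  have key : ∀ x z : E, b (p t) z = 0 →
      fderiv ℝ (fderiv ℝ b) (p t) x (v (p t)) z + fderiv ℝ b (p t) (fderiv ℝ v (p t) x) z
        - (fderiv ℝ (fderiv ℝ b) (p t) x z (v (p t)) + fderiv ℝ b (p t) z (fderiv ℝ v (p t) x))
        = c (p t) * fderiv ℝ b (p t) x z := by
    intro x z hz
    have h := fderiv_interior_product hbb hvd hcd hbd x z
      (by filter_upwards [hnO] with y hy using h2 y hy z)
    rw [hz, mul_zero, add_zero] at h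
    exact h
  have k1 := key (u t) (w t) hbw
  have k2 := key (w t) (u t) hbu
  have d1 := hasDerivAt_bilin_along hbb hp hu hw
  have d2 := hasDerivAt_bilin_along hbb hp hw hu
  refine (d1.sub d2).congr_deriv ?_
  rw [hsymm (v (p t)) (u t), hsymm (v (p t)) (w t)]
  rw [hsymm (w t) (u t)] at k2
  linarith

end Laws

/-- Induction along an interval: a transitive relation that holds between nearby points holds
between the end points. -/
theorem Icc_chain {P : ℝ → ℝ → Prop} {a b : ℝ} (hab : a ≤ b)
    (htrans : ∀ x y z, a ≤ x → x ≤ y → y ≤ z → z ≤ b → P x y → P y z → P x z)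
    (hloc : ∀ t ∈ Icc a b, ∃ δ > 0, ∀ x ∈ Icc a b, ∀ y ∈ Icc a b, |x - t| < δ → |y - t| < δ →
      x ≤ y → P x y) : P a b := by
  choose! δ hδ hP using hloc
  obtain ⟨s, hs0, hmono, ⟨n, hn⟩, hcov⟩ := exists_monotone_Icc_subset_open_cover_Icc hab
    (c := fun i : Icc a b => {x : Icc a b | |(x : ℝ) - i| < δ i})
    (fun i => isOpen_lt (by fun_prop) continuous_const)
    (fun x _ => mem_iUnion.2 ⟨x, by simpa using hδ x x.2⟩)
  have hstep : ∀ m, P (s m) (s (m + 1)) := by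
    intro m
    obtain ⟨i, hi⟩ := hcov m
    exact hP i i.2 _ (s m).2 _ (s (m + 1)).2 (hi (left_mem_Icc.2 (hmono (Nat.le_succ m))))
      (hi (right_mem_Icc.2 (hmono (Nat.le_succ m)))) (hmono (Nat.le_succ m))
  have h : ∀ m, P a (s (m + 1)) := by
    intro m
    induction m with
    | zero => simpa [hs0] using hstep 0
    | succ m ih =>
      exact htrans _ _ _ le_rfl (s _).2.1 (hmono (Nat.le_succ _)) (s _).2.2 ih (hstep (m + 1))
  simpa [hn (n + 1) (by omega)] using h n

/-! ### Integral curves -/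

section IntegralCurves

variable {E : Type*} [NormedAddCommGroup E] [NormedSpace ℝ E]
  {N : Type*} [TopologicalSpace N] [ChartedSpace E N]

/-- The vector field `X` is smooth, as a section of the tangent bundle. -/
def SmoothField (X : ∀ x : N, TangentSpace 𝓘(ℝ, E) x) [IsManifold 𝓘(ℝ, E) ∞ N] : Prop :=
  ContMDiff 𝓘(ℝ, E) 𝓘(ℝ, E).tangent ∞ (fun x => (⟨x, X x⟩ : TangentBundle 𝓘(ℝ, E) N))

variable [IsManifold 𝓘(ℝ, E) ∞ N] {X : ∀ x : N, TangentSpace 𝓘(ℝ, E) x}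

/-- An integral curve read in a chart solves the differential equation of the chart field. -/
theorem IsMIntegralCurveOn.hasDerivWithinAt_chart {e : ℝ → N} {s : Set ℝ} {t : ℝ}
    (h : IsMIntegralCurveOn (I := 𝓘(ℝ, E)) e X s) (ht : t ∈ s) {x₀ : N}
    (hsrc : e t ∈ (extChartAt 𝓘(ℝ, E) x₀).source) :
    HasDerivWithinAt (extChartAt 𝓘(ℝ, E) x₀ ∘ e)
      (chartField X x₀ (extChartAt 𝓘(ℝ, E) x₀ (e t))) s t := by
  have h1 := (mdifferentiableAt_chart hsrc).hasMFDerivAt.comp_hasMFDerivWithinAt t (h t ht)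
  have h2 : HasFDerivWithinAt (extChartAt 𝓘(ℝ, E) x₀ ∘ e)
      ((mfd E E (extChartAt 𝓘(ℝ, E) x₀) (e t)).comp
        (ContinuousLinearMap.smulRight (1 : ℝ →L[ℝ] ℝ) (show E from X (e t)))) s t :=
    hasMFDerivWithinAt_iff_hasFDerivWithinAt.1 h1
  refine h2.hasDerivWithinAt.congr_deriv ?_
  have h3 : chartField X x₀ (extChartAt 𝓘(ℝ, E) x₀ (e t)) =
      mfd E E (extChartAt 𝓘(ℝ, E) x₀) (e t) (X (e t)) := by
    rw [chartField, (extChartAt 𝓘(ℝ, E) x₀).left_inv hsrc]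
  rw [h3]
  change mfd E E (extChartAt 𝓘(ℝ, E) x₀) (e t) ((1 : ℝ) • X (e t)) = _
  rw [one_smul]

/-- A solution of the chart equation is the chart expression of an integral curve. -/
theorem hasMFDerivWithinAt_symm_of_hasDerivWithinAt {p : ℝ → E} {s : Set ℝ} {t : ℝ} {x₀ : N}
    (hp : HasDerivWithinAt p (chartField X x₀ (p t)) s t)
    (ht : p t ∈ (extChartAt 𝓘(ℝ, E) x₀).target) :
    HasMFDerivWithinAt 𝓘(ℝ, ℝ) 𝓘(ℝ, E) ((extChartAt 𝓘(ℝ, E) x₀).symm ∘ p) s t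
      ((1 : ℝ →L[ℝ] ℝ).smulRight (X ((extChartAt 𝓘(ℝ, E) x₀).symm (p t)))) := by
  have h1 := (mdifferentiableAt_chart_symm ht).hasMFDerivAt.comp_hasMFDerivWithinAt t
    hp.hasFDerivWithinAt.hasMFDerivWithinAt
  refine (h1 : HasMFDerivWithinAt 𝓘(ℝ, ℝ) 𝓘(ℝ, E) ((extChartAt 𝓘(ℝ, E) x₀).symm ∘ p) s t _
    ).congr_mfderiv ?_
  have := mfd_symm_chartField X ht
  rw [← this]
  ext
  change mfd E E (extChartAt 𝓘(ℝ, E) x₀).symm (p t) ((1 : ℝ) • chartField X x₀ (p t)) =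
    (1 : ℝ) • mfd E E (extChartAt 𝓘(ℝ, E) x₀).symm (p t) (chartField X x₀ (p t))
  rw [one_smul, one_smul]

theorem SmoothField.contDiffOn_chartField (hX : SmoothField X) (x₀ : N) :
    ContDiffOn ℝ ∞ (chartField X x₀) (extChartAt 𝓘(ℝ, E) x₀).target :=
  _root_.contDiffOn_chartField hX x₀

/-- Uniqueness of integral curves on a closed interval, from the initial time. -/
theorem IsMIntegralCurveOn.eqOn_Icc [T2Space N] (hX : SmoothField X) {e₁ e₂ : ℝ → N} {s : ℝ}
    (h₁ : IsMIntegralCurveOn (I := 𝓘(ℝ, E)) e₁ X (Icc 0 s))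
    (h₂ : IsMIntegralCurveOn (I := 𝓘(ℝ, E)) e₂ X (Icc 0 s)) (h0 : e₁ 0 = e₂ 0) :
    EqOn e₁ e₂ (Icc 0 s) := by
  rcases le_or_gt s 0 with hs | hs
  · intro t ht
    have : t = 0 := le_antisymm (ht.2.trans hs) ht.1
    rw [this, h0]
  set φ := extChartAt 𝓘(ℝ, E) (e₁ 0) with hφ
  have hxt : φ (e₁ 0) ∈ φ.target := mem_extChartAt_target _
  obtain ⟨K, B, hB, hK⟩ := (((hX.contDiffOn_chartField (e₁ 0)).contDiffAt
    ((isOpen_extChartAt_target _).mem_nhds hxt)).of_le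
      (m := 1) (by norm_cast)).exists_lipschitzOnWith
  -- both curves stay for a short time in the chart, where the field is Lipschitz
  have hnear : ∀ e : ℝ → N, IsMIntegralCurveOn (I := 𝓘(ℝ, E)) e X (Icc 0 s) → e 0 = e₁ 0 →
      ∃ δ > 0, δ ≤ s ∧ ∀ t ∈ Icc 0 δ, e t ∈ φ.source ∧ φ (e t) ∈ B := by
    intro e he he0
    have hc : ContinuousWithinAt e (Icc 0 s) 0 := he.continuousWithinAt ⟨le_rfl, hs.le⟩
    have hW : φ.source ∩ φ ⁻¹' B ∈ 𝓝 (e 0) := by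
      rw [he0]
      exact Filter.inter_mem (extChartAt_source_mem_nhds _)
        ((continuousAt_extChartAt _).preimage_mem_nhds hB)
    have := hc.preimage_mem_nhdsWithin hW
    rw [Metric.mem_nhdsWithin_iff] at this
    obtain ⟨ε, hε, hsub⟩ := this
    refine ⟨min (ε / 2) s, by positivity, min_le_right _ _, fun t ht => ?_⟩
    refine hsub ⟨?_, ht.1, ht.2.trans (min_le_right _ _)⟩
    rw [Metric.mem_ball, Real.dist_eq, sub_zero, abs_of_nonneg ht.1]
    linarith [ht.2.trans (min_le_left _ _)]
  obtain ⟨δ₁, hδ₁, hδ₁s, H₁⟩ := hnear e₁ h₁ rfl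
  obtain ⟨δ₂, hδ₂, hδ₂s, H₂⟩ := hnear e₂ h₂ h0.symm
  set δ := min δ₁ δ₂ with hδ
  have hδ0 : 0 < δ := lt_min hδ₁ hδ₂
  have hsol : ∀ e : ℝ → N, IsMIntegralCurveOn (I := 𝓘(ℝ, E)) e X (Icc 0 s) →
      (∀ t ∈ Icc 0 δ, e t ∈ φ.source ∧ φ (e t) ∈ B) →
      ContinuousOn (φ ∘ e) (Icc 0 δ) ∧
      ∀ t ∈ Ico 0 δ, HasDerivWithinAt (φ ∘ e) (chartField X (e₁ 0) ((φ ∘ e) t)) (Ici t) t := by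
    intro e he hH
    have hd : ∀ t ∈ Icc 0 δ, HasDerivWithinAt (φ ∘ e) (chartField X (e₁ 0) ((φ ∘ e) t))
        (Icc 0 s) t := fun t ht => he.hasDerivWithinAt_chart
          ⟨ht.1, ht.2.trans ((min_le_left _ _).trans hδ₁s)⟩ (hH t ht).1
    refine ⟨fun t ht => (hd t ht).continuousWithinAt.mono
      (Icc_subset_Icc_right ((min_le_left _ _).trans hδ₁s)), fun t ht => ?_⟩
    refine (hd t ⟨ht.1, ht.2.le⟩).mono_of_mem_nhdsWithin ?_
    have : Icc t s ∈ 𝓝[≥] t :=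
      Icc_mem_nhdsGE (ht.2.trans_le ((min_le_left _ _).trans hδ₁s))
    exact Filter.mem_of_superset this (Icc_subset_Icc_left ht.1)
  have M₁ : ∀ t ∈ Icc 0 δ, e₁ t ∈ φ.source ∧ φ (e₁ t) ∈ B :=
    fun t ht => H₁ t ⟨ht.1, ht.2.trans (min_le_left _ _)⟩
  have M₂ : ∀ t ∈ Icc 0 δ, e₂ t ∈ φ.source ∧ φ (e₂ t) ∈ B :=
    fun t ht => H₂ t ⟨ht.1, ht.2.trans (min_le_right _ _)⟩
  obtain ⟨c₁, d₁⟩ := hsol e₁ h₁ M₁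
  obtain ⟨c₂, d₂⟩ := hsol e₂ h₂ M₂
  have heq := ODE_solution_unique_of_mem_Icc_right (v := fun _ => chartField X (e₁ 0))
    (s := fun _ => B) (K := K) (fun _ _ => hK) c₁ d₁
    (fun t ht => (M₁ t ⟨ht.1, ht.2.le⟩).2) c₂ d₂ (fun t ht => (M₂ t ⟨ht.1, ht.2.le⟩).2)
    (congrArg φ h0)
  have heq' : ∀ t ∈ Icc 0 δ, e₁ t = e₂ t := fun t ht =>
    φ.injOn (M₁ t ht).1 (M₂ t ht).1 (heq ht)
  -- uniqueness on the open interval, then continuity at the end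
  have hδs : δ ≤ s := (min_le_left _ _).trans hδ₁s
  have hIoo : EqOn e₁ e₂ (Ioo 0 s) :=
    isMIntegralCurveOn_Ioo_eqOn_of_contMDiff_boundaryless (t₀ := δ / 2)
      ⟨by linarith, by linarith⟩ (ContMDiff.of_le hX (by norm_cast)) (h₁.mono Ioo_subset_Icc_self)
      (h₂.mono Ioo_subset_Icc_self) (heq' _ ⟨by linarith, by linarith⟩)
  have := hIoo.of_subset_closure h₁.continuousOn h₂.continuousOn Ioo_subset_Icc_self
    (by rw [closure_Ioo hs.ne])
  exact this

/-- An integral curve that starts at a regular point consists of regular points. -/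
theorem IsMIntegralCurveOn.ne_zero [T2Space N] (hX : SmoothField X) {e : ℝ → N} {s : ℝ}
    (h : IsMIntegralCurveOn (I := 𝓘(ℝ, E)) e X (Icc 0 s)) (h0 : X (e 0) ≠ 0) {t : ℝ}
    (ht : t ∈ Icc 0 s) : X (e t) ≠ 0 := by
  intro hzero
  have hX' : SmoothField (fun x => -X x) := ContMDiff.neg_section hX
  -- the time reversal of `e` and a constant curve are integral curves of `-X`
  have hrev : IsMIntegralCurveOn (I := 𝓘(ℝ, E)) (fun r => e (t - r)) (fun x => -X x) (Icc 0 t) := by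
    have h1 := (h.comp_add t).comp_mul (-1)
    have h2 : ((-1 : ℝ) • X : ∀ x : N, TangentSpace 𝓘(ℝ, E) x) = fun x => -X x := by
      funext x; simp
    rw [h2] at h1
    refine IsMIntegralCurveOn.mono (s := {r | r * -1 ∈ {r | r + t ∈ Icc 0 s}}) ?_ ?_
    · convert h1 using 1
      funext r
      simp only [Function.comp_apply]
      congr 1; ring
    · intro r hr
      simp only [mem_ofPred_eq, mem_Icc] at hr ⊢
      constructor <;> linarith [hr.1, hr.2, ht.2]
  have hconst : IsMIntegralCurveOn (I := 𝓘(ℝ, E)) (fun _ => e t) (fun x => -X x) (Icc 0 t) :=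
    (isMIntegralCurve_const (by simp [hzero])).isMIntegralCurveOn _
  have := IsMIntegralCurveOn.eqOn_Icc hX' hrev hconst (by simp) (right_mem_Icc.2 ht.1)
  simp only [sub_self] at this
  rw [← this] at hzero
  exact h0 hzero

end IntegralCurves

/-! ### Characteristic fields and their local flows -/

section CharField

variable {E : Type*} [NormedAddCommGroup E] [NormedSpace ℝ E]
  {N : Type*} [TopologicalSpace N] [ChartedSpace E N] [IsManifold 𝓘(ℝ, E) ∞ N]

/-- `X` is a characteristic vector field of the one-form `β`: it is tangent to `ker β`, and away
from its zeros `β` does not vanish and `i_X dβ = c β`. The value of `c` at a zero of `X` is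
arbitrary. -/
structure IsCharField (β : DForm E N 1) (X : ∀ x : N, TangentSpace 𝓘(ℝ, E) x) (c : N → ℝ) :
    Prop where
  smooth_field : SmoothField X
  smooth_form : β.IsSmooth
  tangent : ∀ x, β.val x ![X x] = 0
  form_ne_zero : ∀ x, X x ≠ 0 → ∃ w, β.val x ![w] ≠ 0
  interior : ∀ x, X x ≠ 0 → ∀ w, β.d.val x ![X x, w] = c x * β.val x ![w]

variable {β : DForm E N 1} {X : ∀ x : N, TangentSpace 𝓘(ℝ, E) x} {c : N → ℝ}

/-- A regular point has a neighbourhood in a chart, consisting of regular points, on which the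
coefficient `c` is smooth. -/
theorem IsCharField.exists_chart (h : IsCharField β X c) {x₀ : N} (hx₀ : X x₀ ≠ 0) :
    ∃ O : Set E, IsOpen O ∧ extChartAt 𝓘(ℝ, E) x₀ x₀ ∈ O ∧
      O ⊆ (extChartAt 𝓘(ℝ, E) x₀).target ∧
      (∀ y ∈ O, X ((extChartAt 𝓘(ℝ, E) x₀).symm y) ≠ 0) ∧
      ContDiffOn ℝ ∞ (fun y => c ((extChartAt 𝓘(ℝ, E) x₀).symm y)) O := by
  set φ := extChartAt 𝓘(ℝ, E) x₀ with hφ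
  have hto : IsOpen φ.target := isOpen_extChartAt_target x₀
  have hxt : φ x₀ ∈ φ.target := mem_extChartAt_target x₀
  have hxs : φ.symm (φ x₀) = x₀ := extChartAt_to_inv x₀
  have hv := h.smooth_field.contDiffOn_chartField x₀
  have hb := h.smooth_form.contDiffOn_chartCov x₀
  rw [← hφ] at hv hb
  obtain ⟨w, hw⟩ := h.form_ne_zero x₀ hx₀
  set e₀ : E := mfd E E φ x₀ w with he₀
  have hb0 : β.chartCov x₀ (φ x₀) e₀ ≠ 0 := by
    rw [DForm.chartCov_apply, ← hφ, he₀]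
    have := DFunLike.congr_fun (mfd_symm_comp_mfd (E := E) (mem_extChartAt_source x₀)) w
    rw [← hφ] at this
    simp only [ContinuousLinearMap.comp_apply, ContinuousLinearMap.id_apply] at this
    rwa [this, hxs]
  have hv0 : chartField X x₀ (φ x₀) ≠ 0 := by
    intro h0
    have := mfd_symm_chartField X (mem_extChartAt_target x₀)
    rw [← hφ, h0, map_zero, hxs] at this
    exact hx₀ this.symm
  have hbe : ContDiffOn ℝ ∞ (fun y => β.chartCov x₀ y e₀) φ.target := hb.clm_apply contDiffOn_const
  set O := φ.target ∩ ((fun y => chartField X x₀ y) ⁻¹' {0}ᶜ ∩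
    (fun y => β.chartCov x₀ y e₀) ⁻¹' {0}ᶜ) with hO
  have hOo : IsOpen O := by
    have h1 := hv.continuousOn.isOpen_inter_preimage hto (isOpen_compl_singleton (x := (0 : E)))
    have h2 := hbe.continuousOn.isOpen_inter_preimage hto (isOpen_compl_singleton (x := (0 : ℝ)))
    convert h1.inter h2 using 1
    ext y; simp only [hO, mem_inter_iff]; tauto
  have hX0 : ∀ y ∈ O, X (φ.symm y) ≠ 0 := by
    intro y hy h0
    apply hy.2.1
    change mfd E E φ (φ.symm y) (X (φ.symm y)) = 0
    rw [h0]; exact map_zero _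
  refine ⟨O, hOo, ⟨hxt, hv0, hb0⟩, inter_subset_left, hX0, ?_⟩
  have hDb : ContDiffOn ℝ ∞ (fderiv ℝ (β.chartCov x₀)) φ.target :=
    hb.fderiv_of_isOpen hto (by norm_cast)
  -- `c` is the quotient of `dβ(X, e₀)` by `β(e₀)` for a constant vector `e₀`
  have hquot : ContDiffOn ℝ ∞ (fun y => (fderiv ℝ (β.chartCov x₀) y (chartField X x₀ y) e₀ -
      fderiv ℝ (β.chartCov x₀) y e₀ (chartField X x₀ y)) / β.chartCov x₀ y e₀) O := by
    have s : O ⊆ φ.target := inter_subset_left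
    refine ContDiffOn.div (ContDiffOn.sub ?_ ?_) (hbe.mono s) (fun y hy => hy.2.2)
    · exact ((hDb.mono s).clm_apply (hv.mono s)).clm_apply contDiffOn_const
    · exact ((hDb.mono s).clm_apply contDiffOn_const).clm_apply (hv.mono s)
  refine hquot.congr fun y hy => ?_
  rw [eq_div_iff hy.2.2, ← DForm.val_d_chart_apply h.smooth_form hy.1, ← hφ,
    mfd_symm_chartField X hy.1, h.interior _ (hX0 y hy), ← DForm.chartCov_apply]

/-- The coefficient `c` is smooth at regular points. -/
theorem IsCharField.contMDiffAt_coeff (h : IsCharField β X c) {x₀ : N} (hx₀ : X x₀ ≠ 0) :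
    ContMDiffAt 𝓘(ℝ, E) 𝓘(ℝ) ∞ c x₀ := by
  obtain ⟨O, hO, hxO, hOt, -, hc⟩ := h.exists_chart hx₀
  have h1 : ContMDiffAt 𝓘(ℝ, E) 𝓘(ℝ) ∞ (fun y => c ((extChartAt 𝓘(ℝ, E) x₀).symm y))
      (extChartAt 𝓘(ℝ, E) x₀ x₀) := (hc.contDiffAt (hO.mem_nhds hxO)).contMDiffAt
  have h2 := h1.comp x₀ (contMDiffAt_extChartAt (I := 𝓘(ℝ, E)) (n := ∞))
  refine h2.congr_of_eventuallyEq ?_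
  filter_upwards [extChartAt_source_mem_nhds (I := 𝓘(ℝ, E)) x₀] with z hz
  simp only [Function.comp_apply, (extChartAt 𝓘(ℝ, E) x₀).left_inv hz]

theorem IsCharField.isOpen_regular (h : IsCharField β X c) : IsOpen {x | X x ≠ 0} := by
  rw [isOpen_iff_mem_nhds]
  intro x hx
  obtain ⟨O, hO, hxO, hOt, hX, -⟩ := h.exists_chart hx
  filter_upwards [extChartAt_source_mem_nhds (I := 𝓘(ℝ, E)) x,
    (continuousAt_extChartAt (I := 𝓘(ℝ, E)) x).preimage_mem_nhds (hO.mem_nhds hxO)] with z hz hz'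
  have := hX _ hz'
  rwa [(extChartAt 𝓘(ℝ, E) x).left_inv hz] at this

/-- The value of a vector field, as a vector of the model space, to which the tangent space is
definitionally equal. -/
def fieldVal (X : ∀ x : N, TangentSpace 𝓘(ℝ, E) x) (x : N) : E := X x

/-- A local flow `G` of `X` near `x₀`, defined on `E × ℝ` through the chart at `x₀`, together with
its spatial derivative `A z t`, which rescales `β` and the restriction of `dβ` to `ker β` by the
exponential of the integral of `c`. -/
structure IsLocalFlow (β : DForm E N 1) (X : ∀ x : N, TangentSpace 𝓘(ℝ, E) x) (c : N → ℝ)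
    (x₀ : N) (W : Set N) (ε : ℝ) (G : E × ℝ → N) (A : N → ℝ → E →L[ℝ] E) : Prop where
  isOpen : IsOpen W
  mem : x₀ ∈ W
  subset : W ⊆ (extChartAt 𝓘(ℝ, E) x₀).source
  pos : 0 < ε
  start : ∀ z ∈ W, G (extChartAt 𝓘(ℝ, E) x₀ z, 0) = z
  regular : ∀ z ∈ W, X z ≠ 0
  integral : ∀ z ∈ W, IsMIntegralCurveOn (I := 𝓘(ℝ, E))
    (fun t => G (extChartAt 𝓘(ℝ, E) x₀ z, t)) X (Ioo (-ε) ε)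
  deriv : ∀ z ∈ W, ∀ t ∈ Ioo 0 ε, HasMFDerivAt 𝓘(ℝ, E × ℝ) 𝓘(ℝ, E) G (extChartAt 𝓘(ℝ, E) x₀ z, t)
    (((A z t).comp (mfd E E (extChartAt 𝓘(ℝ, E) x₀).symm (extChartAt 𝓘(ℝ, E) x₀ z))).coprod
      (ContinuousLinearMap.toSpanSingleton ℝ (fieldVal X (G (extChartAt 𝓘(ℝ, E) x₀ z, t)))))
  form : ∀ z ∈ W, ∀ t ∈ Ioo (-ε) ε, ∀ u, β.val (G (extChartAt 𝓘(ℝ, E) x₀ z, t)) ![A z t u] =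
    Real.exp (∫ s in (0 : ℝ)..t, c (G (extChartAt 𝓘(ℝ, E) x₀ z, s))) * β.val z ![u]
  twoForm : ∀ z ∈ W, ∀ t ∈ Ioo (-ε) ε, ∀ u w, β.val z ![u] = 0 → β.val z ![w] = 0 →
    β.d.val (G (extChartAt 𝓘(ℝ, E) x₀ z, t)) ![A z t u, A z t w] =
    Real.exp (∫ s in (0 : ℝ)..t, c (G (extChartAt 𝓘(ℝ, E) x₀ z, s))) * β.d.val z ![u, w]

/-- The flow of the chart field near a regular point. The evolution of `β` and `dβ` is obtained in
the chart from the linear equations along integral curves. -/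
theorem IsCharField.exists_isLocalFlow [CompleteSpace E] (h : IsCharField β X c) {x₀ : N}
    (hx₀ : X x₀ ≠ 0) : ∃ W ε G A, IsLocalFlow β X c x₀ W ε G A := by
  obtain ⟨O, hO, hxO, hOt, hXO, hcO⟩ := h.exists_chart hx₀
  set φ := extChartAt 𝓘(ℝ, E) x₀ with hφ
  have hv := (h.smooth_field.contDiffOn_chartField x₀).mono hOt
  have hb := (h.smooth_form.contDiffOn_chartCov x₀).mono hOt
  obtain ⟨r, hr, ε, hε, Φ, A, H⟩ := exists_local_flow hO (hv.of_le (by norm_cast)) hxO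
  have h1 : ∀ y ∈ O, β.chartCov x₀ y (chartField X x₀ y) = 0 := by
    intro y hy
    rw [DForm.chartCov_apply, mfd_symm_chartField X (hOt hy), h.tangent]
  have h2 : ∀ y ∈ O, ∀ w, fderiv ℝ (β.chartCov x₀) y (chartField X x₀ y) w -
      fderiv ℝ (β.chartCov x₀) y w (chartField X x₀ y) = c (φ.symm y) * β.chartCov x₀ y w := by
    intro y hy w
    rw [← DForm.val_d_chart_apply h.smooth_form (hOt hy), mfd_symm_chartField X (hOt hy),
      h.interior _ (hXO y hy), DForm.chartCov_apply]
  have hε0 : (0 : ℝ) ∈ Ioo (-ε) ε := ⟨by linarith, hε⟩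
  set W : Set N := φ.source ∩ φ ⁻¹' (Metric.ball (φ x₀) r) with hW
  have hxW : ∀ z ∈ W, φ.symm (φ z) = z := fun z hz => φ.left_inv hz.1
  have hAinv : ∀ z ∈ W, ∀ u, mfd E E φ.symm (φ z) (mfd E E φ z u) = u := fun z hz u =>
    DFunLike.congr_fun (mfd_symm_comp_mfd (E := E) hz.1) u
  have hcont : ∀ z ∈ W, ContinuousOn (fun t => c (φ.symm (Φ (φ z) t))) (Ioo (-ε) ε) := by
    intro z hz t ht
    obtain ⟨hO', hd, -⟩ := (H _ hz.2).2.2 t ht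
    exact ((hcO.continuousOn.continuousAt (hO.mem_nhds hO')).comp
      (f := Φ (φ z)) hd.continuousAt).continuousWithinAt
  have hform : ∀ z ∈ W, ∀ t ∈ Ioo (-ε) ε, ∀ u, β.chartCov x₀ (Φ (φ z) t) (A (φ z) t u) =
      Real.exp (∫ s in (0 : ℝ)..t, c (φ.symm (Φ (φ z) s))) * β.chartCov x₀ (φ z) u := by
    intro z hz t ht u
    obtain ⟨hΦ0, hA0, HH⟩ := H _ hz.2
    have := eq_mul_exp_integral_of_hasDerivAt (hcont z hz)
      (h := fun t => β.chartCov x₀ (Φ (φ z) t) (A (φ z) t u)) (fun s hs => ?_) ht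
    · rw [this, hΦ0, hA0, ContinuousLinearMap.id_apply]
    · obtain ⟨hO', hd, hAd, -⟩ := HH s hs
      refine hasDerivAt_covector_along (c := fun y => c (φ.symm y)) hO (hb.of_le (by norm_cast))
        (hv.of_le (by norm_cast)) h1 h2 hO' hd ?_
      simpa using hAd.clm_apply (hasDerivAt_const s u)
  refine ⟨W, ε, fun q => φ.symm (Φ q.1 q.2),
    fun z t => (mfd E E φ.symm (Φ (φ z) t)).comp ((A (φ z) t).comp (mfd E E φ z)), ?_⟩
  constructor
  · exact (continuousOn_extChartAt x₀).isOpen_inter_preimage (isOpen_extChartAt_source x₀)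
      Metric.isOpen_ball
  · exact ⟨mem_extChartAt_source x₀, Metric.mem_ball_self hr⟩
  · exact inter_subset_left
  · exact hε
  · intro z hz
    simp only [← hφ, (H _ hz.2).1, hxW z hz]
  · intro z hz
    have := hXO _ ((H _ hz.2).2.2 0 hε0).1
    rwa [(H _ hz.2).1, hxW z hz] at this
  · intro z hz t ht
    obtain ⟨hO', hd, -⟩ := (H _ hz.2).2.2 t ht
    exact hasMFDerivWithinAt_symm_of_hasDerivWithinAt hd.hasDerivWithinAt (hOt hO')
  · intro z hz t ht
    have ht' : t ∈ Ioo (-ε) ε := ⟨by linarith [ht.1], ht.2⟩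
    obtain ⟨hO', -, -, hF⟩ := (H _ hz.2).2.2 t ht'
    have e1 := (mdifferentiableAt_chart_symm (hOt hO')).hasMFDerivAt.comp
      ((φ z, t) : E × ℝ) (hF ht.1).hasMFDerivAt
    refine (e1 : HasMFDerivAt 𝓘(ℝ, E × ℝ) 𝓘(ℝ, E) (fun q : E × ℝ => φ.symm (Φ q.1 q.2)) (φ z, t)
      _).congr_mfderiv ?_
    have e2 := mfd_symm_chartField X (hOt hO')
    have e3 : ∀ q, mfd E E φ z (mfd E E φ.symm (φ z) q) = q := by
      intro q
      have := DFunLike.congr_fun (mfd_comp_mfd_symm (E := E) (x₀ := x₀) (φ.map_source hz.1)) q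
      rw [← hφ, hxW z hz] at this
      exact this
    refine ContinuousLinearMap.ext fun q => ?_
    change mfd E E φ.symm (Φ (φ z) t) (A (φ z) t q.1 + q.2 • chartField X x₀ (Φ (φ z) t)) =
      mfd E E φ.symm (Φ (φ z) t) (A (φ z) t (mfd E E φ z (mfd E E φ.symm (φ z) q.1))) +
        q.2 • fieldVal X (φ.symm (Φ (φ z) t))
    rw [e3, map_add, map_smul]
    exact congrArg (fun r : E => mfd E E φ.symm (Φ (φ z) t) (A (φ z) t q.1) + q.2 • r) e2
  · intro z hz t ht u
    have := hform z hz t ht (mfd E E φ z u)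
    rw [DForm.chartCov_apply, DForm.chartCov_apply, ← hφ, hAinv z hz, hxW z hz] at this
    exact this
  · intro z hz t ht u w hu hw
    obtain ⟨hΦ0, hA0, HH⟩ := H _ hz.2
    have hker : ∀ u, β.val z ![u] = 0 → ∀ s ∈ Ioo (-ε) ε,
        β.chartCov x₀ (Φ (φ z) s) (A (φ z) s (mfd E E φ z u)) = 0 := by
      intro u hu s hs
      rw [hform z hz s hs, DForm.chartCov_apply, ← hφ, hAinv z hz, hxW z hz, hu, mul_zero]
    have key := eq_mul_exp_integral_of_hasDerivAt (hcont z hz)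
      (h := fun t => fderiv ℝ (β.chartCov x₀) (Φ (φ z) t) (A (φ z) t (mfd E E φ z u))
          (A (φ z) t (mfd E E φ z w)) - fderiv ℝ (β.chartCov x₀) (Φ (φ z) t)
          (A (φ z) t (mfd E E φ z w)) (A (φ z) t (mfd E E φ z u))) (fun s hs => ?_) ht
    · simp only [hΦ0, hA0, ContinuousLinearMap.id_apply] at key
      rw [← DForm.val_d_chart_apply h.smooth_form (hOt (HH t ht).1),
        ← DForm.val_d_chart_apply h.smooth_form (φ.map_source hz.1), ← hφ, hAinv z hz,
        hAinv z hz, hxW z hz] at key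
      exact key
    · obtain ⟨hO', hd, hAd, -⟩ := HH s hs
      refine hasDerivAt_twoForm_along (c := fun y => c (φ.symm y)) hO hb
        (hv.of_le (by norm_cast)) (hcO.of_le (by norm_cast)) h2 hO' hd ?_ ?_
        (hker u hu s hs) (hker w hw s hs)
      · simpa using hAd.clm_apply (hasDerivAt_const s (mfd E E φ z u))
      · simpa using hAd.clm_apply (hasDerivAt_const s (mfd E E φ z w))

end CharField

/-! ### Transport along integral curves -/

section Transport

variable {E : Type*} [NormedAddCommGroup E] [NormedSpace ℝ E]
  {N : Type*} [TopologicalSpace N] [ChartedSpace E N]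
  {β : DForm E N 1} {X : ∀ x : N, TangentSpace 𝓘(ℝ, E) x} {c : N → ℝ}

theorem HasMFDerivAt.prodMk_modelSpace {F F' : Type*} [NormedAddCommGroup F] [NormedSpace ℝ F]
    [NormedAddCommGroup F'] [NormedSpace ℝ F'] {f : N → F} {g : N → F'} {x : N} {f' : E →L[ℝ] F}
    {g' : E →L[ℝ] F'} (hf : HasMFDerivAt 𝓘(ℝ, E) 𝓘(ℝ, F) f x f')
    (hg : HasMFDerivAt 𝓘(ℝ, E) 𝓘(ℝ, F') g x g') :
    HasMFDerivAt 𝓘(ℝ, E) 𝓘(ℝ, F × F') (fun z => (f z, g z)) x (f'.prod g') :=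
  ⟨hf.1.prodMk hg.1, hf.2.prodMk hg.2⟩

/-- A segment of an integral curve, restarted at time zero. -/
theorem IsMIntegralCurveOn.shift {e : ℝ → N} {s a b : ℝ}
    (h : IsMIntegralCurveOn (I := 𝓘(ℝ, E)) e X (Icc 0 s)) (ha : 0 ≤ a) (hb : b ≤ s) :
    IsMIntegralCurveOn (I := 𝓘(ℝ, E)) (fun r => e (a + r)) X (Icc 0 (b - a)) := by
  have h1 := (h.comp_add a).mono (s' := Icc 0 (b - a)) (fun r hr => by
    simp only [mem_ofPred_eq, mem_Icc] at hr ⊢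
    constructor <;> linarith [hr.1, hr.2])
  convert h1 using 1
  funext r
  simp only [Function.comp_apply, add_comm]

/-- `φ` is the germ at `x` of the time-`s` flow map of `X`, it takes `x` to `x'`, and its derivative
`A` rescales `β` and the restriction of `dβ` to `ker β` by `κ`. The flow property is stated for
those points near `x` whose integral curve exists up to time `s`. -/
structure IsTransport (β : DForm E N 1) (X : ∀ x : N, TangentSpace 𝓘(ℝ, E) x) (x x' : N)
    (s κ : ℝ) (φ : N → N) (A : E →L[ℝ] E) : Prop where
  map : φ x = x'
  flow : ∀ᶠ z in 𝓝 x, ∀ e : ℝ → N, IsMIntegralCurveOn (I := 𝓘(ℝ, E)) e X (Icc 0 s) → e 0 = z →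
    e s = φ z
  deriv : HasMFDerivAt 𝓘(ℝ, E) 𝓘(ℝ, E) φ x A
  form : ∀ u, β.val x' ![A u] = κ * β.val x ![u]
  twoForm : ∀ u w, β.val x ![u] = 0 → β.val x ![w] = 0 →
    β.d.val x' ![A u, A w] = κ * β.d.val x ![u, w]

theorem IsTransport.refl (x : N) :
    IsTransport β X x x 0 1 id (ContinuousLinearMap.id ℝ E) where
  map := rfl
  flow := Filter.Eventually.of_forall fun z e _ h => h
  deriv := hasMFDerivAt_id x
  form := by simp
  twoForm := by simp

theorem IsTransport.trans {x x' x'' : N} {s s' κ κ' : ℝ} {φ φ' : N → N} {A A' : E →L[ℝ] E}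
    (h : IsTransport β X x x' s κ φ A) (h' : IsTransport β X x' x'' s' κ' φ' A') (hs : 0 ≤ s)
    (hs' : 0 ≤ s') : IsTransport β X x x'' (s + s') (κ * κ') (φ' ∘ φ) (A'.comp A) where
  map := by simp [h.map, h'.map]
  flow := by
    have hc : Filter.Tendsto φ (𝓝 x) (𝓝 x') := h.map ▸ h.deriv.continuousAt
    filter_upwards [h.flow, hc.eventually h'.flow] with z hz hz' e he he0
    have h1 := hz e (he.mono (Icc_subset_Icc_right (by linarith))) he0
    have h2 := he.shift (a := s) (b := s + s') hs le_rfl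
    rw [add_sub_cancel_left] at h2
    exact hz' _ h2 (by simpa using h1)
  deriv := by
    have := h'.deriv
    rw [← h.map] at this
    exact this.comp x h.deriv
  form := by
    intro u
    rw [ContinuousLinearMap.comp_apply, h'.form, h.form]; ring
  twoForm := by
    intro u w hu hw
    rw [ContinuousLinearMap.comp_apply, ContinuousLinearMap.comp_apply, h'.twoForm,
      h.twoForm u w hu hw]
    · ring
    · rw [h.form, hu, mul_zero]
    · rw [h.form, hw, mul_zero]

variable [IsManifold 𝓘(ℝ, E) ∞ N]

/-- An integral curve starting in the domain of a local flow follows the local flow. -/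
theorem IsLocalFlow.eq_of_integral [T2Space N] (hX : SmoothField X) {x₀ : N} {W : Set N} {ε : ℝ}
    {G : E × ℝ → N} {A : N → ℝ → E →L[ℝ] E} (h : IsLocalFlow β X c x₀ W ε G A) {e : ℝ → N} {t : ℝ}
    (he : IsMIntegralCurveOn (I := 𝓘(ℝ, E)) e X (Icc 0 t)) (he0 : e 0 ∈ W) (ht : t < ε) :
    ∀ r ∈ Icc 0 t, e r = G (extChartAt 𝓘(ℝ, E) x₀ (e 0), r) := by
  refine IsMIntegralCurveOn.eqOn_Icc hX he ((h.integral _ he0).mono ?_) (h.start _ he0).symm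
  exact fun r hr => ⟨by linarith [hr.1, h.pos], hr.2.trans_lt ht⟩

/-- The local flow at a positive time is a transport. -/
theorem IsLocalFlow.isTransport [T2Space N] (hX : SmoothField X) {x₀ : N} {W : Set N} {ε : ℝ}
    {G : E × ℝ → N} {A : N → ℝ → E →L[ℝ] E} (h : IsLocalFlow β X c x₀ W ε G A) {z : N} (hz : z ∈ W)
    {t : ℝ} (ht : t ∈ Ioo 0 ε) :
    IsTransport β X z (G (extChartAt 𝓘(ℝ, E) x₀ z, t)) t
      (Real.exp (∫ s in (0 : ℝ)..t, c (G (extChartAt 𝓘(ℝ, E) x₀ z, s))))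
      (fun z' => G (extChartAt 𝓘(ℝ, E) x₀ z', t)) (A z t) where
  map := rfl
  flow := by
    filter_upwards [h.isOpen.mem_nhds hz] with z' hz' e he he0
    have := h.eq_of_integral hX he (by rwa [he0]) ht.2 t ⟨ht.1.le, le_rfl⟩
    rw [this, he0]
  deriv := by
    set φ := extChartAt 𝓘(ℝ, E) x₀
    have h1 : HasMFDerivAt 𝓘(ℝ, E) 𝓘(ℝ, E × ℝ) (fun z' => (φ z', t)) z
        ((mfd E E φ z).prod (0 : E →L[ℝ] ℝ)) :=
      HasMFDerivAt.prodMk_modelSpace (mdifferentiableAt_chart (h.subset hz)).hasMFDerivAt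
        (hasMFDerivAt_const t z)
    have h2 := (h.deriv z hz t ht).comp z h1
    refine (h2 : HasMFDerivAt 𝓘(ℝ, E) 𝓘(ℝ, E) (fun z' => G (φ z', t)) z _).congr_mfderiv ?_
    refine ContinuousLinearMap.ext fun u => ?_
    have h3 : mfd E E φ.symm (φ z) (mfd E E φ z u) = u :=
      DFunLike.congr_fun (mfd_symm_comp_mfd (E := E) (h.subset hz)) u
    change A z t (mfd E E φ.symm (φ z) (mfd E E φ z u)) + (0 : ℝ) • fieldVal X (G (φ z, t)) =
      A z t u
    rw [h3, zero_smul, add_zero]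
  form := h.form z hz t ⟨by linarith [ht.1, h.pos], ht.2⟩
  twoForm := h.twoForm z hz t ⟨by linarith [ht.1, h.pos], ht.2⟩

/-- Along an integral curve, a local flow gives the transport between two nearby points. -/
theorem IsLocalFlow.isTransport_curve [T2Space N] (hX : SmoothField X) {x₀ : N} {W : Set N} {ε : ℝ}
    {G : E × ℝ → N} {A : N → ℝ → E →L[ℝ] E} (hG : IsLocalFlow β X c x₀ W ε G A) {e : ℝ → N}
    {s x y : ℝ} (he : IsMIntegralCurveOn (I := 𝓘(ℝ, E)) e X (Icc 0 s)) (hx : 0 ≤ x) (hxy : x < y)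
    (hy : y ≤ s) (hxW : e x ∈ W) (hyx : y - x < ε) :
    IsTransport β X (e x) (e y) (y - x) (Real.exp (∫ t in x..y, c (e t)))
      (fun z' => G (extChartAt 𝓘(ℝ, E) x₀ z', y - x)) (A (e x) (y - x)) := by
  have heq := hG.eq_of_integral hX (he.shift (a := x) (b := y) hx hy) (by simpa using hxW) hyx
  simp only [add_zero] at heq
  have htr := hG.isTransport hX hxW (t := y - x) ⟨by linarith, hyx⟩
  have h1 := heq (y - x) ⟨by linarith, le_rfl⟩
  rw [add_sub_cancel] at h1
  have h2 : ∫ r in (0 : ℝ)..(y - x), c (G (extChartAt 𝓘(ℝ, E) x₀ (e x), r)) =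
      ∫ r in x..y, c (e r) := by
    rw [intervalIntegral.integral_congr (g := fun r => c (e (x + r)))]
    · rw [intervalIntegral.integral_comp_add_left (fun r => c (e r)) x]
      simp
    · intro r hr
      rw [uIcc_of_le (by linarith)] at hr
      simp only [heq r hr]
  rwa [h2, ← h1] at htr

theorem IsCharField.continuousOn_coeff [T2Space N] (h : IsCharField β X c) {e : ℝ → N} {s : ℝ}
    (he : IsMIntegralCurveOn (I := 𝓘(ℝ, E)) e X (Icc 0 s)) (h0 : X (e 0) ≠ 0) :
    ContinuousOn (fun t => c (e t)) (Icc 0 s) := fun t ht =>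
  (h.contMDiffAt_coeff (he.ne_zero h.smooth_field h0 ht)).continuousAt.comp_continuousWithinAt
    (he.continuousOn t ht)

/-- Along an integral curve through regular points, the flow rescales `β`, and `dβ` on `ker β`, by
the exponential of the integral of `c`. -/
theorem IsCharField.exists_isTransport [CompleteSpace E] [T2Space N] (h : IsCharField β X c)
    {e : ℝ → N} {s : ℝ} (hs : 0 ≤ s) (he : IsMIntegralCurveOn (I := 𝓘(ℝ, E)) e X (Icc 0 s))
    (h0 : X (e 0) ≠ 0) :
    ∃ φ A, IsTransport β X (e 0) (e s) s (Real.exp (∫ t in (0 : ℝ)..s, c (e t))) φ A := by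
  have hcont := h.continuousOn_coeff he h0
  have key := Icc_chain (P := fun a b => ∃ φ A, IsTransport β X (e a) (e b) (b - a)
    (Real.exp (∫ t in a..b, c (e t))) φ A) hs ?_ ?_
  · simpa using key
  · rintro x y z hx hxy hyz hz ⟨φ, A, h1⟩ ⟨φ', A', h2⟩
    refine ⟨φ' ∘ φ, A'.comp A, ?_⟩
    have hi : ∀ a b, 0 ≤ a → a ≤ b → b ≤ s →
        IntervalIntegrable (fun t => c (e t)) MeasureTheory.volume a b := fun a b ha hab hb =>
      (hcont.mono (by rw [uIcc_of_le hab]; exact Icc_subset_Icc ha hb)).intervalIntegrable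
    have h3 := h1.trans h2 (by linarith) (by linarith)
    rw [← Real.exp_add, intervalIntegral.integral_add_adjacent_intervals
      (hi x y hx hxy (hyz.trans hz)) (hi y z (hx.trans hxy) hyz hz)] at h3
    convert h3 using 1
    ring
  · intro t ht
    obtain ⟨W, ε, G, A, hG⟩ := h.exists_isLocalFlow (he.ne_zero h.smooth_field h0 ht)
    have hW := (he.continuousOn t ht).preimage_mem_nhdsWithin (hG.isOpen.mem_nhds hG.mem)
    rw [Metric.mem_nhdsWithin_iff] at hW
    obtain ⟨δ, hδ, hsub⟩ := hW
    refine ⟨min δ (ε / 2), lt_min hδ (half_pos hG.pos), fun x hx y hy hxt hyt hxy => ?_⟩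
    have hxW : e x ∈ W := hsub ⟨by
      rw [Metric.mem_ball, Real.dist_eq]; exact hxt.trans_le (min_le_left _ _), hx⟩
    rcases hxy.eq_or_lt with rfl | hlt
    · refine ⟨id, ContinuousLinearMap.id ℝ E, ?_⟩
      simpa using IsTransport.refl (β := β) (X := X) (e x)
    have hyx : y - x < ε := by
      have h1 := (abs_lt.1 (hxt.trans_le (min_le_right _ _))).1
      have h2 := (abs_lt.1 (hyt.trans_le (min_le_right _ _))).2
      linarith
    exact ⟨_, _, hG.isTransport_curve h.smooth_field he hx.1 hlt hy.2 hxW hyx⟩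

end Transport

/-! ### Immersions -/

section Slice

variable {E : Type*} [NormedAddCommGroup E] [NormedSpace ℝ E]
  {E' : Type*} [NormedAddCommGroup E'] [NormedSpace ℝ E']
  {N : Type*} [TopologicalSpace N] [ChartedSpace E N]
  {N' : Type*} [TopologicalSpace N'] [ChartedSpace E' N']

/-- An immersion has a smooth local retraction, and every vector outside its image is detected by
the differential of a function that vanishes on the image. -/
theorem Manifold.IsImmersionAt.exists_retraction {f : N → N'} {x : N}
    (hf : Manifold.IsImmersionAt 𝓘(ℝ, E) 𝓘(ℝ, E') ∞ f x) :
    ∃ π : N' → N, ContMDiffAt 𝓘(ℝ, E') 𝓘(ℝ, E) ∞ π (f x) ∧ (∀ᶠ w in 𝓝 x, π (f w) = w) ∧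
      ∀ v : E', v ∉ range (mfd E E' f x) → ∃ ℓ : N' → ℝ, ContMDiffAt 𝓘(ℝ, E') 𝓘(ℝ) ∞ ℓ (f x) ∧
        (∀ᶠ w in 𝓝 x, ℓ (f w) = 0) ∧ mfd E' ℝ ℓ (f x) v ≠ 0 := by
  have hfx : ContMDiffAt 𝓘(ℝ, E) 𝓘(ℝ, E') ∞ f x := hf.contMDiffAt
  obtain ⟨F, _, _, hF⟩ := hf
  set dc := hF.domChart
  set cc := hF.codChart
  set q := hF.equiv
  have hxd : x ∈ dc.source := hF.mem_domChart_source
  have hxc : f x ∈ cc.source := hF.mem_codChart_source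
  have hwr : ∀ w ∈ dc.source, cc (f w) = q (dc w, 0) := by
    intro w hw
    have h1 : dc w ∈ (dc.extend 𝓘(ℝ, E)).target := by
      simpa [mfld_simps] using dc.map_source hw
    have h2 := hF.writtenInCharts h1
    change cc (f (dc.symm (dc w))) = q (dc w, 0) at h2
    rwa [dc.left_inv hw] at h2
  have hdcA := hF.domChart_mem_maximalAtlas
  have hccA := hF.codChart_mem_maximalAtlas
  -- the straightening map and its inverse
  set r : N' → E × F := fun w => q.symm (cc w) with hr
  have hrs : ContMDiffAt 𝓘(ℝ, E') 𝓘(ℝ, E × F) ∞ r (f x) :=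
    (q.symm.contDiff.contMDiff.contMDiffAt).comp (f x)
      ((contMDiffOn_of_mem_maximalAtlas hccA).contMDiffAt (cc.open_source.mem_nhds hxc))
  have hrf : ∀ w ∈ dc.source, r (f w) = (dc w, 0) := by
    intro w hw; simp [hr, hwr w hw]
  set r' : E × F → N' := fun y => cc.symm (q y) with hr'
  have hr's : ContMDiffAt 𝓘(ℝ, E × F) 𝓘(ℝ, E') ∞ r' (r (f x)) := by
    refine ContMDiffAt.comp (I' := 𝓘(ℝ, E')) (r (f x)) ?_ q.contDiff.contMDiff.contMDiffAt
    have : q (r (f x)) = cc (f x) := by simp [hr]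
    rw [this]
    exact (contMDiffOn_symm_of_mem_maximalAtlas hccA).contMDiffAt
      (cc.open_target.mem_nhds (cc.map_source hxc))
  have hr'r : r' ∘ r =ᶠ[𝓝 (f x)] id := by
    filter_upwards [cc.open_source.mem_nhds hxc] with w hw
    simp [hr, hr', cc.left_inv hw]
  have hrinj : Function.Injective (mfd E' (E × F) r (f x)) := by
    have h1 : (mfd (E × F) E' r' (r (f x))).comp (mfd E' (E × F) r (f x)) =
        ContinuousLinearMap.id ℝ E' := by
      rw [← mfd_comp (hr's.mdifferentiableAt (by simp)) (hrs.mdifferentiableAt (by simp)),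
        mfd_congr hr'r, mfd_id]
    exact Function.LeftInverse.injective (g := mfd (E × F) E' r' (r (f x)))
      fun v => DFunLike.congr_fun h1 v
  set π : N' → N := fun w => dc.symm (r w).1 with hπ
  have hπs : ContMDiffAt 𝓘(ℝ, E') 𝓘(ℝ, E) ∞ π (f x) := by
    refine ContMDiffAt.comp (I' := 𝓘(ℝ, E)) (f x) (g := dc.symm) (f := fun w => (r w).1) ?_
      ((contDiff_fst.contMDiff.contMDiffAt).comp (f x) hrs)
    rw [hrf x hxd]
    exact (contMDiffOn_symm_of_mem_maximalAtlas hdcA).contMDiffAt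
      (dc.open_target.mem_nhds (dc.map_source hxd))
  have hπf : ∀ w ∈ dc.source, π (f w) = w := by
    intro w hw; simp [hπ, hrf w hw, dc.left_inv hw]
  refine ⟨π, hπs, ?_, fun v hv => ?_⟩
  · filter_upwards [dc.open_source.mem_nhds hxd] with w hw using hπf w hw
  -- the second component of the straightened vector does not vanish
  have hne : (mfd E' (E × F) r (f x) v).2 ≠ 0 := by
    intro h0
    apply hv
    refine ⟨mfd E' E π (f x) v, hrinj ?_⟩
    have h1 : r ∘ f ∘ π =ᶠ[𝓝 (f x)] fun w => ((ContinuousLinearMap.inl ℝ E F).comp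
        (ContinuousLinearMap.fst ℝ E F)) (r w) := by
      have e1 : ∀ᶠ w in 𝓝 (f x), π w ∈ dc.source := by
        refine hπs.continuousAt.eventually_mem ?_
        rw [hπf x hxd]; exact dc.open_source.mem_nhds hxd
      have e2 : ∀ᶠ w in 𝓝 (f x), (r w).1 ∈ dc.target := by
        refine (hrs.continuousAt.fst).eventually_mem ?_
        rw [hrf x hxd]; exact dc.open_target.mem_nhds (dc.map_source hxd)
      filter_upwards [e1, e2] with w hw1 hw2
      simp only [Function.comp_apply, hrf _ hw1]
      simp [hπ, dc.right_inv hw2]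
    have hfx' : ContMDiffAt 𝓘(ℝ, E) 𝓘(ℝ, E') ∞ f (π (f x)) := by rwa [hπf x hxd]
    have hrs' : ContMDiffAt 𝓘(ℝ, E') 𝓘(ℝ, E × F) ∞ r ((f ∘ π) (f x)) := by
      simpa only [Function.comp_apply, hπf x hxd] using hrs
    have h2 := mfd_congr (E := E') (E' := E × F) h1
    rw [mfd_comp (hrs'.mdifferentiableAt (by simp)) ((hfx'.comp _ hπs).mdifferentiableAt (by simp)),
      mfd_comp (hfx'.mdifferentiableAt (by simp)) (hπs.mdifferentiableAt (by simp))] at h2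
    have h3 := mfd_comp (E := E') (E' := E × F) (E'' := E × F)
      (g := ((ContinuousLinearMap.inl ℝ E F).comp (ContinuousLinearMap.fst ℝ E F))) (f := r)
      (ContinuousLinearMap.differentiableAt _).mdifferentiableAt (hrs.mdifferentiableAt (by simp))
    have h4 := DFunLike.congr_fun (h2.trans h3) v
    rw [mfd_eq_fderiv, ContinuousLinearMap.fderiv] at h4
    simp only [Function.comp_apply, hπf x hxd, ContinuousLinearMap.comp_apply] at h4
    rw [h4]
    exact Prod.ext rfl h0.symm
  obtain ⟨ℓ₀, hℓ₀⟩ := SeparatingDual.exists_ne_zero (R := ℝ) hne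
  have hg : Differentiable ℝ (ℓ₀.comp (ContinuousLinearMap.snd ℝ E F)) :=
    ContinuousLinearMap.differentiable _
  refine ⟨fun w => (ℓ₀.comp (ContinuousLinearMap.snd ℝ E F)) (r w), ?_, ?_, ?_⟩
  · exact ((ContinuousLinearMap.contDiff _).contMDiff.contMDiffAt).comp (f x) hrs
  · filter_upwards [dc.open_source.mem_nhds hxd] with w hw
    simp [hrf w hw]
  · have h3 := mfd_comp (E := E') (E' := E × F) (E'' := ℝ)
      (g := ℓ₀.comp (ContinuousLinearMap.snd ℝ E F)) (f := r)
      (hg _).mdifferentiableAt (hrs.mdifferentiableAt (by simp))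
    rw [mfd_eq_fderiv, ContinuousLinearMap.fderiv] at h3
    have h4 := DFunLike.congr_fun h3 v
    intro h5
    exact hℓ₀ (h4.symm.trans h5)

/-- The differential of an immersion is injective. -/
theorem Manifold.IsImmersionAt.injective_mfd {f : N → N'} {x : N}
    (hf : Manifold.IsImmersionAt 𝓘(ℝ, E) 𝓘(ℝ, E') ∞ f x) : Function.Injective (mfd E E' f x) := by
  obtain ⟨π, hπ, hπf, -⟩ := hf.exists_retraction
  have h1 : (mfd E' E π (f x)).comp (mfd E E' f x) = ContinuousLinearMap.id ℝ E := by
    rw [← mfd_comp (hπ.mdifferentiableAt (by simp)) (hf.contMDiffAt.mdifferentiableAt (by simp)),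
      mfd_congr (show π ∘ f =ᶠ[𝓝 x] id from hπf), mfd_id]
  exact Function.LeftInverse.injective (g := mfd E' E π (f x)) fun v => DFunLike.congr_fun h1 v

end Slice

/-! ### Return maps to a transversal -/

section Return

variable {E : Type*} [NormedAddCommGroup E] [NormedSpace ℝ E]
  {N : Type*} [TopologicalSpace N] [ChartedSpace E N] [IsManifold 𝓘(ℝ, E) ∞ N]
  {β : DForm E N 1} {X : ∀ x : N, TangentSpace 𝓘(ℝ, E) x} {c : N → ℝ}

/-- The linear maps `A + σ ⊗ X` rescale `β`, and `dβ` on `ker β`, as `A` does. -/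
theorem IsCharField.scale_add_smul (h : IsCharField β X c) {x x' : N} {κ : ℝ} {A : E →L[ℝ] E}
    (hx' : X x' ≠ 0) (h1 : ∀ u, β.val x' ![A u] = κ * β.val x ![u])
    (h2 : ∀ u w, β.val x ![u] = 0 → β.val x ![w] = 0 →
      β.d.val x' ![A u, A w] = κ * β.d.val x ![u, w]) :
    (∀ u (r : ℝ), β.val x' ![A u + r • fieldVal X x'] = κ * β.val x ![u]) ∧
    ∀ u w (r s : ℝ), β.val x ![u] = 0 → β.val x ![w] = 0 →
      β.d.val x' ![A u + r • fieldVal X x', A w + s • fieldVal X x'] =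
        κ * β.d.val x ![u, w] := by
  have hX : β.val x' ![fieldVal X x'] = 0 := h.tangent x'
  have hi : ∀ w, β.d.val x' ![fieldVal X x', w] = c x' * β.val x' ![w] := h.interior x' hx'
  constructor
  · intro u r
    rw [← ContinuousAlternatingMap.toCov_apply, map_add, map_smul,
      ContinuousAlternatingMap.toCov_apply, ContinuousAlternatingMap.toCov_apply, hX, h1]
    simp
  · intro u w r s hu hw
    have hsk : ∀ v, β.d.val x' ![v, fieldVal X x'] = -β.d.val x' ![fieldVal X x', v] := by
      intro v
      exact ((β.d.val x').toBilin_isAlt.neg (fieldVal X x') v).symm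
    have hXX : β.d.val x' ![fieldVal X x', fieldVal X x'] = 0 := by rw [hi, hX, mul_zero]
    rw [← ContinuousAlternatingMap.toBilin_apply]
    simp only [map_add, map_smul, LinearMap.add_apply, LinearMap.smul_apply,
      ContinuousAlternatingMap.toBilin_apply, hXX, hsk (A u), hi, h1, hu, hw, h2 u w hu hw]
    simp

variable [CompleteSpace E] [T2Space N]
  {E' : Type*} [NormedAddCommGroup E'] [NormedSpace ℝ E']
  {L : Type*} [TopologicalSpace L] [ChartedSpace E' L] [IsManifold 𝓘(ℝ, E') ∞ L]

/-- A continuous first return map to an embedded hypersurface transverse to `X` is differentiable;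
its differential rescales `β`, and `dβ` on `ker β`, by the exponential of the integral of `c` along
the orbit segment. The return map is the flow for a fixed time followed by the flow for a time that
depends on the point, so its differential is that of the fixed time flow up to multiples of `X`. -/
theorem IsCharField.return_map (h : IsCharField β X c) {incl : L → N}
    (hincl : Manifold.IsSmoothEmbedding 𝓘(ℝ, E') 𝓘(ℝ, E) ∞ incl) {P : L → L} {τ : L → ℝ} {y₀ : L}
    (hτc : ContinuousAt τ y₀) (hτ0 : 0 < τ y₀)
    (hret : ∀ᶠ y in 𝓝 y₀, ∃ e : ℝ → N, IsMIntegralCurveOn (I := 𝓘(ℝ, E)) e X (Icc 0 (τ y)) ∧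
      e 0 = incl y ∧ e (τ y) = incl (P y))
    {e₀ : ℝ → N} (he₀ : IsMIntegralCurveOn (I := 𝓘(ℝ, E)) e₀ X (Icc 0 (τ y₀)))
    (he0 : e₀ 0 = incl y₀) (heτ : e₀ (τ y₀) = incl (P y₀)) (hX0 : X (incl y₀) ≠ 0)
    (htr : fieldVal X (incl (P y₀)) ∉ range (mfd E' E incl (P y₀))) :
    MDifferentiableAt 𝓘(ℝ, E') 𝓘(ℝ, E') P y₀ ∧
    (∀ u, β.val (incl (P y₀)) ![mfd E' E incl (P y₀) (mfd E' E' P y₀ u)] =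
      Real.exp (∫ t in (0 : ℝ)..τ y₀, c (e₀ t)) * β.val (incl y₀) ![mfd E' E incl y₀ u]) ∧
    ∀ u w, β.val (incl y₀) ![mfd E' E incl y₀ u] = 0 →
      β.val (incl y₀) ![mfd E' E incl y₀ w] = 0 →
      β.d.val (incl (P y₀)) ![mfd E' E incl (P y₀) (mfd E' E' P y₀ u),
        mfd E' E incl (P y₀) (mfd E' E' P y₀ w)] =
      Real.exp (∫ t in (0 : ℝ)..τ y₀, c (e₀ t)) *
        β.d.val (incl y₀) ![mfd E' E incl y₀ u, mfd E' E incl y₀ w] := by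
  have hXe : X (e₀ 0) ≠ 0 := by rwa [he0]
  have hX1 : X (incl (P y₀)) ≠ 0 := by
    rw [← heτ]; exact he₀.ne_zero h.smooth_field hXe ⟨hτ0.le, le_rfl⟩
  obtain ⟨W, ε, G, A, hG⟩ := h.exists_isLocalFlow hX1
  set φ := extChartAt 𝓘(ℝ, E) (incl (P y₀)) with hφ
  -- a time `t₀` shortly before the return
  obtain ⟨t₀, ht₀0, ht₀τ, ht₀ε, ht₀W⟩ : ∃ t₀, 0 ≤ t₀ ∧ t₀ < τ y₀ ∧ τ y₀ - t₀ < ε ∧ e₀ t₀ ∈ W := by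
    have hc := he₀.continuousWithinAt (t₀ := τ y₀) ⟨hτ0.le, le_rfl⟩
    have hW := hc.preimage_mem_nhdsWithin (hG.isOpen.mem_nhds (heτ ▸ hG.mem))
    rw [Metric.mem_nhdsWithin_iff] at hW
    obtain ⟨δ, hδ, hsub⟩ := hW
    set s := min (min (δ / 2) (ε / 2)) (τ y₀) with hs
    have hs0 : 0 < s := lt_min (lt_min (half_pos hδ) (half_pos hG.pos)) hτ0
    have hs1 : s ≤ δ / 2 := (min_le_left _ _).trans (min_le_left _ _)
    have hs2 : s ≤ ε / 2 := (min_le_left _ _).trans (min_le_right _ _)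
    have hs3 : s ≤ τ y₀ := min_le_right _ _
    have := hG.pos
    refine ⟨τ y₀ - s, by linarith, by linarith, by linarith, hsub ⟨?_, by linarith, by linarith⟩⟩
    rw [Metric.mem_ball, Real.dist_eq, sub_sub_cancel_left, abs_neg, abs_of_pos hs0]
    linarith
  obtain ⟨φ₁, A₁, hT₁⟩ := h.exists_isTransport ht₀0
    (he₀.mono (Icc_subset_Icc_right ht₀τ.le)) hXe
  rw [he0] at hT₁
  have hT₂ := hG.isTransport_curve h.smooth_field he₀ ht₀0 ht₀τ le_rfl ht₀W ht₀ε
  have hT := hT₁.trans hT₂ ht₀0 (by linarith)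
  have hXt : ∀ t ∈ Icc 0 (τ y₀), X (e₀ t) ≠ 0 := fun t ht => he₀.ne_zero h.smooth_field hXe ht
  have hcc := h.continuousOn_coeff he₀ hXe
  rw [← Real.exp_add, intervalIntegral.integral_add_adjacent_intervals
    ((hcc.mono (by rw [uIcc_of_le ht₀0]; exact Icc_subset_Icc_right ht₀τ.le)).intervalIntegrable)
    ((hcc.mono (by rw [uIcc_of_le ht₀τ.le]; exact Icc_subset_Icc_left ht₀0)).intervalIntegrable),
    heτ] at hT
  set κ := Real.exp (∫ t in (0 : ℝ)..τ y₀, c (e₀ t)) with hκ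
  set σ : L → ℝ := fun y => τ y - t₀ with hσ
  have hσ0 : σ y₀ ∈ Ioo 0 ε := ⟨by simp only [hσ]; linarith, ht₀ε⟩
  have hσc : ContinuousAt σ y₀ := hτc.sub continuousAt_const
  have hinclS : ContMDiff 𝓘(ℝ, E') 𝓘(ℝ, E) ∞ incl := hincl.contMDiff
  have hDi : ∀ y, HasMFDerivAt 𝓘(ℝ, E') 𝓘(ℝ, E) incl y (mfd E' E incl y) := fun y =>
    ((hinclS y).mdifferentiableAt (by simp)).hasMFDerivAt
  set ζ : L → N := fun y => φ₁ (incl y) with hζ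
  have hζ0 : ζ y₀ = e₀ t₀ := hT₁.map
  have hζd : HasMFDerivAt 𝓘(ℝ, E') 𝓘(ℝ, E) ζ y₀ (A₁.comp (mfd E' E incl y₀)) :=
    hT₁.deriv.comp y₀ (hDi y₀)
  have hζW : ∀ᶠ y in 𝓝 y₀, ζ y ∈ W :=
    hζd.continuousAt.eventually_mem (by rw [hζ0]; exact hG.isOpen.mem_nhds ht₀W)
  set zc : L → E := fun y => φ (ζ y) with hzc
  have hzcd : HasMFDerivAt 𝓘(ℝ, E') 𝓘(ℝ, E) zc y₀
      ((mfd E E φ (e₀ t₀)).comp (A₁.comp (mfd E' E incl y₀))) := by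
    have h1 : HasMFDerivAt 𝓘(ℝ, E) 𝓘(ℝ, E) φ (ζ y₀) (mfd E E φ (e₀ t₀)) := by
      rw [hζ0]
      exact (mdifferentiableAt_chart (hG.subset ht₀W)).hasMFDerivAt
    exact h1.comp y₀ hζd
  -- near `y₀`, the return point is given by the local flow
  have hq : ∀ᶠ y in 𝓝 y₀, incl (P y) = G (zc y, σ y) := by
    have hσε : ∀ᶠ y in 𝓝 y₀, σ y ∈ Ioo 0 ε := hσc.eventually_mem (isOpen_Ioo.mem_nhds hσ0)
    filter_upwards [hret, hζW, hσε, hinclS.continuous.continuousAt.eventually hT₁.flow] with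
      y ⟨e, he, hey, heP⟩ hyW hyσ hfl
    have hle : t₀ ≤ τ y := by have := hyσ.1; simp only [hσ] at this; linarith
    have h1 : e t₀ = ζ y := hfl e (he.mono (Icc_subset_Icc_right hle)) hey
    have h2 := hG.eq_of_integral h.smooth_field (he.shift ht₀0 le_rfl)
      (by simpa [h1] using hyW) hyσ.2 (τ y - t₀) ⟨by linarith, le_rfl⟩
    rw [add_sub_cancel, add_zero, h1, heP] at h2
    exact h2
  have hGd : HasMFDerivAt 𝓘(ℝ, E × ℝ) 𝓘(ℝ, E) G (zc y₀, σ y₀)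
      (((A (e₀ t₀) (τ y₀ - t₀)).comp (mfd E E φ.symm (φ (e₀ t₀)))).coprod
        (ContinuousLinearMap.toSpanSingleton ℝ (fieldVal X (incl (P y₀))))) := by
    have h1 := hG.deriv _ ht₀W _ hσ0
    have hz0 : zc y₀ = φ (e₀ t₀) := by simp only [hzc, hζ0]
    have h2 : G (zc y₀, σ y₀) = incl (P y₀) := hq.self_of_nhds.symm
    rw [hz0] at h2 ⊢
    rw [← hφ, h2] at h1
    exact h1
  have hGx : G (zc y₀, σ y₀) = incl (P y₀) := hq.self_of_nhds.symm
  -- `P` is continuous, as the transversal carries the induced topology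
  have hPc : ContinuousAt P y₀ := by
    rw [hincl.isEmbedding.isInducing.continuousAt_iff]
    have h1 : ContinuousAt (fun y => G (zc y, σ y)) y₀ :=
      ContinuousAt.comp (f := fun y => (zc y, σ y)) hGd.continuousAt
        (hzcd.continuousAt.prodMk hσc)
    exact h1.congr (hq.mono fun y hy => hy.symm)
  obtain ⟨π, hπ, hπi, hℓ⟩ := (hincl.isImmersion.isImmersionAt (P y₀)).exists_retraction
  obtain ⟨ℓ, hℓs, hℓ0, hℓX⟩ := hℓ _ htr
  -- the return time is differentiable, by the implicit function theorem applied to a function `ℓ`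
  -- that vanishes on the transversal and has nonzero derivative along `X`
  obtain ⟨σ', hσ'⟩ : ∃ σ' : E' →L[ℝ] ℝ, HasMFDerivAt 𝓘(ℝ, E') 𝓘(ℝ) σ y₀ σ' := by
    set ψ := extChartAt 𝓘(ℝ, E') y₀ with hψ
    have hψs : HasMFDerivAt 𝓘(ℝ, E') 𝓘(ℝ, E') ψ.symm (ψ y₀) (mfd E' E' ψ.symm (ψ y₀)) :=
      (mdifferentiableAt_chart_symm (mem_extChartAt_target y₀)).hasMFDerivAt
    have hψ0 : ψ.symm (ψ y₀) = y₀ := extChartAt_to_inv y₀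
    have hψc : ContinuousAt ψ.symm (ψ y₀) := hψs.continuousAt
    have hz1 : HasFDerivAt (fun q => zc (ψ.symm q))
        (((mfd E E φ (e₀ t₀)).comp (A₁.comp (mfd E' E incl y₀))).comp
          (mfd E' E' ψ.symm (ψ y₀))) (ψ y₀) := by
      have := HasMFDerivAt.comp (ψ y₀) (g := zc) (by rw [hψ0]; exact hzcd) hψs
      exact hasMFDerivAt_iff_hasFDerivAt.1 this
    set z' := (((mfd E E φ (e₀ t₀)).comp (A₁.comp (mfd E' E incl y₀))).comp
          (mfd E' E' ψ.symm (ψ y₀))) with hz'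
    have hpair : HasFDerivAt (fun p : E' × ℝ => (zc (ψ.symm p.1), p.2))
        ((z'.comp (ContinuousLinearMap.fst ℝ E' ℝ)).prod (ContinuousLinearMap.snd ℝ E' ℝ))
        (ψ y₀, σ y₀) :=
      (HasFDerivAt.comp (ψ y₀, σ y₀) (g := fun q => zc (ψ.symm q)) hz1 hasFDerivAt_fst).prodMk
        hasFDerivAt_snd
    have hℓG : HasFDerivAt (fun p : E × ℝ => ℓ (G p))
        ((mfd E ℝ ℓ (incl (P y₀))).comp
        (((A (e₀ t₀) (τ y₀ - t₀)).comp (mfd E E φ.symm (φ (e₀ t₀)))).coprod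
        (ContinuousLinearMap.toSpanSingleton ℝ (fieldVal X (incl (P y₀)))))) (zc y₀, σ y₀) := by
      have h1 : HasMFDerivAt 𝓘(ℝ, E) 𝓘(ℝ) ℓ (G (zc y₀, σ y₀)) (mfd E ℝ ℓ (incl (P y₀))) := by
        rw [hGx]; exact (hℓs.mdifferentiableAt (by simp)).hasMFDerivAt
      exact hasMFDerivAt_iff_hasFDerivAt.1 (h1.comp _ hGd)
    have hf := HasFDerivAt.comp (ψ y₀, σ y₀) (g := fun p : E × ℝ => ℓ (G p))
      (f := fun p : E' × ℝ => (zc (ψ.symm p.1), p.2)) (by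
        change HasFDerivAt _ _ (zc (ψ.symm (ψ y₀)), σ y₀)
        rw [hψ0]; exact hℓG) hpair
    have hf0 : (σ ∘ ψ.symm) (ψ y₀) = σ y₀ := by simp only [Function.comp_apply, hψ0]
    rw [← hf0] at hf
    obtain ⟨s', hs'⟩ := exists_hasFDerivAt_of_implicit hf (by
        change mfd E ℝ ℓ (incl (P y₀)) (A (e₀ t₀) (τ y₀ - t₀) (mfd E E φ.symm (φ (e₀ t₀)) (z' 0)) +
          (1 : ℝ) • fieldVal X (incl (P y₀))) ≠ 0
        rw [map_zero, map_zero, map_zero, zero_add, one_smul]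
        exact hℓX) (ContinuousAt.comp (by rw [hψ0]; exact hσc) hψc) (by
        have h1 : ∀ᶠ y in 𝓝 y₀, ℓ (G (zc y, σ y)) = 0 := by
          filter_upwards [hq, hPc.eventually hℓ0] with y hy1 hy2
          rw [← hy1]; exact hy2
        have h2 : Filter.Tendsto ψ.symm (𝓝 (ψ y₀)) (𝓝 y₀) := by
          have := hψc.tendsto; rwa [hψ0] at this
        exact h2.eventually h1)
    refine ⟨s'.comp (mfd E' E' ψ y₀), ?_⟩
    have h1 : HasMFDerivAt 𝓘(ℝ, E') 𝓘(ℝ) ((σ ∘ ψ.symm) ∘ ψ) y₀ (s'.comp (mfd E' E' ψ y₀)) :=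
      hs'.hasMFDerivAt.comp y₀
        (mdifferentiableAt_chart (E := E') (mem_extChartAt_source y₀)).hasMFDerivAt
    refine h1.congr_of_eventuallyEq ?_
    filter_upwards [extChartAt_source_mem_nhds (I := 𝓘(ℝ, E')) y₀] with y hy
    simp only [Function.comp_apply]
    rw [ψ.left_inv hy]
  have hqd := hGd.comp y₀ (hzcd.prodMk_modelSpace hσ')
  set D : E' →L[ℝ] E := (((A (e₀ t₀) (τ y₀ - t₀)).comp A₁).comp (mfd E' E incl y₀)) +
    σ'.smulRight (fieldVal X (incl (P y₀))) with hD
  have hqd' : HasMFDerivAt 𝓘(ℝ, E') 𝓘(ℝ, E) (fun y => incl (P y)) y₀ D := by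
    have h1 : HasMFDerivAt 𝓘(ℝ, E') 𝓘(ℝ, E) (fun y => G (zc y, σ y)) y₀ D := by
      refine (hqd : HasMFDerivAt 𝓘(ℝ, E') 𝓘(ℝ, E) (fun y => G (zc y, σ y)) y₀ _).congr_mfderiv ?_
      refine ContinuousLinearMap.ext fun u => ?_
      have h3 : ∀ u, mfd E E φ.symm (φ (e₀ t₀)) (mfd E E φ (e₀ t₀) u) = u := fun u =>
        DFunLike.congr_fun (mfd_symm_comp_mfd (E := E) (hG.subset ht₀W)) u
      change A (e₀ t₀) (τ y₀ - t₀) (mfd E E φ.symm (φ (e₀ t₀)) (mfd E E φ (e₀ t₀)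
        (A₁ (mfd E' E incl y₀ u)))) + σ' u • fieldVal X (incl (P y₀)) = D u
      rw [h3]; rfl
    exact h1.congr_of_eventuallyEq hq
  have hPd : MDifferentiableAt 𝓘(ℝ, E') 𝓘(ℝ, E') P y₀ := by
    have h1 : HasMFDerivAt 𝓘(ℝ, E') 𝓘(ℝ, E') (π ∘ fun y => incl (P y)) y₀ _ :=
      HasMFDerivAt.comp y₀ (hπ.mdifferentiableAt (by simp)).hasMFDerivAt hqd'
    refine (h1.congr_of_eventuallyEq ?_).mdifferentiableAt
    filter_upwards [hPc.eventually hπi] with y hy using hy.symm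
  have hDD : ∀ u, mfd E' E incl (P y₀) (mfd E' E' P y₀ u) =
      ((A (e₀ t₀) (τ y₀ - t₀)).comp A₁) (mfd E' E incl y₀ u) +
        σ' u • fieldVal X (incl (P y₀)) := by
    intro u
    have h1 := (hDi (P y₀)).comp y₀ hPd.hasMFDerivAt
    have h2 : (mfd E' E incl (P y₀)).comp (mfd E' E' P y₀) = D :=
      hasMFDerivAt_unique h1 hqd'
    exact DFunLike.congr_fun h2 u
  obtain ⟨k1, k2⟩ := h.scale_add_smul hX1 hT.form hT.twoForm
  refine ⟨hPd, fun u => ?_, fun u w hu hw => ?_⟩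
  · rw [hDD]; exact k1 _ _
  · rw [hDD, hDD]; exact k2 _ _ _ _ hu hw

end Return

/-! ### Eigenvalues of conformally symplectic maps -/

section Spectral

open Module

variable {V : Type*} [AddCommGroup V] [Module ℝ V]

/-- The complexification of a linear form. -/
noncomputable def LinearMap.complexify (b : V →ₗ[ℝ] ℝ) : ℂ ⊗[ℝ] V →ₗ[ℂ] ℂ :=
  (TensorProduct.AlgebraTensorModule.rid ℝ ℂ ℂ).toLinearMap ∘ₗ b.baseChange ℂ

@[simp]
theorem LinearMap.complexify_tmul (b : V →ₗ[ℝ] ℝ) (z : ℂ) (v : V) :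
    b.complexify (z ⊗ₜ v) = b v * z := by
  simp [LinearMap.complexify]

/-- Every vector of the complexification has a real and an imaginary part. -/
theorem exists_eq_re_add_im (x : ℂ ⊗[ℝ] V) :
    ∃ v w : V, x = (1 : ℂ) ⊗ₜ[ℝ] v + Complex.I ⊗ₜ[ℝ] w := by
  induction x with
  | zero => exact ⟨0, 0, by simp⟩
  | tmul z v =>
    refine ⟨z.re • v, z.im • v, ?_⟩
    rw [TensorProduct.tmul_smul, TensorProduct.tmul_smul, TensorProduct.smul_tmul',
      TensorProduct.smul_tmul', ← TensorProduct.add_tmul]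
    congr 1
    apply Complex.ext <;> simp
  | add x y hx hy =>
    obtain ⟨v, w, rfl⟩ := hx
    obtain ⟨v', w', rfl⟩ := hy
    refine ⟨v + v', w + w', ?_⟩
    rw [TensorProduct.tmul_add, TensorProduct.tmul_add]
    abel

theorem LinearMap.complexify_eq_zero_iff (b : V →ₗ[ℝ] ℝ) (v w : V) :
    b.complexify ((1 : ℂ) ⊗ₜ[ℝ] v + Complex.I ⊗ₜ[ℝ] w) = 0 ↔ b v = 0 ∧ b w = 0 := by
  simp [Complex.ext_iff]

/-- If a nonzero linear form is multiplied by `f` under `T`, then `f` is an eigenvalue: otherwise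
`T - f` would be surjective, and the form vanishes on its image. -/
theorem hasEigenvalue_baseChange_of_comp_eq_smul [FiniteDimensional ℝ V] {T : V →ₗ[ℝ] V}
    {b : V →ₗ[ℝ] ℝ} {f : ℝ} (hb : b ≠ 0) (hT : ∀ v, b (T v) = f * b v) :
    Module.End.HasEigenvalue (T.baseChange ℂ : Module.End ℂ (ℂ ⊗[ℝ] V)) (f : ℂ) := by
  by_contra hne
  rw [Module.End.hasEigenvalue_iff, not_not, Module.End.eigenspace_def, LinearMap.ker_eq_bot] at hne
  have hsurj := LinearMap.injective_iff_surjective.1 hne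
  apply hb
  ext v
  obtain ⟨x, hx⟩ := hsurj ((1 : ℂ) ⊗ₜ[ℝ] v)
  obtain ⟨p, q, rfl⟩ := exists_eq_re_add_im x
  have h0 := congrArg b.complexify hx
  simp [hT] at h0
  have : (b v : ℂ) = 0 := by rw [← h0]; ring
  simpa using this

/-- A linear form with factor `f` vanishes on the generalized eigenspaces of the other
eigenvalues. -/
theorem eq_zero_of_mem_maxGenEigenspace {K W : Type*} [Field K] [AddCommGroup W] [Module K W]
    {T : Module.End K W} {b : W →ₗ[K] K} {f μ : K} (hT : ∀ x, b (T x) = f * b x)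
    (hμ : μ ≠ f) {x : W}
    (hx : x ∈ T.maxGenEigenspace μ) : b x = 0 := by
  rw [Module.End.mem_maxGenEigenspace] at hx
  obtain ⟨m, hm⟩ := hx
  have h1 : ∀ (m : ℕ) (x : W), b (((T - μ • (1 : Module.End K W)) ^ m) x) = (f - μ) ^ m * b x := by
    intro m
    induction m with
    | zero => simp
    | succ m ih =>
      intro x
      rw [pow_succ', Module.End.mul_apply]
      simp only [LinearMap.sub_apply, LinearMap.smul_apply, Module.End.one_apply, map_sub, map_smul,
        hT, ih, smul_eq_mul]
      ring
  have h2 := h1 m x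
  rw [hm, map_zero] at h2
  rcases mul_eq_zero.1 h2.symm with h | h
  · exact absurd h (pow_ne_zero m (sub_ne_zero.2 hμ.symm))
  · exact h

/-- Two generalized eigenvectors, with eigenvalues `μ` and `ν`, are orthogonal for a bilinear form
with factor `f ≠ μν` on a subspace containing the generalized eigenspaces. -/
theorem bilin_eq_zero_of_mem_maxGenEigenspace {K W : Type*} [Field K] [AddCommGroup W] [Module K W]
    {T : Module.End K W} {θ : W →ₗ[K] W →ₗ[K] K} {f μ ν : K} (hf : μ * ν ≠ f)
    (hT : ∀ x ∈ T.maxGenEigenspace μ, ∀ y ∈ T.maxGenEigenspace ν, θ (T x) (T y) = f * θ x y)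
    {x y : W} (hx : x ∈ T.maxGenEigenspace μ) (hy : y ∈ T.maxGenEigenspace ν) : θ x y = 0 := by
  have key : ∀ N m n : ℕ, m + n = N → ∀ x y, ((T - μ • (1 : Module.End K W)) ^ m) x = 0 →
      ((T - ν • (1 : Module.End K W)) ^ n) y = 0 → θ x y = 0 := by
    intro N
    induction N with
    | zero =>
      intro m n hmn x y hx hy
      obtain ⟨rfl, rfl⟩ : m = 0 ∧ n = 0 := by omega
      have : x = 0 := by simpa using hx
      rw [this]; simp
    | succ N ih =>
      intro m n hmn x y hx hy
      rcases m with _ | m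
      · have : x = 0 := by simpa using hx
        rw [this]; simp
      rcases n with _ | n
      · have : y = 0 := by simpa using hy
        rw [this]; simp
      have hx' : ((T - μ • (1 : Module.End K W)) ^ m) ((T - μ • (1 : Module.End K W)) x) = 0 := by
        rw [← Module.End.mul_apply, ← pow_succ]; exact hx
      have hy' : ((T - ν • (1 : Module.End K W)) ^ n) ((T - ν • (1 : Module.End K W)) y) = 0 := by
        rw [← Module.End.mul_apply, ← pow_succ]; exact hy
      have e1 := ih m (n + 1) (by omega) _ _ hx' hy
      have e2 := ih (m + 1) n (by omega) _ _ hx hy'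
      have hx'' : ((T - μ • (1 : Module.End K W)) ^ (m + 1))
          ((T - μ • (1 : Module.End K W)) x) = 0 := by
        rw [pow_succ', Module.End.mul_apply, hx', map_zero]
      have e3 := ih (m + 1) n (by omega) _ _ hx'' hy'
      have h0 := hT x ((Module.End.mem_maxGenEigenspace _ _ _).2 ⟨_, hx⟩) y
        ((Module.End.mem_maxGenEigenspace _ _ _).2 ⟨_, hy⟩)
      simp only [LinearMap.sub_apply, LinearMap.smul_apply, Module.End.one_apply, map_sub, map_smul,
        smul_eq_mul] at e1 e2 e3
      have h4 : (f - μ * ν) * θ x y = 0 := by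
        have h5 : θ (T x) (T y) = μ * ν * θ x y := by
          linear_combination e3 + μ * e2 + ν * e1
        rw [sub_mul, ← h0, h5, sub_self]
      exact (mul_eq_zero.1 h4).resolve_left (sub_ne_zero.2 hf.symm)
  obtain ⟨m, hm⟩ := (Module.End.mem_maxGenEigenspace _ _ _).1 hx
  obtain ⟨n, hn⟩ := (Module.End.mem_maxGenEigenspace _ _ _).1 hy
  exact key _ m n rfl x y hm hn

/-- An isotropic subspace of a space of dimension at most `2k`, with a nondegenerate bilinear form,
has dimension at most `k`. -/
theorem finrank_le_of_isotropic {K U : Type*} [Field K] [AddCommGroup U] [Module K U]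
    [FiniteDimensional K U] {k : ℕ} (hU : finrank K U ≤ 2 * k) {B : LinearMap.BilinForm K U}
    (hB : ∀ x, (∀ y, B x y = 0) → x = 0) {W : Submodule K U} (hW : ∀ x ∈ W, ∀ y ∈ W, B x y = 0) :
    finrank K W ≤ k := by
  have hinj : Function.Injective (B.domRestrict W) := by
    rw [← LinearMap.ker_eq_bot, LinearMap.ker_eq_bot']
    intro x hx
    apply Subtype.ext
    exact hB x fun y => DFunLike.congr_fun hx y
  have hle : LinearMap.range (B.domRestrict W) ≤ W.dualAnnihilator := by
    rintro _ ⟨x, rfl⟩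
    rw [Submodule.mem_dualAnnihilator]
    exact fun y hy => hW x x.2 y hy
  have h1 := LinearMap.finrank_range_of_inj hinj
  have h2 : finrank K W ≤ finrank K W.dualAnnihilator := h1 ▸ Submodule.finrank_mono hle
  have h3 : finrank K W + finrank K W.dualAnnihilator = finrank K U :=
    Subspace.finrank_add_finrank_dualAnnihilator_eq W
  omega

/-- The contracting generalized eigenspace of a map that multiplies the nonzero form `b` by `f > 1`,
and the two-form `θ`, nondegenerate on `ker b`, by `f` on `ker b`, has at most half the dimension of
`ker b`: it lies in `ker b` and is isotropic. -/
theorem finrank_contracting_le [FiniteDimensional ℝ V] {k : ℕ} (hV : finrank ℝ V = 2 * k + 1)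
    {T : V →ₗ[ℝ] V} {b : V →ₗ[ℝ] ℝ} {θ : V →ₗ[ℝ] V →ₗ[ℝ] ℝ} {f : ℝ} (hf : 1 < f) (hb : b ≠ 0)
    (hT : ∀ v, b (T v) = f * b v)
    (hTθ : ∀ v w, b v = 0 → b w = 0 → θ (T v) (T w) = f * θ v w)
    (hnd : ∀ v, b v = 0 → (∀ w, b w = 0 → θ v w = 0) → v = 0) :
    finrank ℂ (⨆ μ ∈ {μ : ℂ | ‖μ‖ < 1},
      Module.End.maxGenEigenspace (T.baseChange ℂ : Module.End ℂ (ℂ ⊗[ℝ] V)) μ :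
        Submodule ℂ (ℂ ⊗[ℝ] V)) ≤ k := by
  set TC : Module.End ℂ (ℂ ⊗[ℝ] V) := T.baseChange ℂ with hTC
  set bC := b.complexify with hbC
  set θC : LinearMap.BilinForm ℂ (ℂ ⊗[ℝ] V) := LinearMap.BilinForm.baseChange ℂ θ with hθC
  have hθt : ∀ (z w : ℂ) (v u : V), θC (z ⊗ₜ v) (w ⊗ₜ u) = θ v u * (z * w) := by
    intro z w v u
    rw [hθC, LinearMap.BilinForm.baseChange_tmul]
    simp [mul_comm]
  have hfn : ‖(f : ℂ)‖ = f := by simp [abs_of_pos (by linarith : (0 : ℝ) < f)]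
  have hbT : ∀ x, bC (TC x) = f * bC x := by
    intro x
    obtain ⟨v, w, rfl⟩ := exists_eq_re_add_im x
    simp [hbC, hTC, hT]; ring
  have hker : ∀ μ : ℂ, ‖μ‖ < 1 → TC.maxGenEigenspace μ ≤ LinearMap.ker bC := by
    intro μ hμ x hx
    refine eq_zero_of_mem_maxGenEigenspace hbT ?_ hx
    rintro rfl
    rw [hfn] at hμ
    linarith
  have hθT : ∀ x y, bC x = 0 → bC y = 0 → θC (TC x) (TC y) = f * θC x y := by
    intro x y hx hy
    obtain ⟨v, w, rfl⟩ := exists_eq_re_add_im x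
    obtain ⟨v', w', rfl⟩ := exists_eq_re_add_im y
    obtain ⟨h1, h2⟩ := (b.complexify_eq_zero_iff _ _).1 hx
    obtain ⟨h3, h4⟩ := (b.complexify_eq_zero_iff _ _).1 hy
    simp only [hTC, map_add, LinearMap.baseChange_tmul, LinearMap.add_apply, hθt, hTθ _ _ h1 h3,
      hTθ _ _ h1 h4, hTθ _ _ h2 h3, hTθ _ _ h2 h4]
    push_cast
    ring
  set W : Submodule ℂ (ℂ ⊗[ℝ] V) := ⨆ μ ∈ {μ : ℂ | ‖μ‖ < 1}, TC.maxGenEigenspace μ with hW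
  have hWk : W ≤ LinearMap.ker bC := iSup₂_le fun μ hμ => hker μ hμ
  have hiso : ∀ x ∈ W, ∀ y ∈ W, θC x y = 0 := by
    have h1 : ∀ μ : ℂ, ‖μ‖ < 1 → ∀ x ∈ TC.maxGenEigenspace μ, W ≤ LinearMap.ker (θC x) := by
      intro μ hμ x hx
      refine iSup₂_le fun ν hν y hy => ?_
      refine bilin_eq_zero_of_mem_maxGenEigenspace (f := (f : ℂ)) ?_ ?_ hx hy
      · intro h
        have h2 := congrArg norm h
        rw [norm_mul, hfn] at h2
        have : ‖μ‖ * ‖ν‖ ≤ 1 := mul_le_one₀ hμ.le (norm_nonneg _) (le_of_lt hν)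
        linarith
      · exact fun x hx y hy => hθT x y (hker μ hμ hx) (hker ν hν hy)
    intro x hx y hy
    have h2 : W ≤ LinearMap.ker (θC.flip y) := by
      refine iSup₂_le fun μ hμ x hx => ?_
      exact h1 μ hμ x hx hy
    exact h2 hx
  have hbne : bC ≠ 0 := by
    intro h0
    apply hb
    ext v
    have := LinearMap.congr_fun h0 ((1 : ℂ) ⊗ₜ[ℝ] v)
    simpa [hbC] using this
  have hdim : finrank ℂ (LinearMap.ker bC) ≤ 2 * k := by
    have h1 := LinearMap.finrank_range_add_finrank_ker bC
    have h2 : finrank ℂ (LinearMap.range bC) ≠ 0 := by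
      rw [Ne, Submodule.finrank_eq_zero, LinearMap.range_eq_bot]
      exact hbne
    rw [Module.finrank_baseChange, hV] at h1
    omega
  have h5 := finrank_le_of_isotropic hdim (B := LinearMap.BilinForm.restrict θC (LinearMap.ker bC))
    (W := W.comap (LinearMap.ker bC).subtype) ?_ ?_
  · rwa [(Submodule.comapSubtypeEquivOfLe hWk).finrank_eq] at h5
  · rintro ⟨x, hx⟩ h
    obtain ⟨v, w, rfl⟩ := exists_eq_re_add_im x
    obtain ⟨h1, h2⟩ := (b.complexify_eq_zero_iff _ _).1 hx
    have h3 : ∀ u, b u = 0 → θ v u = 0 ∧ θ w u = 0 := by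
      intro u hu
      have hu' : (1 : ℂ) ⊗ₜ[ℝ] u ∈ LinearMap.ker bC := by simp [hbC, hu]
      have : θC ((1 : ℂ) ⊗ₜ[ℝ] v + Complex.I ⊗ₜ[ℝ] w) ((1 : ℂ) ⊗ₜ[ℝ] u) = 0 := h ⟨_, hu'⟩
      rw [map_add, LinearMap.add_apply, hθt, hθt] at this
      simpa [Complex.ext_iff] using this
    have hv := hnd v h1 fun u hu => (h3 u hu).1
    have hw := hnd w h2 fun u hu => (h3 u hu).2
    apply Subtype.ext
    simp [hv, hw]
  · rintro ⟨x, hx⟩ hx' ⟨y, hy⟩ hy'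
    exact hiso x hx' y hy'

end Spectral

/-! ### Periodic orbits -/

section Extension

variable {E : Type*} [NormedAddCommGroup E] [NormedSpace ℝ E]
  {N : Type*} [TopologicalSpace N] [ChartedSpace E N]
  {X : ∀ x : N, TangentSpace 𝓘(ℝ, E) x} {γ : ℝ → N} {T : ℝ}

/-- The inverse function theorem on the line, with a smooth inverse on a neighbourhood. -/
theorem exists_smooth_local_inverse {q q' : ℝ → ℝ} {t₀ : ℝ}
    (hq : ∀ᶠ t in 𝓝 t₀, HasDerivAt q (q' t) t ∧ ContDiffAt ℝ ∞ q t) (hq' : ContinuousAt q' t₀)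
    (h0 : q' t₀ ≠ 0) : ∃ (B : Set ℝ) (θ : ℝ → ℝ), IsOpen B ∧ q t₀ ∈ B ∧
      ContDiffOn ℝ ∞ θ B ∧ ∀ᶠ t in 𝓝 t₀, θ (q t) = t := by
  obtain ⟨J, hJ, hJo, htJ⟩ := eventually_nhds_iff.1 (hq.and (hq'.eventually_ne h0))
  have hn : (∞ : WithTop ℕ∞) ≠ 0 := by simp
  have hqd : HasFDerivAt q ((ContinuousLinearEquiv.unitsEquivAut ℝ (Units.mk0 _ h0) : ℝ ≃L[ℝ] ℝ) :
      ℝ →L[ℝ] ℝ) t₀ := by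
    have h2 := hq.self_of_nhds.1.hasFDerivAt
    have h3 : ((ContinuousLinearEquiv.unitsEquivAut ℝ (Units.mk0 _ h0) : ℝ ≃L[ℝ] ℝ) : ℝ →L[ℝ] ℝ) =
        ContinuousLinearMap.toSpanSingleton ℝ (q' t₀) := by
      ext; simp
    rw [h3]; exact h2
  set e := hq.self_of_nhds.2.toOpenPartialHomeomorph q hqd hn with he
  have het : t₀ ∈ e.source := hq.self_of_nhds.2.mem_toOpenPartialHomeomorph_source hqd hn
  have hee : ∀ t, e t = q t := fun t => rfl
  refine ⟨e.target ∩ e.symm ⁻¹' J, e.symm, e.isOpen_inter_preimage_symm hJo, ?_, ?_, ?_⟩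
  · refine ⟨e.map_source het, ?_⟩
    change e.symm (e t₀) ∈ J
    rwa [e.left_inv het]
  · intro y hy
    obtain ⟨⟨hd, hc⟩, hne⟩ := hJ _ hy.2
    exact (e.contDiffAt_symm_deriv hne hy.1 hd hc).contDiffWithinAt
  · filter_upwards [e.open_source.mem_nhds het] with t ht using e.left_inv ht

/-- Two parameters of the same point of a periodic orbit differ by a multiple of the period. -/
theorem IsPeriodicOrbit.exists_eq_add (hγ : IsPeriodicOrbit X γ T) {s t : ℝ} (h : γ s = γ t) :
    ∃ n : ℤ, s = t + n * T := by
  have hT := hγ.period_pos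
  have hmod : ∀ r, γ (toIcoMod hT 0 r) = γ r := fun r => hγ.periodic.sub_zsmul_eq _
  have hmem : ∀ r, toIcoMod hT 0 r ∈ Ico 0 T := fun r => by
    simpa using toIcoMod_mem_Ico hT 0 r
  have h1 := hγ.injOn (hmem s) (hmem t) (by rw [hmod, hmod, h])
  refine ⟨toIcoDiv hT 0 s - toIcoDiv hT 0 t, ?_⟩
  simp only [toIcoMod, zsmul_eq_mul] at h1
  push_cast
  linarith

theorem IsPeriodicOrbit.periodic_eq (hγ : IsPeriodicOrbit X γ T) {H : ℝ → ℝ}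
    (hH : Function.Periodic H T) {s t : ℝ} (h : γ s = γ t) : H s = H t := by
  obtain ⟨n, rfl⟩ := hγ.exists_eq_add h
  have := hH.int_mul n t
  simpa using this

theorem IsPeriodicOrbit.range_eq (hγ : IsPeriodicOrbit X γ T) : range γ = γ '' Icc 0 T := by
  have := hγ.periodic.image_Icc hγ.period_pos 0
  rw [zero_add] at this
  exact this.symm

/-- A periodic orbit with a positive minimal period contains no zero of the field: otherwise it
would be constant. -/
theorem IsPeriodicOrbit.ne_zero [IsManifold 𝓘(ℝ, E) ∞ N] [T2Space N] (hX : SmoothField X)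
    (hγ : IsPeriodicOrbit X γ T) (t : ℝ) : X (γ t) ≠ 0 := by
  intro h0
  have hT := hγ.period_pos
  have h1 : IsMIntegralCurveOn (I := 𝓘(ℝ, E)) (fun r => γ (r + t)) X (Icc 0 (T / 2)) :=
    (hγ.integralCurve.comp_add t).isMIntegralCurveOn _
  have h2 : IsMIntegralCurveOn (I := 𝓘(ℝ, E)) (fun _ => γ t) X (Icc 0 (T / 2)) :=
    (isMIntegralCurve_const h0).isMIntegralCurveOn _
  have h3 := h1.eqOn_Icc hX h2 (by simp) (right_mem_Icc.2 (by linarith))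
  obtain ⟨n, hn⟩ := hγ.exists_eq_add h3
  have h4 : (n : ℝ) * T = T / 2 := by linarith
  have h5 : (2 * n : ℝ) = 1 := by
    have : (2 * n - 1 : ℝ) * T = 0 := by linarith
    rcases mul_eq_zero.1 this with h | h <;> linarith
  have h6 : (2 * n : ℤ) = 1 := by exact_mod_cast h5
  omega

variable [IsManifold 𝓘(ℝ, E) ∞ N]

/-- An integral curve is smooth in a chart. -/
theorem IsMIntegralCurve.contDiffAt_chart [CompleteSpace E] (hX : SmoothField X)
    (hγ : IsMIntegralCurve (I := 𝓘(ℝ, E)) γ X) {x₀ : N} {t₀ : ℝ}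
    (ht₀ : γ t₀ ∈ (extChartAt 𝓘(ℝ, E) x₀).source) :
    ContDiffAt ℝ ∞ (extChartAt 𝓘(ℝ, E) x₀ ∘ γ) t₀ ∧
    HasDerivAt (extChartAt 𝓘(ℝ, E) x₀ ∘ γ)
      (chartField X x₀ (extChartAt 𝓘(ℝ, E) x₀ (γ t₀))) t₀ := by
  set φ := extChartAt 𝓘(ℝ, E) x₀ with hφ
  have hev : ∀ᶠ t in 𝓝 t₀, γ t ∈ φ.source :=
    hγ.continuous.continuousAt.eventually_mem ((isOpen_extChartAt_source _).mem_nhds ht₀)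
  obtain ⟨δ, hδ, hsub⟩ := Metric.eventually_nhds_iff.1 hev
  have hmem : ∀ t ∈ Icc (t₀ - δ / 2) (t₀ + δ / 2), γ t ∈ φ.source := by
    intro t ht
    refine hsub ?_
    rw [Real.dist_eq, abs_lt]
    constructor <;> linarith [ht.1, ht.2]
  have hder : ∀ t ∈ Icc (t₀ - δ / 2) (t₀ + δ / 2),
      HasDerivAt (φ ∘ γ) (chartField X x₀ (φ (γ t))) t := by
    intro t ht
    have := (hγ.isMIntegralCurveOn univ).hasDerivWithinAt_chart (mem_univ t) (hmem t ht)
    exact hasDerivWithinAt_univ.1 this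
  refine ⟨?_, hder t₀ ⟨by linarith, by linarith⟩⟩
  have h1 : ContDiffOn ℝ ∞ (φ ∘ γ) (Icc (t₀ - δ / 2) (t₀ + δ / 2)) := by
    refine ODE.contDiffOn_enat_Icc_of_hasDerivWithinAt (f := fun _ => chartField X x₀)
      (u := φ.target) ?_ (fun t ht => (hder t ht).hasDerivWithinAt)
      (fun t ht => φ.map_source (hmem t ht))
    exact (hX.contDiffOn_chartField x₀).comp contDiffOn_snd (fun p hp => hp.2)
  exact h1.contDiffAt (Icc_mem_nhds (by linarith) (by linarith))

/-- Near a point of a regular integral curve, the time is a smooth function of a linear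
coordinate of the chart. -/
theorem IsMIntegralCurve.exists_time_function [CompleteSpace E] (hX : SmoothField X)
    (hγ : IsMIntegralCurve (I := 𝓘(ℝ, E)) γ X) (t₀ : ℝ) (hX0 : X (γ t₀) ≠ 0) :
    ∃ (ℓ : E →L[ℝ] ℝ) (B : Set ℝ) (θ : ℝ → ℝ), IsOpen B ∧
      ℓ (extChartAt 𝓘(ℝ, E) (γ t₀) (γ t₀)) ∈ B ∧ ContDiffOn ℝ ∞ θ B ∧
      ∀ᶠ t in 𝓝 t₀, θ (ℓ (extChartAt 𝓘(ℝ, E) (γ t₀) (γ t))) = t := by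
  have hcont := hγ.continuous
  set φ := extChartAt 𝓘(ℝ, E) (γ t₀) with hφ
  have hv0 : chartField X (γ t₀) (φ (γ t₀)) ≠ 0 := by
    intro h0
    have := mfd_symm_chartField X (mem_extChartAt_target (I := 𝓘(ℝ, E)) (γ t₀))
    rw [← hφ, h0, map_zero, extChartAt_to_inv] at this
    exact hX0 this.symm
  have hchart := fun t (ht : γ t ∈ φ.source) => hγ.contDiffAt_chart hX ht
  obtain ⟨hpc, hpd⟩ := hchart t₀ (mem_extChartAt_source _)
  obtain ⟨ℓ, hℓ⟩ := SeparatingDual.exists_eq_one (R := ℝ) hv0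
  set q : ℝ → ℝ := fun t => ℓ (φ (γ t)) with hq
  have hqd : ∀ t, γ t ∈ φ.source →
      HasDerivAt q (ℓ (chartField X (γ t₀) (φ (γ t)))) t := fun t ht =>
    ℓ.hasFDerivAt.comp_hasDerivAt t (hchart t ht).2
  have hqc : ∀ t, γ t ∈ φ.source → ContDiffAt ℝ ∞ q t := fun t ht =>
    ℓ.contDiff.contDiffAt.comp t (hchart t ht).1
  refine ⟨ℓ, ?_⟩
  refine exists_smooth_local_inverse (q := q) (t₀ := t₀)
    (q' := fun t => ℓ (chartField X (γ t₀) (φ (γ t)))) ?_ ?_ ?_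
  · filter_upwards [hcont.continuousAt.eventually_mem
      (extChartAt_source_mem_nhds (I := 𝓘(ℝ, E)) (γ t₀))] with t ht
    exact ⟨hqd t ht, hqc t ht⟩
  · have h1 : ContinuousAt (chartField X (γ t₀)) (φ (γ t₀)) :=
      ((hX.contDiffOn_chartField (γ t₀)).contDiffAt ((isOpen_extChartAt_target _).mem_nhds
        (mem_extChartAt_target _))).continuousAt
    have h2 : ContinuousAt (fun t => φ (γ t)) t₀ :=
      ContinuousAt.comp (g := φ) (continuousAt_extChartAt (I := 𝓘(ℝ, E)) (γ t₀))
        hcont.continuousAt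
    have h3 : ContinuousAt (fun t => chartField X (γ t₀) (φ (γ t))) t₀ :=
      ContinuousAt.comp (g := chartField X (γ t₀)) h1 h2
    exact ContinuousAt.comp (g := ℓ) ℓ.continuous.continuousAt h3
  · simp only [hℓ]; exact one_ne_zero

/-- A smooth periodic function of the time extends from a periodic orbit to a neighbourhood of
any point of the orbit. -/
theorem IsPeriodicOrbit.exists_local_extension [CompleteSpace E] [T2Space N]
    (hX : SmoothField X) (hγ : IsPeriodicOrbit X γ T) {H : ℝ → ℝ}
    (hH : ContDiff ℝ ∞ H) (hper : Function.Periodic H T) (t₀ : ℝ) :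
    ∃ U ∈ 𝓝 (γ t₀), ∃ g : N → ℝ, ContMDiffOn 𝓘(ℝ, E) 𝓘(ℝ) ∞ g U ∧
      ∀ y ∈ U, ∀ t, γ t = y → g y = H t := by
  have hT := hγ.period_pos
  have hcont := hγ.integralCurve.continuous
  obtain ⟨ℓ, B, θ, hB, hqB, hθc, hθl⟩ :=
    hγ.integralCurve.exists_time_function hX t₀ (hγ.ne_zero hX t₀)
  set φ := extChartAt 𝓘(ℝ, E) (γ t₀) with hφ
  obtain ⟨δ, hδ, hδs⟩ := Metric.eventually_nhds_iff.1 hθl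
  -- on a period around `t₀`, remove the part of the orbit where the time is not close to `t₀`:
  -- it may return to the chart, but not to `γ t₀`
  set K : Set N := γ '' (Icc (t₀ - T / 2) (t₀ + T / 2) \ Ioo (t₀ - δ) (t₀ + δ)) with hK
  have hKc : IsClosed K := ((isCompact_Icc.diff isOpen_Ioo).image hcont).isClosed
  have hxK : γ t₀ ∉ K := by
    rintro ⟨s, ⟨hs1, hs2⟩, hs⟩
    obtain ⟨n, hn⟩ := hγ.exists_eq_add hs
    have h1 : |(n : ℝ)| < 1 := by
      rw [abs_lt]
      constructor <;> nlinarith [hs1.1, hs1.2]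
    have h2 : n = 0 := Int.abs_lt_one_iff.1 (by exact_mod_cast h1)
    rw [h2] at hn
    apply hs2
    simp only [Int.cast_zero, zero_mul, add_zero] at hn
    rw [hn]
    constructor <;> linarith
  set U : Set N := (φ.source ∩ φ ⁻¹' (ℓ ⁻¹' B)) ∩ Kᶜ with hU
  have hUo : IsOpen (φ.source ∩ φ ⁻¹' (ℓ ⁻¹' B)) :=
    (continuousOn_extChartAt (γ t₀)).isOpen_inter_preimage (isOpen_extChartAt_source _)
      (hB.preimage ℓ.continuous)
  refine ⟨U, Filter.inter_mem (hUo.mem_nhds ⟨mem_extChartAt_source _, hqB⟩)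
    (hKc.isOpen_compl.mem_nhds hxK), fun x => H (θ (ℓ (φ x))), ?_, ?_⟩
  · have h1 : ContDiffOn ℝ ∞ (fun y => H (θ (ℓ y))) (ℓ ⁻¹' B) :=
      hH.comp_contDiffOn (hθc.comp ℓ.contDiff.contDiffOn (fun y hy => hy))
    refine ContMDiffOn.comp (t := ℓ ⁻¹' B) h1.contMDiffOn
      ((contMDiffOn_extChartAt (I := 𝓘(ℝ, E)) (n := ∞) (x := γ t₀)).mono (t := U) ?_)
      (fun y hy => hy.1.2)
    intro y hy
    have := hy.1.1
    rwa [hφ, extChartAt_source] at this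
  · rintro y hy t rfl
    have hmem := toIcoMod_mem_Ico hT (t₀ - T / 2) t
    have hγt : γ (toIcoMod hT (t₀ - T / 2) t) = γ t := hγ.periodic.sub_zsmul_eq _
    set t' := toIcoMod hT (t₀ - T / 2) t with ht'
    have h1 : t' ∈ Ioo (t₀ - δ) (t₀ + δ) := by
      by_contra hn
      exact hy.2 ⟨t', ⟨⟨hmem.1, by linarith [hmem.2]⟩, hn⟩, hγt⟩
    have h2 : θ (ℓ (φ (γ t'))) = t' := hδs (by
      rw [Real.dist_eq, abs_lt]; constructor <;> linarith [h1.1, h1.2])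
    change H (θ (ℓ (φ (γ t)))) = H t
    rw [← hγt]
    rw [h2]
    exact hγ.periodic_eq hper hγt

/-- A smooth periodic function of the time extends from a periodic orbit to the manifold, by a
partition of unity. -/
theorem IsPeriodicOrbit.exists_extension [FiniteDimensional ℝ E] [T2Space N]
    [SecondCountableTopology N] (hX : SmoothField X) (hγ : IsPeriodicOrbit X γ T) {H : ℝ → ℝ}
    (hH : ContDiff ℝ ∞ H) (hper : Function.Periodic H T) :
    ∃ h : N → ℝ, ContMDiff 𝓘(ℝ, E) 𝓘(ℝ) ∞ h ∧ ∀ t, h (γ t) = H t := by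
  have hT := hγ.period_pos
  have hcont := hγ.integralCurve.continuous
  have : LocallyCompactSpace N := ChartedSpace.locallyCompactSpace E N
  have hcomp : IsCompact (range γ) := by
    rw [hγ.range_eq]; exact isCompact_Icc.image hcont
  suffices hloc : ∀ x : N, ∃ U ∈ 𝓝 x, ∃ g : N → ℝ, ContMDiffOn 𝓘(ℝ, E) 𝓘(ℝ) ∞ g U ∧
      ∀ y ∈ U, ∀ t, γ t = y → g y = H t by
    have hconv : ∀ x : N, Convex ℝ {r : ℝ | ∀ t, γ t = x → r = H t} := by
      intro x r hr s hs a b _ _ hab t ht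
      rw [hr t ht, hs t ht, smul_eq_mul, smul_eq_mul, ← add_mul, hab, one_mul]
    obtain ⟨h, hh⟩ := exists_contMDiffMap_forall_mem_convex_of_local (n := (⊤ : ℕ∞)) 𝓘(ℝ, E)
      hconv hloc
    exact ⟨h, h.contMDiff, fun t => hh (γ t) t rfl⟩
  intro x
  by_cases hx : x ∈ range γ
  swap
  · exact ⟨(range γ)ᶜ, hcomp.isClosed.isOpen_compl.mem_nhds hx, fun _ => 0, contMDiffOn_const,
      fun y hy t ht => absurd ⟨t, ht⟩ hy⟩
  obtain ⟨t₀, rfl⟩ := hx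
  exact hγ.exists_local_extension hX hH hper t₀

end Extension

/-! ### The mean of the coefficient over a periodic orbit -/

section Averaging

variable {E : Type*} [NormedAddCommGroup E] [NormedSpace ℝ E]
  {N : Type*} [TopologicalSpace N] [ChartedSpace E N]
  {X : ∀ x : N, TangentSpace 𝓘(ℝ, E) x} {γ : ℝ → N} {T : ℝ}

theorem IsMIntegralCurve.hasDerivAt_comp (hγ : IsMIntegralCurve (I := 𝓘(ℝ, E)) γ X) {g : N → ℝ}
    {t : ℝ} (hg : MDifferentiableAt 𝓘(ℝ, E) 𝓘(ℝ) g (γ t)) :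
    HasDerivAt (fun r => g (γ r)) (mfd E ℝ g (γ t) (X (γ t))) t := by
  have h1 := hg.hasMFDerivAt.comp t (hγ t)
  have h2 : HasFDerivAt (fun r => g (γ r)) ((mfd E ℝ g (γ t)).comp
      ((1 : ℝ →L[ℝ] ℝ).smulRight (fieldVal X (γ t)))) t := hasMFDerivAt_iff_hasFDerivAt.1 h1
  refine h2.hasDerivAt.congr_deriv ?_
  change mfd E ℝ g (γ t) ((1 : ℝ) • fieldVal X (γ t)) = _
  rw [one_smul]; rfl

variable [IsManifold 𝓘(ℝ, E) ∞ N]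

theorem IsMIntegralCurve.contMDiff [CompleteSpace E] (hX : SmoothField X)
    (hγ : IsMIntegralCurve (I := 𝓘(ℝ, E)) γ X) : ContMDiff 𝓘(ℝ) 𝓘(ℝ, E) ∞ γ := fun t =>
  contMDiffAt_iff_target.2 ⟨hγ.continuous.continuousAt,
    (hγ.contDiffAt_chart hX (mem_extChartAt_source (γ t))).1.contMDiffAt⟩

/-- The derivative of a smooth function along a smooth field is continuous. -/
theorem SmoothField.continuous_deriv (hX : SmoothField X) {g : N → ℝ}
    (hg : ContMDiff 𝓘(ℝ, E) 𝓘(ℝ) ∞ g) : Continuous fun x => mfd E ℝ g x (X x) := by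
  refine continuous_iff_continuousAt.2 fun x₀ => ?_
  set φ := extChartAt 𝓘(ℝ, E) x₀ with hφ
  have hto : IsOpen φ.target := isOpen_extChartAt_target x₀
  have hxt : φ x₀ ∈ φ.target := mem_extChartAt_target x₀
  have hG : ContDiffOn ℝ ∞ (g ∘ φ.symm) φ.target := by
    rw [← contMDiffOn_iff_contDiffOn]
    exact hg.comp_contMDiffOn (contMDiffOn_extChartAt_symm x₀)
  have h1 : ContinuousOn (fun y => fderiv ℝ (g ∘ φ.symm) y (chartField X x₀ y)) φ.target :=
    (hG.continuousOn_fderiv_of_isOpen hto (by norm_cast)).clm_apply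
      (hX.contDiffOn_chartField x₀).continuousOn
  have h2 : ContinuousAt (fun x => fderiv ℝ (g ∘ φ.symm) (φ x) (chartField X x₀ (φ x))) x₀ :=
    ContinuousAt.comp (g := fun y => fderiv ℝ (g ∘ φ.symm) y (chartField X x₀ y))
      (h1.continuousAt (hto.mem_nhds hxt)) (continuousAt_extChartAt (I := 𝓘(ℝ, E)) x₀)
  refine h2.congr ?_
  filter_upwards [extChartAt_source_mem_nhds (I := 𝓘(ℝ, E)) x₀] with x hx
  have hxt' := φ.map_source hx
  have h3 := mfd_comp (E := E) (E' := E) (E'' := ℝ) (g := g) (f := φ.symm) (x := φ x)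
    ((hg _).mdifferentiableAt (by simp)) (mdifferentiableAt_chart_symm hxt')
  rw [mfd_eq_fderiv] at h3
  rw [h3, ContinuousLinearMap.comp_apply, mfd_symm_chartField X hxt', φ.left_inv hx]

variable {β : DForm E N 1} {c : N → ℝ}

theorem IsCharField.contDiff_coeff_comp [CompleteSpace E] [T2Space N] (h : IsCharField β X c)
    (hγ : IsPeriodicOrbit X γ T) : ContDiff ℝ ∞ fun t => c (γ t) := by
  rw [← contMDiff_iff_contDiff]
  intro t
  exact ContMDiffAt.comp (g := c) t (h.contMDiffAt_coeff (hγ.ne_zero h.smooth_field t))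
    (hγ.integralCurve.contMDiff h.smooth_field t)

/-- If the integral `I` of `c` over the orbit does not vanish, then for some positive smooth
function `g` the function `dg(X) + g c` has the sign of `I` near the orbit: on the orbit, `log g` is
the primitive of the difference between the mean of `c` and `c`. -/
theorem IsCharField.exists_pos_function [FiniteDimensional ℝ E] [T2Space N]
    [SecondCountableTopology N] (h : IsCharField β X c) (hγ : IsPeriodicOrbit X γ T)
    (hI : ∫ t in (0 : ℝ)..T, c (γ t) ≠ 0) :
    ∃ (U : Set N) (g : N → ℝ), IsOpen U ∧ range γ ⊆ U ∧ ContMDiff 𝓘(ℝ, E) 𝓘(ℝ) ∞ g ∧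
      (∀ x, 0 < g x) ∧ ∀ x ∈ U, X x ≠ 0 ∧
        0 < (∫ t in (0 : ℝ)..T, c (γ t)) * (mfd E ℝ g x (X x) + g x * c x) := by
  have hT := hγ.period_pos
  have hcγ := h.contDiff_coeff_comp hγ
  set I := ∫ t in (0 : ℝ)..T, c (γ t) with hIdef
  set H : ℝ → ℝ := fun t => I / T * t - ∫ s in (0 : ℝ)..t, c (γ s) with hH
  have hHd : ∀ t, HasDerivAt H (I / T - c (γ t)) t := fun t =>
    ((hasDerivAt_id t).const_mul (I / T)).congr_deriv (mul_one _) |>.sub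
      (hcγ.continuous.integral_hasStrictDerivAt 0 t).hasDerivAt
  have hHs : ContDiff ℝ ∞ H := by
    rw [contDiff_infty_iff_deriv]
    refine ⟨fun t => (hHd t).differentiableAt, ?_⟩
    rw [funext fun t => (hHd t).deriv]
    exact contDiff_const.sub hcγ
  have hper : Function.Periodic H T := by
    intro t
    have hp : Function.Periodic (fun s => c (γ s)) T := fun s => by simp only [hγ.periodic s]
    have h1 := hp.intervalIntegral_add_eq t 0
    have h2 := intervalIntegral.integral_add_adjacent_intervals
      (hcγ.continuous.intervalIntegrable (μ := MeasureTheory.volume) 0 t)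
      (hcγ.continuous.intervalIntegrable t (t + T))
    rw [zero_add] at h1
    simp only [hH]
    rw [← h2, h1, mul_add, div_mul_cancel₀ _ hT.ne']
    ring
  obtain ⟨u, hu, huγ⟩ := hγ.exists_extension h.smooth_field hHs hper
  have hug : ∀ t, mfd E ℝ u (γ t) (X (γ t)) = I / T - c (γ t) := fun t => by
    refine (hγ.integralCurve.hasDerivAt_comp ((hu (γ t)).mdifferentiableAt (by simp))).unique ?_
    rw [funext huγ]
    exact hHd t
  have hcont : ContinuousOn (fun x => I * (mfd E ℝ u x (X x) + c x)) {x | X x ≠ 0} := by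
    refine continuousOn_const.mul ((h.smooth_field.continuous_deriv hu).continuousOn.add ?_)
    exact fun x hx => (h.contMDiffAt_coeff hx).continuousAt.continuousWithinAt
  refine ⟨{x | X x ≠ 0} ∩ (fun x => I * (mfd E ℝ u x (X x) + c x)) ⁻¹' Ioi 0,
    fun x => Real.exp (u x), hcont.isOpen_inter_preimage h.isOpen_regular isOpen_Ioi, ?_,
    Real.contDiff_exp.contMDiff.comp hu, fun x => Real.exp_pos _, ?_⟩
  · rintro _ ⟨t, rfl⟩
    refine ⟨hγ.ne_zero h.smooth_field t, ?_⟩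
    change 0 < I * (mfd E ℝ u (γ t) (X (γ t)) + c (γ t))
    rw [hug, sub_add_cancel, ← mul_div_assoc]
    exact div_pos (mul_self_pos.2 hI) hT
  · rintro x ⟨hx, hpos⟩
    refine ⟨hx, ?_⟩
    have h1 : mfd E ℝ (fun x => Real.exp (u x)) x (X x) = Real.exp (u x) * mfd E ℝ u x (X x) := by
      have := mfd_comp (E := E) (E' := ℝ) (E'' := ℝ) (g := Real.exp) (f := u) (x := x)
        (Real.contDiff_exp.contMDiff.mdifferentiable (n := ∞) (by simp) _)
        ((hu x).mdifferentiableAt (by simp))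
      have h2 := DFunLike.congr_fun this (X x)
      rw [mfd_eq_fderiv] at h2
      refine h2.trans ?_
      change fderiv ℝ Real.exp (u x) (mfd E ℝ u x (fieldVal X x)) =
        Real.exp (u x) * mfd E ℝ u x (fieldVal X x)
      rw [(Real.hasDerivAt_exp _).hasFDerivAt.fderiv]
      simp [mul_comm]
    rw [h1, ← mul_add, mul_left_comm]
    exact mul_pos (Real.exp_pos _) hpos

/-- Conversely, the sign of `dg(X) + g c` along the orbit, for a positive function `g`, is the sign
of the integral of `c`: divide by `g` and integrate over a period. -/
theorem IsCharField.integral_coeff_pos [CompleteSpace E] [T2Space N]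
    (h : IsCharField β X c) (hγ : IsPeriodicOrbit X γ T) {g : N → ℝ} {σ : ℝ}
    (hg : ∀ t, MDifferentiableAt 𝓘(ℝ, E) 𝓘(ℝ) g (γ t)) (hg0 : ∀ t, 0 < g (γ t))
    (hs : ∀ t, 0 < σ * (mfd E ℝ g (γ t) (X (γ t)) + g (γ t) * c (γ t))) :
    0 < σ * ∫ t in (0 : ℝ)..T, c (γ t) := by
  have hcγ := h.contDiff_coeff_comp hγ
  set F : ℝ → ℝ := fun t => σ * (Real.log (g (γ t)) + ∫ s in (0 : ℝ)..t, c (γ s)) with hF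
  have hFd : ∀ t, HasDerivAt F
      (σ * (mfd E ℝ g (γ t) (X (γ t)) / g (γ t) + c (γ t))) t := fun t =>
    (((hγ.integralCurve.hasDerivAt_comp (hg t)).log (hg0 t).ne').add
      (hcγ.continuous.integral_hasStrictDerivAt 0 t).hasDerivAt).const_mul σ
  have hmono : StrictMono F := by
    refine strictMono_of_deriv_pos fun t => ?_
    rw [(hFd t).deriv]
    have key : ∀ p q r : ℝ, q ≠ 0 → σ * (p + q * r) / q = σ * (p / q + r) := by
      intro p q r hq; field_simp
    exact (div_pos (hs t) (hg0 t)).trans_eq (key _ _ _ (hg0 t).ne')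
  have h0 := hmono hγ.period_pos
  have hT : γ T = γ 0 := by simpa using hγ.periodic 0
  simp only [hF, intervalIntegral.integral_same, hT] at h0
  linarith

end Averaging

/-! ### Hypersurfaces of contact manifolds -/

section Contact

variable {k : ℕ} {M : Type*} [TopologicalSpace M]
  [ChartedSpace (Euc (2 * (k + 1) + 1)) M] [IsManifold 𝓘(ℝ, Euc (2 * (k + 1) + 1)) ∞ M]
  {S : Type*} [TopologicalSpace S]
  [ChartedSpace (Euc (2 * (k + 1))) S] [IsManifold 𝓘(ℝ, Euc (2 * (k + 1))) ∞ S]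
  {α : DForm (Euc (2 * (k + 1) + 1)) M 1} {ι : S → M}
  {Ω : DForm (Euc (2 * (k + 1))) S (2 * (k + 1))} {β : DForm (Euc (2 * (k + 1))) S 1}
  {X : ∀ x : S, TangentSpace 𝓘(ℝ, Euc (2 * (k + 1))) x} {c : S → ℝ}

theorem DirectsCharFoliation.tangent (hX : DirectsCharFoliation Ω β X) (x : S) :
    β.val x ![fieldVal X x] = 0 ∧
      ∀ w, β.val x ![w] = 0 → β.d.val x ![fieldVal X x, w] = 0 := by
  have h : X x ∈ charFoliation β x := by
    rw [hX.spans]; exact Submodule.mem_span_singleton_self _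
  exact h

theorem DirectsCharFoliation.exists_eq_smul (hX : DirectsCharFoliation Ω β X) {x : S}
    {v : Euc (2 * (k + 1))} (hv : β.val x ![v] = 0)
    (h : ∀ w, β.val x ![w] = 0 → β.d.val x ![v, w] = 0) : ∃ r : ℝ, v = r • fieldVal X x := by
  have h1 : v ∈ charFoliation β x := ⟨hv, h⟩
  rw [hX.spans] at h1
  obtain ⟨r, hr⟩ := Submodule.mem_span_singleton.1 h1
  exact ⟨r, hr.symm⟩

/-- At a regular point of a hypersurface of a contact manifold, the restricted one-form `β` does not
vanish, and `(dβ)^k` does not vanish on a complement of the characteristic direction in `ker β`. -/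
theorem DirectsCharFoliation.regular (hX : DirectsCharFoliation Ω β X) (hα : IsContactForm α)
    (hι : Manifold.IsSmoothEmbedding 𝓘(ℝ, Euc (2 * (k + 1))) 𝓘(ℝ, Euc (2 * (k + 1) + 1)) ∞ ι)
    (hβ : β = DForm.pullback ι α) {x : S} (hx : X x ≠ 0) :
    (∃ r, β.val x ![r] ≠ 0) ∧
    ∀ (r : Euc (2 * (k + 1))) (u : Fin (2 * k) → Euc (2 * (k + 1))), (β.val x).toLin r ≠ 0 →
      (∀ i, (β.val x).toLin (u i) = 0) →
      LinearIndependent ℝ (Fin.cons r (Fin.cons (fieldVal X x) u :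
        Fin (2 * k + 1) → Euc (2 * (k + 1))) : Fin (2 * k + 1 + 1) → Euc (2 * (k + 1))) →
      wedgeAlt (β.d.val x).toBilin k u ≠ 0 := by
  have hV : Module.finrank ℝ (Euc (2 * (k + 1) + 1)) = 2 * (k + 1) + 1 := finrank_euclideanSpace_fin
  have hW : Module.finrank ℝ (Euc (2 * (k + 1))) = 2 * (k + 1) := finrank_euclideanSpace_fin
  set j : Euc (2 * (k + 1)) →ₗ[ℝ] Euc (2 * (k + 1) + 1) :=
    (mfd (Euc (2 * (k + 1))) (Euc (2 * (k + 1) + 1)) ι x).toLinearMap with hj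
  have hinj : Function.Injective j := (hι.isImmersion.isImmersionAt x).injective_mfd
  set a := (α.val (ι x)).toLin with ha
  set η := (α.d.val (ι x)).toBilin with hη
  have hb : ∀ w, β.val x ![w] = a (j w) := by
    intro w
    rw [hβ, DForm.val_pullback, ha, ContinuousAlternatingMap.toLin_apply]
    refine congrArg (α.val (ι x)) ?_
    funext i
    fin_cases i
    rfl
  have hθ : ∀ v w, β.d.val x ![v, w] = η (j v) (j w) := by
    intro v w
    rw [hβ, DForm.d_pullback hα.1 (hι.contMDiff x), DForm.val_pullback, hη,
      ContinuousAlternatingMap.toBilin_apply]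
    refine congrArg (α.d.val (ι x)) ?_
    funext i
    fin_cases i <;> rfl
  obtain ⟨v, hv⟩ := hα.2 (ι x)
  have hc : oneWedgeAlt a η (k + 1) v ≠ 0 := by
    have := oneWedgePow_eq (α.val (ι x)) (α.d.val (ι x)) (k + 1) v
    rw [ha, hη, ← this]
    exact hv
  have hker : ∀ w, a (j w) = 0 → η (j (fieldVal X x)) (j w) = 0 := by
    intro w hw
    rw [← hθ]
    exact (hX.tangent x).2 w (by rw [hb, hw])
  have hXa : a (j (fieldVal X x)) = 0 := by rw [← hb]; exact (hX.tangent x).1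
  refine ⟨?_, ?_⟩
  · obtain ⟨w, hw⟩ := covector_ne_zero_of_contact hV hW a η
      (ContinuousAlternatingMap.toBilin_isAlt _) hc j hinj (X := fieldVal X x) hx hker
    exact ⟨w, by rwa [hb]⟩
  · intro r u hr hu hLI
    have h1 := wedgeAlt_ne_zero_of_contact hV hW a η
      (ContinuousAlternatingMap.toBilin_isAlt _) hc j hinj hXa hker (r := r) (u := u)
      (by rwa [← hb]) (fun i => by rw [← hb]; exact hu i) hLI
    have h2 : (β.d.val x).toBilin = η.compl₁₂ j j := by
      refine LinearMap.ext fun v => LinearMap.ext fun w => ?_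
      rw [ContinuousAlternatingMap.toBilin_apply, hθ, LinearMap.compl₁₂_apply]
    rwa [h2]

/-- A field directing the characteristic foliation of a hypersurface of a contact manifold is a
characteristic field of the restricted one-form. -/
theorem DirectsCharFoliation.exists_coeff (hX : DirectsCharFoliation Ω β X) (hα : IsContactForm α)
    (hι : Manifold.IsSmoothEmbedding 𝓘(ℝ, Euc (2 * (k + 1))) 𝓘(ℝ, Euc (2 * (k + 1) + 1)) ∞ ι)
    (hβ : β = DForm.pullback ι α) : ∃ c : S → ℝ, IsCharField β X c := by
  have key : ∀ x, ∃ s : ℝ, X x ≠ 0 →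
      ∀ w, β.d.val x ![fieldVal X x, w] = s * β.val x ![w] := by
    intro x
    by_cases hx : X x = 0
    · exact ⟨0, fun h => absurd hx h⟩
    obtain ⟨r, hr⟩ := (hX.regular hα hι hβ hx).1
    refine ⟨β.d.val x ![fieldVal X x, r] / β.val x ![r], fun _ w => ?_⟩
    -- subtract from `w` its component along `r`
    have h1 := (hX.tangent x).2 (w - (β.val x ![w] / β.val x ![r]) • r) (by
      rw [← ContinuousAlternatingMap.toLin_apply, map_sub, map_smul,
        ContinuousAlternatingMap.toLin_apply, ContinuousAlternatingMap.toLin_apply, smul_eq_mul,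
        div_mul_cancel₀ _ hr, sub_self])
    rw [← ContinuousAlternatingMap.toBilin_apply, map_sub, map_smul,
      ContinuousAlternatingMap.toBilin_apply, ContinuousAlternatingMap.toBilin_apply,
      smul_eq_mul, sub_eq_zero] at h1
    rw [h1]
    ring
  choose c hc using key
  refine ⟨c, hX.smooth, ?_, fun x => (hX.tangent x).1, fun x hx => (hX.regular hα hι hβ hx).1,
    fun x hx => hc x hx⟩
  rw [hβ]
  exact hα.1.pullback hι.contMDiff

/-- The top power of `d(gβ)` is a positive multiple of `(dg(X) + g c) Ω`. -/
theorem DirectsCharFoliation.exists_wedgePow_eq (hX : DirectsCharFoliation Ω β X)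
    (hα : IsContactForm α)
    (hι : Manifold.IsSmoothEmbedding 𝓘(ℝ, Euc (2 * (k + 1))) 𝓘(ℝ, Euc (2 * (k + 1) + 1)) ∞ ι)
    (hβ : β = DForm.pullback ι α) (hc : IsCharField β X c) {x : S} (hx : X x ≠ 0) {g : S → ℝ}
    (hg : ContMDiffAt 𝓘(ℝ, Euc (2 * (k + 1))) 𝓘(ℝ) ∞ g x) (hg0 : 0 < g x) :
    ∃ ρ > 0, ∀ v : Fin (2 * (k + 1)) → Euc (2 * (k + 1)),
      wedgePow ((β.fsmul g).d.val x) (k + 1) v =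
        ρ * (mfd (Euc (2 * (k + 1))) ℝ g x (X x) + g x * c x) * Ω.val x v := by
  have hW : Module.finrank ℝ (Euc (2 * (k + 1))) = 2 * (k + 1) := finrank_euclideanSpace_fin
  obtain ⟨hb, hne⟩ := hX.regular hα hι hβ hx
  have hd := DForm.val_d_fsmul hc.smooth_form hg
  have h1 : ∀ w, ((β.fsmul g).d.val x).toBilin (fieldVal X x) w =
      (mfd (Euc (2 * (k + 1))) ℝ g x (X x) + g x * c x) * (β.val x).toLin w := by
    intro w
    rw [ContinuousAlternatingMap.toBilin_apply, ContinuousAlternatingMap.toLin_apply, hd,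
      (hX.tangent x).1]
    have := hc.interior x hx w
    change mfd (Euc (2 * (k + 1))) ℝ g x (X x) * _ - _ * 0 + g x * β.d.val x ![X x, w] = _
    rw [this]; ring
  have h2 : ∀ v w, (β.val x).toLin v = 0 → (β.val x).toLin w = 0 →
      ((β.fsmul g).d.val x).toBilin v w = g x * (β.d.val x).toBilin v w := by
    intro v w hv hw
    rw [ContinuousAlternatingMap.toLin_apply] at hv hw
    rw [ContinuousAlternatingMap.toBilin_apply, ContinuousAlternatingMap.toBilin_apply, hd, hv, hw]
    ring
  have h3 : ∀ v : Fin (2 * k + 1) → Euc (2 * (k + 1)),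
      0 < oneWedgeAlt (β.val x).toLin (β.d.val x).toBilin k v →
      0 < (Ω.val x).toAlternatingMap (Fin.cons (fieldVal X x) v :
        Fin (2 * k + 1 + 1) → Euc (2 * (k + 1))) := by
    intro v hv
    exact hX.oriented x v (hv.trans_eq (oneWedgePow_eq (β.val x) (β.d.val x) k v).symm)
  obtain ⟨ρ, hρ, h⟩ := exists_wedgeAlt_eq_mul hW (β.val x).toLin (β.d.val x).toBilin
    ((β.fsmul g).d.val x).toBilin (ContinuousAlternatingMap.toBilin_isAlt _)
    (Ω.val x).toAlternatingMap (X := fieldVal X x) hx (hX.tangent x).1 hb hg0 h1 h2 hne h3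
  exact ⟨ρ, hρ, fun v => (wedgePow_eq _ _ v).trans (h v)⟩

end Contact

/-! ### Liouville orbits -/

section LiouvilleOrbits

/-- A two-form whose top power does not vanish is nondegenerate. -/
theorem eq_zero_of_wedgeAlt_ne_zero {W : Type*} [AddCommGroup W] [Module ℝ W]
    [FiniteDimensional ℝ W] {k : ℕ} (hW : Module.finrank ℝ W = 2 * (k + 1))
    {B : W →ₗ[ℝ] W →ₗ[ℝ] ℝ} (hB : B.IsAlt) {v : Fin (2 * (k + 1)) → W}
    (hv : wedgeAlt B (k + 1) v ≠ 0) {x : W} (hx : B x = 0) : x = 0 := by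
  by_contra h0
  obtain ⟨u, hu⟩ := exists_linearIndependent_cons (d := 2 * k + 1) hW.ge h0
  refine (wedgeAlt B (k + 1)).ne_zero_of_linearIndependent hW hv
    (e := (Fin.cons x u : Fin (2 * k + 1 + 1) → W)) hu ?_
  rw [wedgeAlt_cons B hB, hx, oneWedgeAlt_apply]
  simp

/-- A nonzero form of degree at least two takes a positive value. -/
theorem exists_pos_of_ne_zero {W : Type*} [AddCommGroup W] [Module ℝ W] {k : ℕ}
    {f : W [⋀^Fin (2 * (k + 1))]→ₗ[ℝ] ℝ} (h : f ≠ 0) : ∃ v, 0 < f v := by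
  obtain ⟨v, hv⟩ : ∃ v, f v ≠ 0 := by
    by_contra! h0
    exact h (AlternatingMap.ext h0)
  rcases hv.lt_or_gt with h1 | h1
  · have h2 := f.map_swap v (i := ⟨0, by omega⟩) (j := ⟨1, by omega⟩) (by simp)
    exact ⟨_, by rw [h2]; linarith⟩
  · exact ⟨v, h1⟩

variable {k : ℕ} {M : Type*} [TopologicalSpace M]
  [ChartedSpace (Euc (2 * (k + 1) + 1)) M] [IsManifold 𝓘(ℝ, Euc (2 * (k + 1) + 1)) ∞ M]
  {S : Type*} [TopologicalSpace S]
  [ChartedSpace (Euc (2 * (k + 1))) S] [IsManifold 𝓘(ℝ, Euc (2 * (k + 1))) ∞ S]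
  {α : DForm (Euc (2 * (k + 1) + 1)) M 1} {ι : S → M}
  {Ω : DForm (Euc (2 * (k + 1))) S (2 * (k + 1))} {β : DForm (Euc (2 * (k + 1))) S 1}
  {X : ∀ x : S, TangentSpace 𝓘(ℝ, Euc (2 * (k + 1))) x} {c : S → ℝ} {γ : ℝ → S} {T : ℝ}

/-- If the integral of `c` over the orbit does not vanish, then some `d(gβ)` has a top power without
zeros near the orbit. -/
theorem DirectsCharFoliation.isLiouvilleOrbit [T2Space S] [SecondCountableTopology S]
    (hX : DirectsCharFoliation Ω β X) (hα : IsContactForm α)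
    (hι : Manifold.IsSmoothEmbedding 𝓘(ℝ, Euc (2 * (k + 1))) 𝓘(ℝ, Euc (2 * (k + 1) + 1)) ∞ ι)
    (hβ : β = DForm.pullback ι α) (hc : IsCharField β X c) (hΩ : IsVolumeForm Ω)
    (hγ : IsPeriodicOrbit X γ T) (hI : ∫ t in (0 : ℝ)..T, c (γ t) ≠ 0) :
    IsLiouvilleOrbit β γ := by
  obtain ⟨U, g, hU, hγU, hg, hg0, hs⟩ := hc.exists_pos_function hγ hI
  refine ⟨U, g, ⟨hU, hγU, hg.contMDiffOn, fun x _ => hg0 x⟩, fun x hx v hv => ?_⟩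
  obtain ⟨hx0, hs⟩ := hs x hx
  obtain ⟨ρ, hρ, h⟩ := hX.exists_wedgePow_eq hα hι hβ hc hx0 (hg x) (hg0 x)
  obtain ⟨w, hw⟩ : ∃ w, Ω.val x w ≠ 0 := by
    by_contra! h0
    exact hΩ.2 x (ContinuousAlternatingMap.ext h0)
  have h1 : wedgeAlt ((β.fsmul g).d.val x).toBilin (k + 1) w ≠ 0 := by
    rw [← wedgePow_eq, h]
    exact mul_ne_zero (mul_ne_zero hρ.ne' (right_ne_zero_of_mul hs.ne')) hw
  exact eq_zero_of_wedgeAlt_ne_zero finrank_euclideanSpace_fin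
    (ContinuousAlternatingMap.toBilin_isAlt _) h1
    (LinearMap.ext fun w => (ContinuousAlternatingMap.toBilin_apply _ _ _).trans (hv w))

/-- The orbit carries a function `g > 0` for which the top power of `d(gβ)` has the sign of `σ` if
and only if the integral of `c` over the orbit has this sign. -/
theorem DirectsCharFoliation.exists_signed_iff [T2Space S] [SecondCountableTopology S]
    (hX : DirectsCharFoliation Ω β X) (hα : IsContactForm α)
    (hι : Manifold.IsSmoothEmbedding 𝓘(ℝ, Euc (2 * (k + 1))) 𝓘(ℝ, Euc (2 * (k + 1) + 1)) ∞ ι)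
    (hβ : β = DForm.pullback ι α) (hc : IsCharField β X c) (hΩ : IsVolumeForm Ω)
    (hγ : IsPeriodicOrbit X γ T) (σ : ℝ) :
    (∃ (U : Set S) (g : S → ℝ), IsPosFunctionNear (n := k + 1) γ U g ∧
      ∀ x ∈ U, ∀ v : Fin (2 * (k + 1)) → Euc (2 * (k + 1)),
        0 < Ω.val x v → 0 < σ * wedgePow ((β.fsmul g).d.val x) (k + 1) v) ↔
    0 < σ * ∫ t in (0 : ℝ)..T, c (γ t) := by
  constructor
  · rintro ⟨U, g, ⟨hU, hγU, hg, hg0⟩, h⟩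
    have hmem : ∀ t, γ t ∈ U := fun t => hγU ⟨t, rfl⟩
    have hgt : ∀ t, ContMDiffAt 𝓘(ℝ, Euc (2 * (k + 1))) 𝓘(ℝ) ∞ g (γ t) := fun t =>
      hg.contMDiffAt (hU.mem_nhds (hmem t))
    refine hc.integral_coeff_pos hγ (fun t => (hgt t).mdifferentiableAt (by simp))
      (fun t => hg0 _ (hmem t)) fun t => ?_
    obtain ⟨ρ, hρ, h'⟩ := hX.exists_wedgePow_eq hα hι hβ hc (hγ.ne_zero hX.smooth t) (hgt t)
      (hg0 _ (hmem t))
    obtain ⟨v, hv⟩ := exists_pos_of_ne_zero (f := (Ω.val (γ t)).toAlternatingMap) fun h0 =>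
      hΩ.2 (γ t) (ContinuousAlternatingMap.ext fun w => DFunLike.congr_fun h0 w)
    have h1 := h _ (hmem t) v hv
    rw [h'] at h1
    change 0 < Ω.val (γ t) v at hv
    refine pos_of_mul_pos_left (b := ρ * Ω.val (γ t) v) ?_ (by positivity)
    refine h1.trans_eq ?_
    ring
  · intro hσ
    have hI : ∫ t in (0 : ℝ)..T, c (γ t) ≠ 0 := right_ne_zero_of_mul hσ.ne'
    obtain ⟨U, g, hU, hγU, hg, hg0, hs⟩ := hc.exists_pos_function hγ hI
    refine ⟨U, g, ⟨hU, hγU, hg.contMDiffOn, fun x _ => hg0 x⟩, fun x hx v hv => ?_⟩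
    obtain ⟨hx0, hs⟩ := hs x hx
    obtain ⟨ρ, hρ, h⟩ := hX.exists_wedgePow_eq hα hι hβ hc hx0 (hg x) (hg0 x)
    rw [h]
    set I := ∫ t in (0 : ℝ)..T, c (γ t) with hIdef
    set s := mfd (Euc (2 * (k + 1))) ℝ g x (X x) + g x * c x with hsdef
    have h1 : 0 < σ * s := by
      refine pos_of_mul_pos_left (b := I * I) ?_ (mul_self_nonneg I)
      refine (mul_pos hσ hs).trans_eq ?_
      ring
    refine (mul_pos (mul_pos h1 hρ) hv).trans_eq ?_
    ring

theorem DirectsCharFoliation.isPositiveLiouville_iff [T2Space S] [SecondCountableTopology S]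
    (hX : DirectsCharFoliation Ω β X) (hα : IsContactForm α)
    (hι : Manifold.IsSmoothEmbedding 𝓘(ℝ, Euc (2 * (k + 1))) 𝓘(ℝ, Euc (2 * (k + 1) + 1)) ∞ ι)
    (hβ : β = DForm.pullback ι α) (hc : IsCharField β X c) (hΩ : IsVolumeForm Ω)
    (hγ : IsPeriodicOrbit X γ T) :
    IsPositiveLiouville Ω β γ ↔ 0 < ∫ t in (0 : ℝ)..T, c (γ t) := by
  have h := hX.exists_signed_iff hα hι hβ hc hΩ hγ 1
  simp only [one_mul] at h
  exact h

theorem DirectsCharFoliation.isNegativeLiouville_iff [T2Space S] [SecondCountableTopology S]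
    (hX : DirectsCharFoliation Ω β X) (hα : IsContactForm α)
    (hι : Manifold.IsSmoothEmbedding 𝓘(ℝ, Euc (2 * (k + 1))) 𝓘(ℝ, Euc (2 * (k + 1) + 1)) ∞ ι)
    (hβ : β = DForm.pullback ι α) (hc : IsCharField β X c) (hΩ : IsVolumeForm Ω)
    (hγ : IsPeriodicOrbit X γ T) :
    IsNegativeLiouville Ω β γ ↔ ∫ t in (0 : ℝ)..T, c (γ t) < 0 := by
  have h := hX.exists_signed_iff hα hι hβ hc hΩ hγ (-1)
  simp only [neg_one_mul, neg_pos] at h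
  exact h

end LiouvilleOrbits

/-! ### Poincaré return maps of a periodic orbit -/

section ReturnMaps

/-- A vector outside of a hyperplane spans a complement of it. -/
theorem exists_eq_add_smul_of_notMem_range {V W : Type*} [AddCommGroup V] [Module ℝ V]
    [AddCommGroup W] [Module ℝ W] [FiniteDimensional ℝ W] (j : V →ₗ[ℝ] W)
    (hj : Function.Injective j) (hd : Module.finrank ℝ W = Module.finrank ℝ V + 1) {x : W}
    (hx : x ∉ LinearMap.range j) (w : W) : ∃ (u : V) (r : ℝ), w = j u + r • x := by
  have h1 : LinearMap.range j < LinearMap.range j ⊔ Submodule.span ℝ {x} := by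
    refine lt_of_le_of_ne le_sup_left fun h => hx ?_
    rw [h]
    exact Submodule.mem_sup_right (Submodule.mem_span_singleton_self x)
  have h2 := Submodule.finrank_lt_finrank_of_lt h1
  rw [LinearMap.finrank_range_of_inj hj] at h2
  have h3 : LinearMap.range j ⊔ Submodule.span ℝ {x} = ⊤ :=
    Submodule.eq_top_of_finrank_eq (le_antisymm (Submodule.finrank_le _) (by omega))
  obtain ⟨p, ⟨u, rfl⟩, q, hq, hpq⟩ := Submodule.mem_sup.1 (h3 ▸ Submodule.mem_top (x := w))
  obtain ⟨r, rfl⟩ := Submodule.mem_span_singleton.1 hq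
  exact ⟨u, r, hpq.symm⟩

universe v

variable {d : ℕ} {S : Type v} [TopologicalSpace S] [ChartedSpace (Euc (d + 1)) S]
  {X : ∀ x : S, TangentSpace 𝓘(ℝ, Euc (d + 1)) x} {γ : ℝ → S} {T : ℝ}
  {β : DForm (Euc (d + 1)) S 1} {c : S → ℝ}

/-- The tangent space of the transversal is a complement of the direction of the field. -/
theorem ReturnMap.exists_eq_add_smul (R : ReturnMap X γ) (w : Euc (d + 1)) :
    ∃ (u : Euc d) (r : ℝ), w = mfd (Euc d) (Euc (d + 1)) R.incl R.base u +
      r • fieldVal X (R.incl R.base) := by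
  refine exists_eq_add_smul_of_notMem_range
    (mfd (Euc d) (Euc (d + 1)) R.incl R.base).toLinearMap
    ((R.embedding.isImmersion.isImmersionAt R.base).injective_mfd) ?_ ?_ w
  · simp only [finrank_euclideanSpace_fin]
  · rintro ⟨u, hu⟩
    exact R.transverse R.base ⟨u, hu⟩

variable [IsManifold 𝓘(ℝ, Euc (d + 1)) ∞ S]

/-- The restriction of `β` to the transversal does not vanish at the base point. -/
theorem ReturnMap.form_ne_zero (R : ReturnMap X γ) (h : IsCharField β X c) :
    (β.val (R.incl R.base)).toLin ∘ₗ
      (mfd (Euc d) (Euc (d + 1)) R.incl R.base).toLinearMap ≠ 0 := by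
  intro h0
  obtain ⟨w, hw⟩ := h.form_ne_zero (R.incl R.base) fun h0 =>
    R.transverse R.base ⟨0, by rw [h0]; exact map_zero _⟩
  obtain ⟨u, r, rfl⟩ := R.exists_eq_add_smul w
  have h1 : β.val (R.incl R.base) ![fieldVal X (R.incl R.base)] = 0 := h.tangent _
  apply hw
  rw [← ContinuousAlternatingMap.toLin_apply, map_add, map_smul,
    ContinuousAlternatingMap.toLin_apply _ (fieldVal _ _), h1, smul_zero, add_zero]
  exact DFunLike.congr_fun h0 u

/-- The restriction of `dβ` to the kernel of `β` on the transversal is nondegenerate. -/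
theorem ReturnMap.eq_zero_of_forall_d (R : ReturnMap X γ) (h : IsCharField β X c)
    (hspan : ∀ v, β.val (R.incl R.base) ![v] = 0 →
      (∀ w, β.val (R.incl R.base) ![w] = 0 → β.d.val (R.incl R.base) ![v, w] = 0) →
      ∃ r : ℝ, v = r • fieldVal X (R.incl R.base)) {u : Euc d}
    (hu : β.val (R.incl R.base) ![mfd (Euc d) (Euc (d + 1)) R.incl R.base u] = 0)
    (hd : ∀ w, β.val (R.incl R.base) ![mfd (Euc d) (Euc (d + 1)) R.incl R.base w] = 0 →
      β.d.val (R.incl R.base) ![mfd (Euc d) (Euc (d + 1)) R.incl R.base u,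
        mfd (Euc d) (Euc (d + 1)) R.incl R.base w] = 0) : u = 0 := by
  set j := mfd (Euc d) (Euc (d + 1)) R.incl R.base with hj
  set x := R.incl R.base with hx
  have hX0 : X x ≠ 0 := fun h0 => R.transverse R.base ⟨0, by rw [← hx, h0]; exact map_zero _⟩
  have hXb : β.val x ![fieldVal X x] = 0 := h.tangent x
  have hXi : ∀ w, β.d.val x ![fieldVal X x, w] = c x * β.val x ![w] := h.interior x hX0
  obtain ⟨r, hr⟩ := hspan (j u) hu fun w hw => by
    obtain ⟨w', s, rfl⟩ := R.exists_eq_add_smul w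
    rw [← hj, ← hx] at hw ⊢
    rw [← ContinuousAlternatingMap.toLin_apply, map_add, map_smul,
      ContinuousAlternatingMap.toLin_apply, ContinuousAlternatingMap.toLin_apply, hXb, smul_zero,
      add_zero] at hw
    have h1 : β.d.val x ![j u, fieldVal X x] = 0 := by
      have := (β.d.val x).toBilin_isAlt.neg (fieldVal X x) (j u)
      rw [ContinuousAlternatingMap.toBilin_apply, ContinuousAlternatingMap.toBilin_apply, hXi, hu,
        mul_zero, neg_zero] at this
      exact this.symm
    rw [← ContinuousAlternatingMap.toBilin_apply, map_add, map_smul,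
      ContinuousAlternatingMap.toBilin_apply, ContinuousAlternatingMap.toBilin_apply, hd w' hw, h1,
      smul_zero, add_zero]
  have hinj : Function.Injective j := (R.embedding.isImmersion.isImmersionAt R.base).injective_mfd
  have hr0 : r = 0 := by
    by_contra hr0
    refine R.transverse R.base ⟨r⁻¹ • u, ?_⟩
    change j (r⁻¹ • u) = fieldVal X x
    rw [map_smul, hr, smul_smul, inv_mul_cancel₀ hr0, one_smul]
  refine hinj ?_
  rw [hr, hr0, zero_smul, map_zero]

variable [T2Space S]

/-- The orbit closes up at its first return, so that the base point is fixed and its return time is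
the period. -/
theorem ReturnMap.return_base (R : ReturnMap X γ) (hX : SmoothField X)
    (hγ : IsPeriodicOrbit X γ T) : R.P R.base = R.base ∧ R.τ R.base = T ∧
      ∃ t₁, ∀ e : ℝ → S, IsMIntegralCurveOn (I := 𝓘(ℝ, Euc (d + 1))) e X (Icc 0 T) →
        e 0 = R.incl R.base → ∀ t ∈ Icc 0 T, e t = γ (t + t₁) := by
  obtain ⟨t₁, ht₁⟩ := (R.meets_once R.base).2 rfl
  have huniq : ∀ (s : ℝ) (e : ℝ → S),
      IsMIntegralCurveOn (I := 𝓘(ℝ, Euc (d + 1))) e X (Icc 0 s) →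
      e 0 = R.incl R.base → ∀ t ∈ Icc 0 s, e t = γ (t + t₁) := fun s e he he0 =>
    he.eqOn_Icc hX ((hγ.integralCurve.comp_add t₁).isMIntegralCurveOn _) (by simp [he0, ht₁])
  obtain ⟨e, he, he0, heτ, hfirst⟩ := R.first_return R.base R.base_mem
  have hτ := R.τ_pos R.base R.base_mem
  have heq := huniq _ e he he0
  have hP : R.P R.base = R.base := by
    rw [← R.meets_once, ← heτ, heq _ ⟨hτ.le, le_rfl⟩]
    exact mem_range_self _
  have hT := hγ.period_pos
  have hτT : R.τ R.base = T := by
    have h1 : γ (R.τ R.base + t₁) = γ t₁ := by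
      rw [← heq _ ⟨hτ.le, le_rfl⟩, heτ, hP, ht₁]
    obtain ⟨n, hn⟩ := hγ.exists_eq_add h1
    have h2 : R.τ R.base = n * T := by linarith
    have h3 : (0 : ℝ) < n := by
      by_contra! h
      have := mul_nonpos_of_nonpos_of_nonneg h hT.le
      linarith
    have h4 : (1 : ℝ) ≤ n := by
      have : 0 < n := by exact_mod_cast h3
      exact_mod_cast this
    refine le_antisymm ?_ (by nlinarith)
    -- the orbit is back at the base point at time `T`, so the first return is not later
    by_contra! hlt
    refine hfirst T ⟨hT, hlt⟩ ⟨R.base, ?_⟩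
    rw [heq T ⟨hT.le, hlt.le⟩, add_comm, hγ.periodic, ht₁]
  exact ⟨hP, hτT, t₁, huniq T⟩

/-- A return map rescales `β|_L`; at the base point the factor is the exponential of the integral of
`c` over the orbit, and the restriction of `dβ` to `ker β|_L` is multiplied by the same factor. -/
theorem IsCharField.exists_isConformalFactor (h : IsCharField β X c) (hγ : IsPeriodicOrbit X γ T)
    (R : ReturnMap X γ) : ∃ f : R.L → ℝ, R.IsConformalFactor β f ∧
      f R.base = Real.exp (∫ t in (0 : ℝ)..T, c (γ t)) ∧
      (∀ u, β.val (R.incl R.base) ![mfd (Euc d) (Euc (d + 1)) R.incl R.base (R.TP u)] =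
        f R.base * β.val (R.incl R.base) ![mfd (Euc d) (Euc (d + 1)) R.incl R.base u]) ∧
      ∀ u w, β.val (R.incl R.base) ![mfd (Euc d) (Euc (d + 1)) R.incl R.base u] = 0 →
        β.val (R.incl R.base) ![mfd (Euc d) (Euc (d + 1)) R.incl R.base w] = 0 →
        β.d.val (R.incl R.base) ![mfd (Euc d) (Euc (d + 1)) R.incl R.base (R.TP u),
          mfd (Euc d) (Euc (d + 1)) R.incl R.base (R.TP w)] =
        f R.base * β.d.val (R.incl R.base) ![mfd (Euc d) (Euc (d + 1)) R.incl R.base u,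
          mfd (Euc d) (Euc (d + 1)) R.incl R.base w] := by
  have : Nonempty S := ⟨γ 0⟩
  choose! e he he0 heτ hfirst using R.first_return
  have hX0 : ∀ y, X (R.incl y) ≠ 0 := fun y h0 =>
    R.transverse y ⟨0, by rw [h0]; exact map_zero _⟩
  have hmain := fun y (hy : y ∈ R.V) => h.return_map R.embedding (P := R.P) (τ := R.τ)
    (R.τ_cont.continuousAt (R.isOpen_V.mem_nhds hy)) (R.τ_pos y hy)
    (Filter.eventually_of_mem (R.isOpen_V.mem_nhds hy)
      fun z hz => ⟨e z, he z hz, he0 z hz, heτ z hz⟩)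
    (he y hy) (he0 y hy) (heτ y hy) (hX0 y) (R.transverse (R.P y))
  obtain ⟨hP, hτ, t₁, ht₁⟩ := R.return_base h.smooth_field hγ
  obtain ⟨-, hb1, hb2⟩ := hmain R.base R.base_mem
  rw [hP] at hb1 hb2
  refine ⟨fun y => Real.exp (∫ t in (0 : ℝ)..R.τ y, c (e y t)), ?_, ?_, hb1, hb2⟩
  · intro y hy
    obtain ⟨h1, h2, -⟩ := hmain y hy
    refine ⟨Real.exp_pos _, h1, ContinuousAlternatingMap.ext fun v => ?_⟩
    have hv : ∀ (F : Euc d → Euc (d + 1)), (fun i => F (v i)) = ![F (v 0)] := by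
      intro F; funext i; fin_cases i; rfl
    have h3 := h2 (v 0)
    rw [← hv fun u => mfd (Euc d) (Euc (d + 1)) R.incl (R.P y) (mfd (Euc d) (Euc d) R.P y u),
      ← hv fun u => mfd (Euc d) (Euc (d + 1)) R.incl y u] at h3
    exact h3
  · change Real.exp (∫ t in (0 : ℝ)..R.τ R.base, c (e R.base t)) = _
    congr 1
    have hp : Function.Periodic (fun s => c (γ s)) T := fun s => by simp only [hγ.periodic s]
    have hb := he R.base R.base_mem
    rw [hτ] at hb ⊢
    have h1 : ∫ t in (0 : ℝ)..T, c (e R.base t) = ∫ t in (0 : ℝ)..T, c (γ (t + t₁)) := by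
      refine intervalIntegral.integral_congr fun t ht => ?_
      rw [uIcc_of_le hγ.period_pos.le] at ht
      simp only [ht₁ _ hb (he0 _ R.base_mem) t ht]
    rw [h1, intervalIntegral.integral_comp_add_right (fun s => c (γ s)), zero_add, add_comm T,
      hp.intervalIntegral_add_eq t₁ 0, zero_add]

/-- The factor of a return map at the base point is an eigenvalue of its differential; for a
hyperbolic orbit it is not `1`. -/
theorem IsCharField.integral_ne_zero_of_hyperbolic (h : IsCharField β X c)
    (hγ : IsPeriodicOrbit X γ T) (hyp : IsHyperbolicOrbit X γ) :
    ∫ t in (0 : ℝ)..T, c (γ t) ≠ 0 := by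
  intro h0
  obtain ⟨R, hR⟩ := hyp
  obtain ⟨f, -, hf, hT, -⟩ := h.exists_isConformalFactor hγ R
  have h1 := hasEigenvalue_baseChange_of_comp_eq_smul (T := R.TP) (R.form_ne_zero h) hT
  have h2 := (hR _ h1).2
  rw [hf, h0, Real.exp_zero] at h2
  simp at h2

end ReturnMaps

/-- Write `n = k + 1`. `M` is a contact manifold of dimension `2n + 1`, `S` a hypersurface of
dimension `2n` oriented by `Ω`, `β = ι^* α`, and `γ` is a hyperbolic periodic orbit of the
characteristic foliation, directed by `X`. -/
theorem mainTheorem2 (k : ℕ)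
    {M : Type*} [TopologicalSpace M] [T2Space M] [SecondCountableTopology M]
    [ChartedSpace (Euc (2 * (k + 1) + 1)) M] [IsManifold 𝓘(ℝ, Euc (2 * (k + 1) + 1)) ∞ M]
    {S : Type u} [TopologicalSpace S] [T2Space S] [SecondCountableTopology S]
    [ChartedSpace (Euc (2 * (k + 1))) S] [IsManifold 𝓘(ℝ, Euc (2 * (k + 1))) ∞ S]
    (α : DForm (Euc (2 * (k + 1) + 1)) M 1) (hα : IsContactForm α)
    (ι : S → M)
    (hι : Manifold.IsSmoothEmbedding 𝓘(ℝ, Euc (2 * (k + 1))) 𝓘(ℝ, Euc (2 * (k + 1) + 1)) ∞ ι)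
    (Ω : DForm (Euc (2 * (k + 1))) S (2 * (k + 1))) (hΩ : IsVolumeForm Ω)
    (β : DForm (Euc (2 * (k + 1))) S 1) (hβ : β = DForm.pullback ι α)
    (X : ∀ x : S, TangentSpace 𝓘(ℝ, Euc (2 * (k + 1))) x)
    (hX : DirectsCharFoliation Ω β X)
    (γ : ℝ → S) (T : ℝ) (hγ : IsPeriodicOrbit X γ T)
    (hyp : IsHyperbolicOrbit (d := 2 * k + 1) X γ) :
    IsLiouvilleOrbit β γ ∧
    (∀ R : ReturnMap (d := 2 * k + 1) X γ, ∃ f : R.L → ℝ,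
      R.IsConformalFactor β f ∧ f R.base ≠ 1 ∧
      (1 < f R.base ↔ IsPositiveLiouville Ω β γ) ∧
      (f R.base < 1 ↔ IsNegativeLiouville Ω β γ)) ∧
    (IsPositiveLiouville Ω β γ → ∀ R : ReturnMap (d := 2 * k + 1) X γ, R.index ≤ k + 1) := by
  obtain ⟨c, hc⟩ := hX.exists_coeff hα hι hβ
  have hI := hc.integral_ne_zero_of_hyperbolic hγ hyp
  refine ⟨hX.isLiouvilleOrbit hα hι hβ hc hΩ hγ hI, fun R => ?_, fun hpos R => ?_⟩
  · obtain ⟨f, hf, hfb, -⟩ := hc.exists_isConformalFactor hγ R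
    refine ⟨f, hf, ?_, ?_, ?_⟩
    · rw [hfb, Ne, Real.exp_eq_one_iff]
      exact hI
    · rw [hfb, Real.one_lt_exp_iff, hX.isPositiveLiouville_iff hα hι hβ hc hΩ hγ]
    · rw [hfb, Real.exp_lt_one_iff, hX.isNegativeLiouville_iff hα hι hβ hc hΩ hγ]
  · rw [hX.isPositiveLiouville_iff hα hι hβ hc hΩ hγ] at hpos
    obtain ⟨f, -, hfb, hb, hθ⟩ := hc.exists_isConformalFactor hγ R
    have hf1 : 1 < f R.base := by rwa [hfb, Real.one_lt_exp_iff]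
    -- `T_{x₀}P` is conformally symplectic on `ker β|_L`, with factor larger than `1`
    set j := mfd (Euc (2 * k + 1)) (Euc (2 * k + 1 + 1)) R.incl R.base with hj
    refine Nat.succ_le_succ (finrank_contracting_le finrank_euclideanSpace_fin (T := R.TP)
      (b := (β.val (R.incl R.base)).toLin ∘ₗ j.toLinearMap)
      (θ := (β.d.val (R.incl R.base)).toBilin.compl₁₂ j.toLinearMap j.toLinearMap)
      hf1 (R.form_ne_zero hc) hb hθ fun u hu hd => ?_)
    exact R.eq_zero_of_forall_d hc (fun v hv h => hX.exists_eq_smul hv h) hu hd
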